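/- Let $F_\chi$ be the Fock space of the modes $\chi_a$, $a\in\mathbb Z+\frac12$, with $[\chi_a,\chi_b]=(-1)^{a-\frac12}\delta_{a,-b}$: the complex vacuum module generated by a vector $|0\rangle$ with $\chi_a|0\rangle=0$ for all $a>0$. Put $h_n=\frac12\sum_{a+b=2n}:\!\chi_a\chi_b\!:$ for $n\in\mathbb Z$ (the untwisted Heisenberg modes), and $L_0=\frac12\sum_{a>0}(-1)^{a-\frac12}\,a\,\chi_{-a}\chi_a$. Let $F^{hwv}_\chi\subset F_\chi$ be the span of the highest weight vectors of the untwisted Heisenberg algebra, i.e. of the nonzero eigenvectors $v$ of $h_0$ with $h_nv=0$ for all $n>0$. Then $F^{hwv}_\chi$ is the direct sum of the joint eigenspaces of $2L_0$ and $h_0$ on it, with eigenvalues $(d,m)\in\frac12\mathbb Z_{\ge0}\times\mathbb Z$; these are finite-dimensional, and for each $d$ only finitely many are nonzero. Its character $$\dim_{q,z}F^{hwv}_\chi=\operatorname{tr}_{F^{hwv}_\chi}q^{2L_0}z^{h_0}$$ (the coefficient of $q^dz^m$ is the dimension of the joint eigenspace for $(d,m)$) is equal, as a formal power series in $q^{1/2}$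 with coefficients Laurent polynomials in $z$, to each of the following, where all infinite sums and products converge formally (coefficientwise). (1) $\displaystyle\sum_{n\ge0}\sum_{m\in\mathbb Z}\sum_{l\ge0}N'(m-l,n)\,z^m q^{2n+\frac m2}$, where for $n\neq1$ $N'(m,n)$ is the number of partitions of $n$ with crank $m$, while $N'(\pm1,1)=1$, $N'(0,1)=-1$ and $N'(m,1)=0$ for $|m|\ge2$. The crank of a partition with $\omega$ parts equal to $1$ is its largest part if $\omega=0$ ($0$ for the empty partition), and the number of parts larger than $\omega$, minus $\omega$, if $\omega>0$. (2) $\displaystyle\sum_{(\pi_1|\pi_2)}q^{\mathcal W(\pi_1|\pi_2)}z^{\#\pi_2-\#\pi_1}$, over all pairs of partitions, each with distinct positive integer parts, where $\#\pi$ is the number of parts of $\pi$, $|\pi|$ is their sum, and, with $n=\#\pi_1$ and $s=\#\pi_2$, $\mathcal W(\pi_1|\pi_2)=2|\pi_1|+2|\pi_2|+2ns-\frac{n(2n-1)}2-\frac{s(2s+1)}2$. (3) $\displaystyle\prod_{n\ge1}\frac{1-q^{2n}}{(1-zq^{2n-\frac32})(1-z^{-1}q^{2n-\frac12})}$. (4)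 $\displaystyle\frac{\prod_{l\ge1}(1+zq^{2l-\frac32})\prod_{l\ge1}(1+z^{-1}q^{2l-\frac12})}{2\prod_{i\ge1}(1-q^{4i})(1+q^{2i})}\left(\sum_{k\ge0}\frac{z^kq^{\frac k2}}{1+z^{-1}q^{2k+\frac32}}+\sum_{k\ge0}\frac{z^{-k}q^{\frac{3k}2}}{1+zq^{2k+\frac12}}\right)$. -/

import Mathlib

open scoped LaurentPolynomial PowerSeries PowerSeries.WithPiTopology

noncomputable section

namespace CKP

/-! ## The Fock space

The mode `χ_a`, `a ∈ ℤ + 1/2`, is indexed by the integer `j` with `a = j + 1/2`. In particular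
`χ_a` with `a > 0` corresponds to `0 ≤ j`, and `χ_{-a}` corresponds to the integer `-j - 1`. -/

/-- The scalar `(-1)^(a - 1/2) δ_{a, -b}`, for `a = j + 1/2` and `b = k + 1/2`. -/
def bracket (j k : ℤ) : ℂ := if j + k = -1 then (-1 : ℂ) ^ j else 0

/-- The commutation relations `[χ_a, χ_b] = (-1)^(a - 1/2) δ_{a, -b}`. -/
inductive ModeRel : FreeAlgebra ℂ ℤ → FreeAlgebra ℂ ℤ → Prop
  | comm (j k : ℤ) :
      ModeRel (FreeAlgebra.ι ℂ j * FreeAlgebra.ι ℂ k)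
        (FreeAlgebra.ι ℂ k * FreeAlgebra.ι ℂ j + algebraMap ℂ (FreeAlgebra ℂ ℤ) (bracket j k))

/-- The associative algebra generated by the modes: the enveloping algebra of the Lie algebra of
modes, in which the central element is identified with the unit. -/
def ModeAlgebra : Type := RingQuot ModeRel

instance instRingModeAlgebra : Ring ModeAlgebra := inferInstanceAs (Ring (RingQuot ModeRel))

instance instAlgebraModeAlgebra : Algebra ℂ ModeAlgebra :=
  inferInstanceAs (Algebra ℂ (RingQuot ModeRel))

/-- The quotient map from the free algebra. -/
def toModeAlgebra : FreeAlgebra ℂ ℤ →ₐ[ℂ] ModeAlgebra := RingQuot.mkAlgHom ℂ ModeRel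

/-- The generator `χ_{j + 1/2}` of the mode algebra. -/
def mode (j : ℤ) : ModeAlgebra := toModeAlgebra (FreeAlgebra.ι ℂ j)

/-- The left ideal generated by the `χ_a` with `a > 0`. -/
def vacuumIdeal : Submodule ModeAlgebra ModeAlgebra :=
  Submodule.span ModeAlgebra {x | ∃ j : ℤ, 0 ≤ j ∧ x = mode j}

/-- The Fock space `F_χ`: the induced vacuum module. -/
def Fock : Type := ModeAlgebra ⧸ vacuumIdeal

instance instAddCommGroupFock : AddCommGroup Fock :=
  inferInstanceAs (AddCommGroup (ModeAlgebra ⧸ vacuumIdeal))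

instance instModuleModeAlgebraFock : Module ModeAlgebra Fock :=
  inferInstanceAs (Module ModeAlgebra (ModeAlgebra ⧸ vacuumIdeal))

instance instModuleFock : Module ℂ Fock := Module.compHom Fock (algebraMap ℂ ModeAlgebra)

instance instIsScalarTowerFock : IsScalarTower ℂ ModeAlgebra Fock where
  smul_assoc c x v := by
    rw [Algebra.smul_def, mul_smul]
    rfl

/-- The vacuum vector. -/
def vac : Fock := vacuumIdeal.mkQ 1

/-- The operator `χ_{j + 1/2}` on the Fock space. -/
def chi (j : ℤ) : Module.End ℂ Fock := Algebra.lsmul ℂ ℂ Fock (mode j)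

theorem mode_comm (j k : ℤ) :
    mode j * mode k = mode k * mode j + algebraMap ℂ ModeAlgebra (bracket j k) := by
  have h : toModeAlgebra _ = toModeAlgebra _ := RingQuot.mkAlgHom_rel ℂ (ModeRel.comm j k)
  rw [map_mul, map_add, map_mul, AlgHom.commutes] at h
  exact h

theorem chi_apply (j : ℤ) (v : Fock) : chi j v = mode j • v := rfl

theorem chi_comm (j k : ℤ) (v : Fock) : chi j (chi k v) = chi k (chi j v) + bracket j k • v := by
  simp only [chi_apply, smul_smul, mode_comm j k, add_smul, algebraMap_smul]

theorem smul_vac (x : ModeAlgebra) : x • vac = vacuumIdeal.mkQ x := by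
  have h : x • vac = vacuumIdeal.mkQ (x • 1) := (map_smul vacuumIdeal.mkQ x 1).symm
  rw [h, smul_eq_mul, mul_one]

theorem chi_vac (j : ℤ) (hj : 0 ≤ j) : chi j vac = 0 := by
  have h : mode j ∈ vacuumIdeal := Submodule.subset_span ⟨j, hj, rfl⟩
  rw [chi_apply, smul_vac]
  exact (Submodule.Quotient.mk_eq_zero _).2 h

/-- Every vector is annihilated by all but finitely many of the `χ_a` with `a > 0`. -/
theorem exists_chi_eq_zero (v : Fock) : ∃ N : ℤ, ∀ j, N ≤ j → chi j v = 0 := by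
  obtain ⟨x, hx⟩ := Submodule.mkQ_surjective vacuumIdeal v
  obtain ⟨w, hw⟩ : ∃ w, toModeAlgebra w = x := RingQuot.mkAlgHom_surjective ℂ ModeRel x
  have key : ∀ u : Fock, (∃ N : ℤ, ∀ j, N ≤ j → chi j u = 0) →
      ∃ N : ℤ, ∀ j, N ≤ j → chi j (toModeAlgebra w • u) = 0 := by
    clear hw
    induction w using FreeAlgebra.induction with
    | grade0 r =>
      rintro u ⟨N, hN⟩
      refine ⟨N, fun j hj => ?_⟩
      rw [AlgHom.commutes, algebraMap_smul, map_smul, hN j hj, smul_zero]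
    | grade1 k =>
      rintro u ⟨N, hN⟩
      refine ⟨max N (-k), fun j hj => ?_⟩
      have h1 : N ≤ j := le_trans (le_max_left _ _) hj
      have h2 : -k ≤ j := le_trans (le_max_right _ _) hj
      have h3 : bracket j k = 0 := by
        unfold bracket
        rw [if_neg (by omega)]
      have h4 := chi_comm j k u
      rw [hN j h1, h3, map_zero, zero_smul, add_zero] at h4
      exact h4
    | mul a b ha hb =>
      intro u hu
      have := ha _ (hb u hu)
      simpa only [map_mul, mul_smul] using this
    | add a b ha hb =>
      intro u hu
      obtain ⟨N, hN⟩ := ha u hu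
      obtain ⟨M, hM⟩ := hb u hu
      refine ⟨max N M, fun j hj => ?_⟩
      rw [map_add, add_smul, map_add, hN j (le_trans (le_max_left _ _) hj),
        hM j (le_trans (le_max_right _ _) hj), add_zero]
  have h := key vac ⟨0, fun j hj => chi_vac j hj⟩
  rwa [smul_vac, hw, hx] at h

/-! ## Heisenberg modes and grading operators -/

/-- The sum of a locally finite family of operators. -/
def locSum {ι : Type} (f : ι → Module.End ℂ Fock) (hf : ∀ v, {i | f i v ≠ 0}.Finite) :
    Module.End ℂ Fock where
  toFun v := ∑ᶠ i, f i v
  map_add' v w := by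
    simp only [map_add]
    exact finsum_add_distrib (hf v) (hf w)
  map_smul' c v := by
    simp only [map_smul, RingHom.id_apply]
    exact (smul_finsum' c (hf v)).symm

/-- The normally ordered product `:χ_a χ_b:` for `a = j + 1/2`, `b = k + 1/2`. -/
def normalOrdered (j k : ℤ) : Module.End ℂ Fock :=
  if j < 0 then chi j * chi k else chi k * chi j

theorem normalOrdered_locFinite (n : ℤ) (v : Fock) :
    {j : ℤ | normalOrdered j (2 * n - 1 - j) v ≠ 0}.Finite := by
  obtain ⟨N, hN⟩ := exists_chi_eq_zero v
  refine (Set.finite_Icc (min 0 (2 * n - 1 - N)) (max 0 N)).subset fun j hj => ?_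
  have hj' : normalOrdered j (2 * n - 1 - j) v ≠ 0 := hj
  rw [Set.mem_Icc]
  by_contra hcon
  apply hj'
  unfold normalOrdered
  by_cases h0 : j < 0
  · rw [if_pos h0, Module.End.mul_apply, hN _ (by omega), map_zero]
  · rw [if_neg h0, Module.End.mul_apply, hN _ (by omega), map_zero]

/-- The Heisenberg mode `h_n`, `n ∈ ℤ`: the coefficient of `z ^ (-2n - 2)` in
`(1 / 4z) (:χ(z)χ(z): - :χ(-z)χ(-z):)`, that is `(1/2) ∑_{a + b = 2n} :χ_a χ_b:`. -/
def heis (n : ℤ) : Module.End ℂ Fock :=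
  (1 / 2 : ℂ) • locSum (fun j : ℤ => normalOrdered j (2 * n - 1 - j)) (normalOrdered_locFinite n)

theorem degree_locFinite (v : Fock) :
    {i : ℕ | (((-1 : ℂ) ^ i * ((i : ℂ) + 1 / 2)) • normalOrdered (-i - 1) i) v ≠ 0}.Finite := by
  obtain ⟨N, hN⟩ := exists_chi_eq_zero v
  refine (Set.finite_Iio N.toNat).subset fun i hi => ?_
  have hi' : (((-1 : ℂ) ^ i * ((i : ℂ) + 1 / 2)) • normalOrdered (-i - 1) i) v ≠ 0 := hi
  rw [Set.mem_Iio]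
  by_contra hcon
  apply hi'
  rw [LinearMap.smul_apply, normalOrdered, if_pos (by omega), Module.End.mul_apply,
    hN _ (by omega), map_zero, smul_zero]

/-- The Virasoro mode
`L_0 = (1/2) ((1/2) :χ_{-1/2} χ_{1/2}: - (3/2) :χ_{-3/2} χ_{3/2}: + (5/2) :χ_{-5/2} χ_{5/2}: - ⋯)`. -/
def virL0 : Module.End ℂ Fock :=
  (1 / 2 : ℂ) • locSum
    (fun i : ℕ => ((-1 : ℂ) ^ i * ((i : ℂ) + 1 / 2)) • normalOrdered (-i - 1) i) degree_locFinite

/-- Highest weight vectors for the untwisted Heisenberg algebra. -/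
def IsHighestWeight (v : Fock) : Prop :=
  v ≠ 0 ∧ (∀ n : ℤ, 0 < n → heis n v = 0) ∧ ∃ c : ℂ, heis 0 v = c • v

/-- `F^hwv_χ`: the span of the highest weight vectors for the untwisted Heisenberg algebra. -/
def Fhwv : Submodule ℂ Fock := Submodule.span ℂ {v | IsHighestWeight v}

/-- The part of `F^hwv_χ` of degree `k / 2` and charge `m`: the vectors `v` in it with
`2 L_0 v = (k / 2) v` and `h_0 v = m v`. -/
def FhwvGraded (k : ℕ) (m : ℤ) : Submodule ℂ Fock where
  carrier := {v | v ∈ Fhwv ∧ (2 : ℂ) • virL0 v = ((k : ℂ) / 2) • v ∧ heis 0 v = (m : ℂ) • v}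
  zero_mem' := by simp
  add_mem' := by
    rintro v w ⟨h1, h2, h3⟩ ⟨h4, h5, h6⟩
    refine ⟨add_mem h1 h4, ?_, ?_⟩
    · rw [map_add, smul_add, smul_add, h2, h5]
    · rw [map_add, smul_add, h3, h6]
  smul_mem' := by
    rintro c v ⟨h1, h2, h3⟩
    refine ⟨Submodule.smul_mem _ c h1, ?_, ?_⟩
    · rw [map_smul, smul_comm, h2, smul_comm]
    · rw [map_smul, h3, smul_comm]

/-! ## Formal series in `q^(1/2)` and `z` -/

/-- Formal power series in `q^(1/2)` whose coefficients are Laurent polynomials in `z`. -/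
abbrev QZ : Type := ℚ[T;T⁻¹]⟦X⟧

/-- Laurent polynomials in `z` are discrete, so convergence in `QZ`, which carries the product
topology, means that every coefficient is eventually constant. -/
instance instTopologicalSpaceLaurent : TopologicalSpace ℚ[T;T⁻¹] := ⊥

instance instDiscreteTopologyLaurent : DiscreteTopology ℚ[T;T⁻¹] := ⟨rfl⟩

/-- The monomial `q^(k/2) z^m`. -/
def qz (k : ℕ) (m : ℤ) : QZ := PowerSeries.monomial k (LaurentPolynomial.T m)

theorem constantCoeff_qz {k : ℕ} (hk : 0 < k) (m : ℤ) : PowerSeries.constantCoeff (qz k m) = 0 := by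
  rw [← PowerSeries.coeff_zero_eq_constantCoeff_apply, qz, PowerSeries.coeff_monomial,
    if_neg hk.ne]

theorem isUnit_one_sub_qz {k : ℕ} (hk : 0 < k) (m : ℤ) : IsUnit (1 - qz k m) := by
  rw [PowerSeries.isUnit_iff_constantCoeff, map_sub, constantCoeff_qz hk, map_one, sub_zero]
  exact isUnit_one

theorem isUnit_one_add_qz {k : ℕ} (hk : 0 < k) (m : ℤ) : IsUnit (1 + qz k m) := by
  rw [PowerSeries.isUnit_iff_constantCoeff, map_add, constantCoeff_qz hk, map_one, add_zero]
  exact isUnit_one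

/-- The graded dimension `tr q^(2 L_0) z^(h_0)` of `F^hwv_χ`: the coefficient of `q^(k/2) z^m` is the
dimension of the part of degree `k / 2` and charge `m`. -/
def charFhwv : QZ :=
  PowerSeries.mk fun k : ℕ =>
    ∑ᶠ m : ℤ, (Module.finrank ℂ (FhwvGraded k m) : ℚ) • LaurentPolynomial.T m

/-! ## The crank -/

/-- The crank of a partition. -/
def crank {n : ℕ} (p : n.Partition) : ℤ :=
  if p.parts.count 1 = 0 then (p.parts.sup : ℤ)
  else ((p.parts.filter fun i => p.parts.count 1 < i).card : ℤ) - (p.parts.count 1 : ℤ)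

/-- The number `N'(m, n)` of partitions of `n` with crank `m`, with modified values for `n = 1`. -/
def crankCount (m : ℤ) (n : ℕ) : ℤ :=
  if n = 1 then (if m = 0 then -1 else if m = 1 ∨ m = -1 then 1 else 0)
  else (Fintype.card {p : n.Partition // crank p = m} : ℤ)

theorem neg_le_crank {n : ℕ} (p : n.Partition) : -(n : ℤ) ≤ crank p := by
  have h : p.parts.count 1 ≤ n := by
    have h1 : p.parts.card • 1 ≤ p.parts.sum :=
      Multiset.card_nsmul_le_sum fun i hi => p.parts_pos hi
    have h2 := Multiset.count_le_card 1 p.parts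
    rw [p.parts_sum] at h1
    simp only [smul_eq_mul, mul_one] at h1
    omega
  unfold crank
  split_ifs
  · omega
  · omega

/-- For `l ≥ 0`, the exponent `4n + m` is nonnegative wherever `N'(m - l, n)` is not zero. -/
theorem exponent_nonneg {m l : ℤ} {n : ℕ} (hl : 0 ≤ l) (h : crankCount (m - l) n ≠ 0) :
    0 ≤ 4 * (n : ℤ) + m := by
  unfold crankCount at h
  split_ifs at h with h1 h2 h3
  · omega
  · omega
  · exact absurd rfl h
  · have h4 : Fintype.card {p : n.Partition // crank p = m - l} ≠ 0 := by exact_mod_cast h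
    obtain ⟨p, hp⟩ := Fintype.card_pos_iff.1 (Nat.pos_of_ne_zero h4)
    have := neg_le_crank p
    omega

/-! ## Distinct integer bipartitions -/

/-- Pairs of partitions, each with distinct positive integer parts. A partition with distinct
parts is given by its finite set of parts. -/
abbrev BPDI : Type := Finset ℕ+ × Finset ℕ+

/-- The Hammond-Lewis birank `#π₂ - #π₁`. -/
def birank (π : BPDI) : ℤ := (π.2.card : ℤ) - (π.1.card : ℤ)

/-- The weight `|π₁| + |π₂|`. -/
def size (π : BPDI) : ℕ := (∑ i ∈ π.1, (i : ℕ)) + ∑ i ∈ π.2, (i : ℕ)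

/-- `2 W(π₁ | π₂)`, where `W = 2 |(π₁ | π₂)| + 2 n s - n (2n - 1) / 2 - s (2s + 1) / 2` with
`n = #π₁` and `s = #π₂`. -/
def twiceW (π : BPDI) : ℤ :=
  4 * (size π : ℤ) + 4 * (π.1.card : ℤ) * (π.2.card : ℤ)
    - (π.1.card : ℤ) * (2 * (π.1.card : ℤ) - 1) - (π.2.card : ℤ) * (2 * (π.2.card : ℤ) + 1)

theorem card_mul_le_sum (s : Finset ℕ+) : s.card * (s.card + 1) ≤ 2 * ∑ i ∈ s, (i : ℕ) := by
  refine Finset.induction_on_max s (by simp) ?_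
  · intro a s ha ih
    have hnot : a ∉ s := fun h => lt_irrefl _ (ha a h)
    have hcard : s.card + 1 ≤ (a : ℕ) := by
      have hsub : s ⊆ Finset.Ico 1 a := fun x hx =>
        Finset.mem_Ico.2 ⟨one_le, ha x hx⟩
      have := Finset.card_le_card hsub
      rw [PNat.card_Ico] at this
      have h1 := a.pos
      simp only [PNat.one_coe] at this
      omega
    rw [Finset.card_insert_of_notMem hnot, Finset.sum_insert hnot]
    nlinarith

theorem twiceW_nonneg (π : BPDI) : 0 ≤ twiceW π := by
  have h1 : ((π.1.card * (π.1.card + 1) : ℕ) : ℤ) ≤ _ := Int.ofNat_le.2 (card_mul_le_sum π.1)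
  have h2 : ((π.2.card * (π.2.card + 1) : ℕ) : ℤ) ≤ _ := Int.ofNat_le.2 (card_mul_le_sum π.2)
  unfold twiceW size
  push_cast at h1 h2 ⊢
  have h3 : (0 : ℤ) ≤ (π.1.card : ℤ) * (π.2.card : ℤ) := by positivity
  have h4 : (0 : ℤ) ≤ (π.1.card : ℤ) := by positivity
  have h5 : (0 : ℤ) ≤ (π.2.card : ℤ) := by positivity
  nlinarith

end CKP

end

open CKP

/-! Write Q = q^2, a = z^{-1}q^{3/2}, b = zq^{1/2}, so that ab = Q, and (x)_∞ = ∏_{n≥0}(1 - xQ^n).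
Everything is compared with the product P = (Q)_∞ / ((a)_∞ (b)_∞), which is `charProduct`.

Representation theory. Creation operators applied to the vacuum give a basis of F_χ indexed by
multisets (`fockBasis`); independence comes from the polynomial model. On it 2L_0 and h_0 are
diagonal, so F_χ has character 1/((a)_∞(b)_∞) (`fockChar_eq`). An operator commuting with all modes
is fixed by its value on the vacuum, which reduces the Heisenberg relations to a vacuum computation.
Let V_N be the space of vectors killed by h_n for all n > N, taken degree by degree. For n = N+1 the
operator h_n maps V_{N+1} to itself with kernel V_N, and it is onto: it is nilpotent on each graded
piece, and its commutator with h_{-n} is a nonzero scalar (`heis_surjective`). Rank-nullity gives ch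
V_N = (1 - Q^{N+1}) ch V_{N+1}. As V_N is the whole Fock space in any fixed degree once N is large,
ch V_0 = (Q)_∞ ch F_χ = P, and the graded pieces of V_0 are those of F^hwv_χ
(`charFhwv_eq_charProduct`).

The four formulas. (3) is P itself. (2) is the expansion of (ab)_∞/((a)_∞(b)_∞) as a double sum of
a^n b^s Q^{ns}/((Q)_n(Q)_s), by Euler and the q-binomial theorem, with 1/(Q)_n read as the
generating function of n-element sets (`hasSum_bipartitions`). For (1), the q-binomial theorem
summed over the number of ones gives the crank generating function (Q)_∞/((a)_∞(bQ)_∞), up to a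
correction that is exactly the modification of N' at n = 1; the missing factor 1/(1-b) is the sum
over l (`hasSum_charProduct_crank`). For (4), both the Lambert sums and 1/((a^2;Q^2)_∞(b^2;Q^2)_∞)
are resolved into the same partial theta series along diagonals, and (x^2;Q^2)_∞ = (x)_∞(-x)_∞
finishes (`charProduct_eq_lambert`).

Convergence is always handled by divisibility by powers of X (`Vanishing`), which provides both
summability and the interchange of sums. -/

set_option linter.unusedSectionVars false

noncomputable section

namespace CKP

open PowerSeries Filter Topology

/-! ## Summable families of power series over a discrete ring -/

section QSeries

variable {A : Type*} [CommRing A]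

/-- A family of power series whose members are divisible by `X ^ d`, for every `d`, with finitely
many exceptions. -/
def Vanishing {ι : Type*} (f : ι → A⟦X⟧) : Prop :=
  ∀ d : ℕ, {i | ¬ (X : A⟦X⟧) ^ d ∣ f i}.Finite

namespace Vanishing

variable {ι κ : Type*} {f : ι → A⟦X⟧} {g : κ → A⟦X⟧}

theorem comp_injective (hf : Vanishing f) {e : κ → ι} (he : Function.Injective e) :
    Vanishing (fun k => f (e k)) := fun d => (hf d).preimage he.injOn

theorem mono (hf : Vanishing f) {f' : ι → A⟦X⟧} (h : ∀ i, f i ∣ f' i) : Vanishing f' :=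
  fun d => (hf d).subset fun i hi hd => hi (hd.trans (h i))

theorem mul_left (hf : Vanishing f) (u : ι → A⟦X⟧) : Vanishing (fun i => u i * f i) :=
  hf.mono fun i => Dvd.intro_left (u i) rfl

theorem mul_right (hf : Vanishing f) (u : ι → A⟦X⟧) : Vanishing (fun i => f i * u i) :=
  hf.mono fun i => Dvd.intro (u i) rfl

theorem prod (hf : Vanishing f) (hg : Vanishing g) :
    Vanishing (fun p : ι × κ => f p.1 * g p.2) := fun d => by
  refine ((hf d).prod (hg d)).subset fun p hp => ⟨fun h => hp (h.mul_right _), fun h => hp (h.mul_left _)⟩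

theorem of_nat {f : ℕ → A⟦X⟧} (hf : ∀ n, (X : A⟦X⟧) ^ n ∣ f n) : Vanishing f := fun d =>
  (Set.finite_Iio d).subset fun n hn => by
    by_contra h
    exact hn ((pow_dvd_pow _ (not_lt.1 h)).trans (hf n))

end Vanishing

/-- The product `∏ (1 - x Q ^ n)` over `n < N`. -/
def qPoch (x Q : A⟦X⟧) (N : ℕ) : A⟦X⟧ := ∏ n ∈ Finset.range N, (1 - x * Q ^ n)

theorem isUnit_one_sub_of_dvd {x : A⟦X⟧} (hx : (X : A⟦X⟧) ∣ x) : IsUnit (1 - x) := by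
  rw [isUnit_iff_constantCoeff, map_sub, X_dvd_iff.1 hx, map_one, sub_zero]
  exact isUnit_one

@[simp] theorem qPoch_zero (x Q : A⟦X⟧) : qPoch x Q 0 = 1 := by simp [qPoch]

theorem qPoch_succ (x Q : A⟦X⟧) (N : ℕ) : qPoch x Q (N + 1) = qPoch x Q N * (1 - x * Q ^ N) :=
  Finset.prod_range_succ _ _

theorem qPoch_succ' (x Q : A⟦X⟧) (N : ℕ) :
    qPoch x Q (N + 1) = (1 - x) * qPoch (x * Q) Q N := by
  rw [qPoch, Finset.prod_range_succ', pow_zero, mul_one, mul_comm]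
  congr 1
  exact Finset.prod_congr rfl fun n _ => by ring

theorem isUnit_qPoch {x : A⟦X⟧} (Q : A⟦X⟧) (hx : (X : A⟦X⟧) ∣ x) (N : ℕ) :
    IsUnit (qPoch x Q N) := by
  induction N with
  | zero => simp
  | succ N ih => rw [qPoch_succ]; exact ih.mul (isUnit_one_sub_of_dvd (hx.mul_right _))

theorem X_pow_dvd_mul_pow (x : A⟦X⟧) {Q : A⟦X⟧} (hQ : (X : A⟦X⟧) ∣ Q) (n : ℕ) :
    (X : A⟦X⟧) ^ n ∣ x * Q ^ n := (pow_dvd_pow_of_dvd hQ n).mul_left _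

@[simp] theorem qPoch_zero_left (Q : A⟦X⟧) (N : ℕ) : qPoch 0 Q N = 1 := by simp [qPoch]

theorem one_sub_mul_inverse_qPoch_succ {Q : A⟦X⟧} (hQ : (X : A⟦X⟧) ∣ Q) (n : ℕ) :
    (1 - Q ^ (n + 1)) * Ring.inverse (qPoch Q Q (n + 1)) = Ring.inverse (qPoch Q Q n) := by
  have h1 := isUnit_qPoch Q hQ n
  have h2 : IsUnit (1 - Q ^ (n + 1)) := isUnit_one_sub_of_dvd (dvd_pow hQ n.succ_ne_zero)
  rw [qPoch_succ, ← pow_succ', Ring.inverse_mul (Or.inl h1), ← mul_assoc,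
    Ring.mul_inverse_cancel _ h2, one_mul]

variable [TopologicalSpace A] [DiscreteTopology A]

theorem Vanishing.summable {ι : Type*} {f : ι → A⟦X⟧} (hf : Vanishing f) : Summable f := by
  rw [PowerSeries.WithPiTopology.summable_iff_summable_coeff]
  intro d
  refine summable_of_hasFiniteSupport ((hf (d + 1)).subset fun i hi h => hi ?_)
  exact X_pow_dvd_iff.1 h d d.lt_succ_self

/-- A Fubini principle: the vanishing condition already makes the double sum exist, so the iterated
sum can only compute its value. Sums are interchanged below by applying it in one order and taking
fibres in the other. -/
theorem Vanishing.hasSum_prod {ι κ : Type*} {f : ι × κ → A⟦X⟧} {g : ι → A⟦X⟧} {s : A⟦X⟧}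
    (hf : Vanishing f) (hg : ∀ i, HasSum (fun k => f (i, k)) (g i)) (hs : HasSum g s) :
    HasSum f s := by
  have h := hf.summable.hasSum
  rwa [(h.prod_fiberwise hg).unique hs] at h

theorem Vanishing.hasSum_mul {ι κ : Type*} {f : ι → A⟦X⟧} {g : κ → A⟦X⟧} {s t : A⟦X⟧}
    (hf : Vanishing f) (hg : Vanishing g) (hs : HasSum f s) (ht : HasSum g t) :
    HasSum (fun p : ι × κ => f p.1 * g p.2) (s * t) :=
  (hf.prod hg).hasSum_prod (fun i => ht.mul_left (f i)) (hs.mul_right t)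

theorem tendsto_zero_of_dvd {f : ℕ → A⟦X⟧} (hf : ∀ n, (X : A⟦X⟧) ^ n ∣ f n) :
    Tendsto f atTop (𝓝 0) := by
  rw [PowerSeries.WithPiTopology.tendsto_iff_coeff_tendsto]
  intro d
  refine tendsto_const_nhds.congr' ?_
  filter_upwards [eventually_gt_atTop d] with n hn
  rw [map_zero, X_pow_dvd_iff.1 (hf n) d hn]

theorem multipliable_one_add {f : ℕ → A⟦X⟧} (hf : ∀ n, (X : A⟦X⟧) ^ n ∣ f n) :
    Multipliable fun n => 1 + f n := by
  refine PowerSeries.WithPiTopology.multipliable_one_add_of_tendsto_order_atTop_nhds_top _ ?_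
  refine ENat.tendsto_nhds_top_iff_natCast_lt.mpr fun n => ?_
  filter_upwards [eventually_gt_atTop n] with m hm
  refine lt_of_lt_of_le ?_ (PowerSeries.nat_le_order _ m fun i hi => X_pow_dvd_iff.1 (hf m) i hi)
  exact_mod_cast hm

theorem multipliable_one_sub {f : ℕ → A⟦X⟧} (hf : ∀ n, (X : A⟦X⟧) ^ n ∣ f n) :
    Multipliable fun n => 1 - f n := by
  simp only [sub_eq_add_neg]
  exact multipliable_one_add fun n => (hf n).neg_right

theorem isUnit_tprod_one_sub {f : ℕ → A⟦X⟧} (hf : ∀ n, (X : A⟦X⟧) ^ (n + 1) ∣ f n) :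
    IsUnit (∏' n, (1 - f n)) := by
  have hm : Multipliable fun n => 1 - f n :=
    multipliable_one_sub fun n => (pow_dvd_pow _ n.le_succ).trans (hf n)
  rw [isUnit_iff_constantCoeff, hm.map_tprod (constantCoeff (R := A))
    (PowerSeries.WithPiTopology.continuous_constantCoeff A)]
  have : ∀ n, constantCoeff (1 - f n) = 1 := fun n => by
    rw [map_sub, X_dvd_iff.1 ((dvd_pow_self _ n.succ_ne_zero).trans (hf n)), map_one, sub_zero]
  simp [this]

/-! ## The `q`-Pochhammer symbols and the `q`-binomial theorem -/

/-- The infinite product `∏ (1 - x Q ^ n)` over `n ≥ 0`. -/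
def qPochInf (x Q : A⟦X⟧) : A⟦X⟧ := ∏' n : ℕ, (1 - x * Q ^ n)

theorem hasProd_qPochInf (x : A⟦X⟧) {Q : A⟦X⟧} (hQ : (X : A⟦X⟧) ∣ Q) :
    HasProd (fun n : ℕ => 1 - x * Q ^ n) (qPochInf x Q) :=
  (multipliable_one_sub (X_pow_dvd_mul_pow x hQ)).hasProd

theorem tendsto_qPoch (x : A⟦X⟧) {Q : A⟦X⟧} (hQ : (X : A⟦X⟧) ∣ Q) :
    Tendsto (qPoch x Q) atTop (𝓝 (qPochInf x Q)) :=
  (hasProd_qPochInf x hQ).tendsto_prod_nat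

theorem isUnit_qPochInf {x Q : A⟦X⟧} (hx : (X : A⟦X⟧) ∣ x) (hQ : (X : A⟦X⟧) ∣ Q) :
    IsUnit (qPochInf x Q) := isUnit_tprod_one_sub fun n => by
  rw [pow_succ']
  exact mul_dvd_mul hx (pow_dvd_pow_of_dvd hQ n)

theorem qPochInf_eq_qPoch_mul (x : A⟦X⟧) {Q : A⟦X⟧} (hQ : (X : A⟦X⟧) ∣ Q) (N : ℕ) :
    qPochInf x Q = qPoch x Q N * qPochInf (x * Q ^ N) Q := by
  have h1 := (tendsto_add_atTop_iff_nat N).2 (tendsto_qPoch x hQ)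
  have h2 := (tendsto_qPoch (x * Q ^ N) hQ).const_mul (qPoch x Q N)
  refine tendsto_nhds_unique (h1.congr fun n => ?_) h2
  rw [add_comm, qPoch, Finset.prod_range_add]
  congr 1
  exact Finset.prod_congr rfl fun n _ => by rw [pow_add, mul_assoc]

theorem qPochInf_eq_one_sub_mul (x : A⟦X⟧) {Q : A⟦X⟧} (hQ : (X : A⟦X⟧) ∣ Q) :
    qPochInf x Q = (1 - x) * qPochInf (x * Q) Q := by
  simpa [qPoch] using qPochInf_eq_qPoch_mul x hQ 1

@[simp] theorem qPochInf_zero (Q : A⟦X⟧) : qPochInf 0 Q = 1 := by simp [qPochInf]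

theorem qPochInf_mul_neg (x : A⟦X⟧) {Q : A⟦X⟧} (hQ : (X : A⟦X⟧) ∣ Q) :
    qPochInf x Q * qPochInf (-x) Q = qPochInf (x ^ 2) (Q ^ 2) := by
  have hQ2 : (X : A⟦X⟧) ∣ Q ^ 2 := hQ.trans (dvd_pow_self _ two_ne_zero)
  refine ((hasProd_qPochInf x hQ).mul (hasProd_qPochInf (-x) hQ)).unique ?_
  convert hasProd_qPochInf (x ^ 2) hQ2 using 2 with n
  ring

/-- A power series whose coefficients satisfy a first order `q`-difference recurrence is a quotient
of infinite products. -/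
theorem hasSum_of_recurrence {Q x α β : A⟦X⟧} {c : ℕ → A⟦X⟧} (hQ : (X : A⟦X⟧) ∣ Q)
    (hx : (X : A⟦X⟧) ∣ x) (h0 : c 0 = 1)
    (hc : ∀ n, (1 - Q ^ (n + 1)) * c (n + 1) = (α - β * Q ^ n) * c n) :
    HasSum (fun n => x ^ n * c n) (qPochInf (β * x) Q * Ring.inverse (qPochInf (α * x) Q)) := by
  have hsum : ∀ (y : A⟦X⟧), X ∣ y → ∀ d : ℕ → A⟦X⟧, Summable (fun n => y ^ n * d n) :=
    fun y hy d => (Vanishing.mul_right (Vanishing.of_nat fun n => pow_dvd_pow_of_dvd hy n) d).summable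
  set H : A⟦X⟧ → A⟦X⟧ := fun y => ∑' n, y ^ n * c n with hH
  have hH1 : ∀ y, X ∣ y → H y = 1 + y * ∑' n, y ^ n * c (n + 1) := fun y hy => by
    rw [hH]
    simp only
    rw [(hsum y hy c).tsum_eq_zero_add, pow_zero, one_mul, h0,
      ← (hsum y hy _).tsum_mul_left]
    congr 2
    funext n
    ring
  have hfun : ∀ y, X ∣ y → (1 - α * y) * H y = (1 - β * y) * H (y * Q) := fun y hy => by
    have e1 := (hsum y hy c).hasSum
    have e2 := (hsum (y * Q) (hy.mul_right _) c).hasSum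
    have e3 : HasSum (fun n => y ^ n * c n - (y * Q) ^ n * c n)
        (α * y * H y - β * y * H (y * Q)) := by
      have := ((e1.mul_left (α * y)).sub (e2.mul_left (β * y)))
      -- The term n = 0 of the difference is zero; after the shift by one, each term is the
      -- recurrence multiplied by y^(n+1).
      rw [hasSum_nat_add_iff' 1 |>.symm]
      simp only [Finset.sum_range_one, pow_zero, one_mul, sub_self, sub_zero]
      refine this.congr_fun fun n => ?_
      have h := hc n
      linear_combination (y ^ (n + 1)) * h
    have e4 := e3.unique (e1.sub e2)
    have e4' : α * y * H y - β * y * H (y * Q) = H y - H (y * Q) := e4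
    linear_combination -e4'
  -- The functional equation is iterated along x, xQ, xQ^2, …; in the limit H(xQ^N) tends to its
  -- constant term 1.
  have hiter : ∀ N, qPoch (α * x) Q N * H x = qPoch (β * x) Q N * H (x * Q ^ N) := fun N => by
    induction N with
    | zero => simp
    | succ N ih =>
      have h := hfun (x * Q ^ N) (hx.mul_right _)
      rw [qPoch_succ, qPoch_succ, pow_succ, ← mul_assoc x]
      linear_combination (1 - α * x * Q ^ N) * ih + qPoch (β * x) Q N * h
  have hlim : Tendsto (fun N => H (x * Q ^ N)) atTop (𝓝 1) := by
    have : Tendsto (fun N => H (x * Q ^ N) - 1) atTop (𝓝 0) := by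
      refine tendsto_zero_of_dvd fun N => ?_
      rw [hH1 _ (hx.mul_right _), add_sub_cancel_left]
      exact (X_pow_dvd_mul_pow x hQ N).mul_right _
    simpa using this.add_const 1
  have hkey : qPochInf (α * x) Q * H x = qPochInf (β * x) Q := by
    have h1 := (tendsto_qPoch (α * x) hQ).mul_const (H x)
    have h2 := (tendsto_qPoch (β * x) hQ).mul hlim
    rw [mul_one] at h2
    exact tendsto_nhds_unique (h1.congr hiter) h2
  have hu : IsUnit (qPochInf (α * x) Q) := isUnit_qPochInf (hx.mul_left _) hQ
  have := (hsum x hx c).hasSum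
  rwa [show (∑' n, x ^ n * c n) = qPochInf (β * x) Q * Ring.inverse (qPochInf (α * x) Q) from
    (Ring.eq_mul_inverse_iff_mul_eq _ _ _ hu).2 (by rw [mul_comm]; exact hkey)] at this

/-- The `q`-binomial theorem. -/
theorem hasSum_qBinomial {Q a : A⟦X⟧} (b : A⟦X⟧) (hQ : (X : A⟦X⟧) ∣ Q) (ha : (X : A⟦X⟧) ∣ a) :
    HasSum (fun n => a ^ n * (qPoch b Q n * Ring.inverse (qPoch Q Q n)))
      (qPochInf (b * a) Q * Ring.inverse (qPochInf a Q)) := by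
  have := hasSum_of_recurrence (x := a) (α := 1) (β := b)
    (c := fun n => qPoch b Q n * Ring.inverse (qPoch Q Q n)) hQ ha (by simp) fun n => ?_
  · rwa [one_mul] at this
  · have h := one_sub_mul_inverse_qPoch_succ hQ n
    rw [qPoch_succ b]
    linear_combination qPoch b Q n * (1 - b * Q ^ n) * h

/-- Euler's expansion of the reciprocal of an infinite product. -/
theorem hasSum_inverse_qPochInf {Q a : A⟦X⟧} (hQ : (X : A⟦X⟧) ∣ Q) (ha : (X : A⟦X⟧) ∣ a) :
    HasSum (fun n => a ^ n * Ring.inverse (qPoch Q Q n)) (Ring.inverse (qPochInf a Q)) := by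
  simpa using hasSum_qBinomial 0 hQ ha

/-- Euler's expansion of an infinite product. -/
theorem hasSum_qPochInf {Q a : A⟦X⟧} (hQ : (X : A⟦X⟧) ∣ Q) (ha : (X : A⟦X⟧) ∣ a) :
    HasSum (fun n => a ^ n * ((-1) ^ n * Q ^ (n.choose 2) * Ring.inverse (qPoch Q Q n)))
      (qPochInf a Q) := by
  have := hasSum_of_recurrence (x := a) (α := 0) (β := 1)
    (c := fun n => (-1) ^ n * Q ^ (n.choose 2) * Ring.inverse (qPoch Q Q n)) hQ ha
    (by simp) fun n => ?_
  · simpa using this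
  · have h := one_sub_mul_inverse_qPoch_succ hQ n
    rw [show (n + 1).choose 2 = n + n.choose 2 by rw [Nat.choose_succ_succ' n 1, Nat.choose_one_right],
      pow_add]
    linear_combination (-1) ^ (n + 1) * Q ^ n * Q ^ (n.choose 2) * h

end QSeries

/-! ### Double series, partial theta series and their diagonals -/

section QSeries

variable {A : Type*} [CommRing A] [TopologicalSpace A] [DiscreteTopology A]

theorem inverse_qPochInf_mul_pow {Q b : A⟦X⟧} (hQ : (X : A⟦X⟧) ∣ Q) (hb : (X : A⟦X⟧) ∣ b) (n : ℕ) :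
    Ring.inverse (qPochInf (b * Q ^ n) Q) = qPoch b Q n * Ring.inverse (qPochInf b Q) := by
  rw [qPochInf_eq_qPoch_mul b hQ n, Ring.inverse_mul (Or.inl (isUnit_qPoch Q hb n)),
    mul_comm (Ring.inverse _), ← mul_assoc, Ring.mul_inverse_cancel _ (isUnit_qPoch Q hb n), one_mul]

/-- Summing over the second index first gives 1/(bQ^n)_∞ = (b)_n/(b)_∞ by Euler; the remaining sum
over n is then the q-binomial series. -/
theorem hasSum_double {Q a b : A⟦X⟧} (hQ : (X : A⟦X⟧) ∣ Q) (ha : (X : A⟦X⟧) ∣ a)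
    (hb : (X : A⟦X⟧) ∣ b) :
    HasSum (fun p : ℕ × ℕ => (a ^ p.1 * b ^ p.2) *
        (Q ^ (p.1 * p.2) * (Ring.inverse (qPoch Q Q p.1) * Ring.inverse (qPoch Q Q p.2))))
      (qPochInf (a * b) Q * Ring.inverse (qPochInf a Q * qPochInf b Q)) := by
  have hv : Vanishing (fun p : ℕ × ℕ => (a ^ p.1 * b ^ p.2) *
        (Q ^ (p.1 * p.2) * (Ring.inverse (qPoch Q Q p.1) * Ring.inverse (qPoch Q Q p.2)))) :=
    ((Vanishing.of_nat fun n => pow_dvd_pow_of_dvd ha n).prod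
      (Vanishing.of_nat fun n => pow_dvd_pow_of_dvd hb n)).mul_right _
  refine hv.hasSum_prod (fun n => ?_)
    (g := fun n => a ^ n * Ring.inverse (qPoch Q Q n) * Ring.inverse (qPochInf (b * Q ^ n) Q)) ?_
  · refine ((hasSum_inverse_qPochInf hQ (hb.mul_right (Q ^ n))).mul_left
      (a ^ n * Ring.inverse (qPoch Q Q n))).congr_fun fun s => ?_
    simp only
    rw [mul_pow, ← pow_mul]
    ring
  · have h := (hasSum_qBinomial b hQ ha).mul_right (Ring.inverse (qPochInf b Q))
    rw [Ring.inverse_mul (Or.inl (isUnit_qPochInf ha hQ)), mul_comm a b,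
      mul_comm (Ring.inverse (qPochInf b Q)), ← mul_assoc]
    refine h.congr_fun fun n => ?_
    rw [inverse_qPochInf_mul_pow hQ hb]
    ring

/-- The quadrant is cut into the pairs on or below the diagonal and those strictly above it; the
extra 1 in the second family keeps the diagonal from being counted twice. -/
theorem hasSum_of_diagonals {M : Type*} [AddCommMonoid M] [TopologicalSpace M] [ContinuousAdd M]
    {f : ℕ × ℕ → M} {s t : M} (hs : HasSum (fun p : ℕ × ℕ => f (p.1 + p.2, p.2)) s)
    (ht : HasSum (fun p : ℕ × ℕ => f (p.2, p.1 + 1 + p.2)) t) : HasSum f (s + t) := by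
  have h1 : Function.Injective (fun p : ℕ × ℕ => (p.1 + p.2, p.2)) := fun p q h => by
    simp only [Prod.mk.injEq] at h
    ext <;> omega
  have h2 : Function.Injective (fun p : ℕ × ℕ => (p.2, p.1 + 1 + p.2)) := fun p q h => by
    simp only [Prod.mk.injEq] at h
    ext <;> omega
  refine (h1.hasSum_range_iff.2 hs).add_isCompl ?_ (h2.hasSum_range_iff.2 ht)
  rw [isCompl_iff, Set.disjoint_iff, codisjoint_iff_le_sup]
  constructor
  · rintro ⟨i, l⟩ ⟨⟨p, hp⟩, ⟨q, hq⟩⟩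
    simp only [Prod.mk.injEq] at hp hq
    exact absurd hp.1 (by omega)
  · rintro ⟨i, l⟩ -
    rcases le_or_gt l i with h | h
    · exact Or.inl ⟨(i - l, l), by simp [h]⟩
    · exact Or.inr ⟨(l - i - 1, i), by simp only [Prod.mk.injEq, true_and]; omega⟩

/-- The partial theta series `∑ (-1) ^ j R ^ (j (j + 1) / 2 + j m)`. -/
def partialTheta (R : A⟦X⟧) (m : ℕ) : A⟦X⟧ :=
  ∑' j : ℕ, (-1) ^ j * R ^ ((j + 1).choose 2 + j * m)

theorem le_choose_succ (j : ℕ) : j ≤ (j + 1).choose 2 := by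
  rw [Nat.choose_succ_succ' j 1, Nat.choose_one_right]
  omega

theorem vanishing_partialTheta {R : A⟦X⟧} (hR : (X : A⟦X⟧) ∣ R) (m : ℕ) :
    Vanishing (fun j : ℕ => (-1) ^ j * R ^ ((j + 1).choose 2 + j * m)) :=
  Vanishing.mul_left (Vanishing.of_nat fun j => (pow_dvd_pow_of_dvd hR j).trans
    (pow_dvd_pow _ ((le_choose_succ j).trans (Nat.le_add_right _ _)))) _

theorem inverse_qPoch_eq {R : A⟦X⟧} (hR : (X : A⟦X⟧) ∣ R) (n : ℕ) :
    Ring.inverse (qPoch R R n) = qPochInf (R ^ (n + 1)) R * Ring.inverse (qPochInf R R) := by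
  rw [Ring.eq_mul_inverse_iff_mul_eq _ _ _ (isUnit_qPochInf hR hR), qPochInf_eq_qPoch_mul R hR n,
    ← mul_assoc, Ring.inverse_mul_cancel _ (isUnit_qPoch R hR n), one_mul, pow_succ']

/-- Write 1/(R)_{m+l} as (R^{m+l+1})_∞/(R)_∞, expand the numerator by Euler and interchange the
sums. The inner sum over l is 1/(R^{n+1})_∞ = (R)_n/(R)_∞, whose numerator cancels the Euler
denominator. -/
theorem hasSum_partialTheta {R : A⟦X⟧} (hR : (X : A⟦X⟧) ∣ R) (m : ℕ) :
    HasSum (fun l : ℕ => R ^ l *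
        (Ring.inverse (qPoch R R (m + l)) * Ring.inverse (qPoch R R l)))
      (Ring.inverse (qPochInf R R) ^ 2 * partialTheta R m) := by
  set I := Ring.inverse (qPochInf R R) with hI
  -- The powers R^{p.1} and R^{p.2} are kept in front because they alone witness the vanishing of
  -- the double family.
  set F : ℕ × ℕ → A⟦X⟧ := fun p => (R ^ p.1 * R ^ p.2) *
    (R ^ (p.1 * (m + p.2)) * (-1) ^ p.1 * R ^ (p.1.choose 2) * I *
      Ring.inverse (qPoch R R p.1) * Ring.inverse (qPoch R R p.2)) with hF
  have hR' : ∀ n : ℕ, (X : A⟦X⟧) ^ n ∣ R ^ n := fun n => pow_dvd_pow_of_dvd hR n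
  have hv : Vanishing F := ((Vanishing.of_nat hR').prod (Vanishing.of_nat hR')).mul_right _
  have h1 : ∀ n, HasSum (fun l => F (n, l)) (I ^ 2 * ((-1) ^ n * R ^ ((n + 1).choose 2 + n * m))) :=
    fun n => by
    have h := (hasSum_inverse_qPochInf hR (hR.mul_right (R ^ n))).mul_left
      (R ^ n * R ^ (n * m) * (-1) ^ n * R ^ (n.choose 2) * I * Ring.inverse (qPoch R R n))
    rw [inverse_qPochInf_mul_pow hR hR] at h
    have e : R ^ n * R ^ (n * m) * (-1) ^ n * R ^ (n.choose 2) * I * Ring.inverse (qPoch R R n) *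
        (qPoch R R n * I) = I ^ 2 * ((-1) ^ n * R ^ ((n + 1).choose 2 + n * m)) := by
      rw [Nat.choose_succ_succ' n 1, Nat.choose_one_right, pow_add, pow_add]
      linear_combination (R ^ n * R ^ (n * m) * (-1) ^ n * R ^ (n.choose 2) * I ^ 2) *
        Ring.inverse_mul_cancel _ (isUnit_qPoch R hR n)
    rw [← hI, e] at h
    refine h.congr_fun fun l => ?_
    simp only [hF]
    rw [mul_pow, ← pow_mul]
    ring
  have h2 : HasSum F (I ^ 2 * partialTheta R m) :=
    hv.hasSum_prod h1 ((vanishing_partialTheta hR m).summable.hasSum.mul_left _)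
  rw [← (Equiv.prodComm ℕ ℕ).hasSum_iff] at h2
  refine h2.prod_fiberwise fun l => ?_
  have h := (hasSum_qPochInf hR (a := R ^ (m + l + 1)) (hR.trans (dvd_pow_self _ (by omega)))).mul_left
    (R ^ l * I * Ring.inverse (qPoch R R l))
  rw [show R ^ l * (Ring.inverse (qPoch R R (m + l)) * Ring.inverse (qPoch R R l)) =
    R ^ l * I * Ring.inverse (qPoch R R l) * qPochInf (R ^ (m + l + 1)) R by
      rw [inverse_qPoch_eq hR (m + l)]; ring]
  refine h.congr_fun fun n => ?_
  simp only [hF, Function.comp_apply, Equiv.prodComm_apply, Prod.swap_prod_mk]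
  rw [← pow_mul]
  ring

theorem vanishing_pow_mul {x : A⟦X⟧} (hx : (X : A⟦X⟧) ∣ x) (u : ℕ → A⟦X⟧) :
    Vanishing (fun m => x ^ m * u m) :=
  Vanishing.mul_right (Vanishing.of_nat fun n => pow_dvd_pow_of_dvd hx n) u

/-- Both factors are expanded by Euler. Since R = ab, a term a^i b^l depends on i - l up to a power
of R, so each diagonal is a pure power of a or b times a partial theta series. -/
theorem inverse_mul_eq_partialTheta {a b R : A⟦X⟧} (ha : (X : A⟦X⟧) ∣ a) (hb : (X : A⟦X⟧) ∣ b)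
    (hRdef : R = a * b) :
    Ring.inverse (qPochInf a R) * Ring.inverse (qPochInf b R) =
      Ring.inverse (qPochInf R R) ^ 2 *
        ((∑' m : ℕ, a ^ m * partialTheta R m) +
          ∑' m : ℕ, b ^ (m + 1) * partialTheta R (m + 1)) := by
  have hR : (X : A⟦X⟧) ∣ R := by rw [hRdef]; exact ha.mul_right b
  have hRpow : ∀ n : ℕ, R ^ n = a ^ n * b ^ n := fun n => by rw [hRdef, mul_pow]
  have hva : Vanishing (fun n : ℕ => a ^ n) := Vanishing.of_nat fun n => pow_dvd_pow_of_dvd ha n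
  have hvb : Vanishing (fun n : ℕ => b ^ n) := Vanishing.of_nat fun n => pow_dvd_pow_of_dvd hb n
  have hvR : Vanishing (fun n : ℕ => R ^ n) := Vanishing.of_nat fun n => pow_dvd_pow_of_dvd hR n
  set I : ℕ → A⟦X⟧ := fun n => Ring.inverse (qPoch R R n) with hI
  have h1 : HasSum (fun p : ℕ × ℕ => (a ^ p.1 * I p.1) * (b ^ p.2 * I p.2))
      (Ring.inverse (qPochInf a R) * Ring.inverse (qPochInf b R)) := by
    have h := Vanishing.hasSum_mul (vanishing_pow_mul ha I) (vanishing_pow_mul hb I)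
      (hasSum_inverse_qPochInf hR ha) (hasSum_inverse_qPochInf hR hb)
    exact h
  have h2 : HasSum (fun p : ℕ × ℕ => (a ^ p.1 * R ^ p.2) * (I (p.1 + p.2) * I p.2))
      (Ring.inverse (qPochInf R R) ^ 2 * ∑' m : ℕ, a ^ m * partialTheta R m) := by
    refine Vanishing.hasSum_prod
      (g := fun m => Ring.inverse (qPochInf R R) ^ 2 * (a ^ m * partialTheta R m))
      ((hva.prod hvR).mul_right _) (fun m => ?_)
      ((vanishing_pow_mul ha (partialTheta R)).summable.hasSum.mul_left _)
    rw [mul_left_comm]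
    exact ((hasSum_partialTheta hR m).mul_left (a ^ m)).congr_fun fun l => by simp only [hI]; ring
  have h3 : HasSum (fun p : ℕ × ℕ => (b ^ p.1 * R ^ p.2) * (b * (I (p.1 + 1 + p.2) * I p.2)))
      (Ring.inverse (qPochInf R R) ^ 2 * ∑' m : ℕ, b ^ (m + 1) * partialTheta R (m + 1)) := by
    refine Vanishing.hasSum_prod
      (g := fun m => Ring.inverse (qPochInf R R) ^ 2 * (b ^ (m + 1) * partialTheta R (m + 1)))
      ((hvb.prod hvR).mul_right _) (fun m => ?_)
      (((vanishing_pow_mul hb (partialTheta R)).comp_injective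
        (add_left_injective 1)).summable.hasSum.mul_left _)
    rw [mul_left_comm]
    exact ((hasSum_partialTheta hR (m + 1)).mul_left (b ^ (m + 1))).congr_fun fun l => by
      simp only [hI]; ring
  refine h1.unique ?_
  rw [mul_add]
  refine hasSum_of_diagonals (h2.congr_fun fun p => ?_) (h3.congr_fun fun p => ?_)
  · simp only [hRpow, pow_add]
    ring
  · simp only [hRpow, pow_add, pow_one]
    ring

/-! ### Lambert series -/

theorem hasSum_inverse_one_add {x : A⟦X⟧} (hx : (X : A⟦X⟧) ∣ x) :
    HasSum (fun n : ℕ => (-x) ^ n) (Ring.inverse (1 + x)) := by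
  have hs : Summable (fun n : ℕ => (-x) ^ n) :=
    (Vanishing.of_nat fun n => pow_dvd_pow_of_dvd hx.neg_right n).summable
  have hu : IsUnit (1 - -x) := isUnit_one_sub_of_dvd hx.neg_right
  have h := hs.hasSum
  rwa [show (∑' n : ℕ, (-x) ^ n) = Ring.inverse (1 + x) by
    rw [← sub_neg_eq_add, ← one_mul (Ring.inverse _), Ring.eq_mul_inverse_iff_mul_eq _ _ _ hu]
    exact hs.tsum_pow_mul_one_sub] at h

theorem vanishing_lambert {a b : A⟦X⟧} (hb : (X : A⟦X⟧) ∣ b) (Q : A⟦X⟧) :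
    Vanishing (fun k : ℕ => b ^ k * Ring.inverse (1 + a * Q ^ k)) := vanishing_pow_mul hb _

theorem hasSum_lambert {a b Q : A⟦X⟧} (ha : (X : A⟦X⟧) ∣ a) (hb : (X : A⟦X⟧) ∣ b) :
    HasSum (fun p : ℕ × ℕ => (b ^ p.1 * a ^ p.2) * (Q ^ (p.1 * p.2) * (-1) ^ p.2))
      (∑' k : ℕ, b ^ k * Ring.inverse (1 + a * Q ^ k)) := by
  have hva : Vanishing (fun n : ℕ => a ^ n) := Vanishing.of_nat fun n => pow_dvd_pow_of_dvd ha n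
  have hvb : Vanishing (fun n : ℕ => b ^ n) := Vanishing.of_nat fun n => pow_dvd_pow_of_dvd hb n
  refine Vanishing.hasSum_prod ((hvb.prod hva).mul_right _) (fun k => ?_)
    (vanishing_lambert hb Q).summable.hasSum
  refine ((hasSum_inverse_one_add (ha.mul_right (Q ^ k))).mul_left (b ^ k)).congr_fun fun j => ?_
  simp only
  rw [neg_pow (a * Q ^ k), mul_pow, ← pow_mul]
  ring

/-- Geometric expansion of both series gives the terms b^k a^j Q^{kj} with total sign (-1)^j +
(-1)^k. Diagonals with k - j odd cancel; those with k - j even double, and on them only even powers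
of a, b and Q survive. -/
theorem lambert_eq_partialTheta {a b : A⟦X⟧} (ha : (X : A⟦X⟧) ∣ a) (hb : (X : A⟦X⟧) ∣ b) :
    (∑' k : ℕ, b ^ k * Ring.inverse (1 + a * (a * b) ^ k)) +
        (∑' k : ℕ, a ^ k * Ring.inverse (1 + b * (a * b) ^ k)) =
      2 * ((∑' m : ℕ, (b ^ 2) ^ m * partialTheta ((a * b) ^ 2) m) +
        ∑' m : ℕ, (a ^ 2) ^ (m + 1) * partialTheta ((a * b) ^ 2) (m + 1)) := by
  set Q := a * b with hQdef
  have hQ : (X : A⟦X⟧) ∣ Q := ha.mul_right b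
  have hQ2 : (X : A⟦X⟧) ∣ Q ^ 2 := hQ.trans (dvd_pow_self _ two_ne_zero)
  have ha2 : (X : A⟦X⟧) ∣ a ^ 2 := ha.trans (dvd_pow_self _ two_ne_zero)
  have hb2 : (X : A⟦X⟧) ∣ b ^ 2 := hb.trans (dvd_pow_self _ two_ne_zero)
  have hva : Vanishing (fun n : ℕ => a ^ n) := Vanishing.of_nat fun n => pow_dvd_pow_of_dvd ha n
  have hvb : Vanishing (fun n : ℕ => b ^ n) := Vanishing.of_nat fun n => pow_dvd_pow_of_dvd hb n
  have hvQ : Vanishing (fun n : ℕ => Q ^ n) := Vanishing.of_nat fun n => pow_dvd_pow_of_dvd hQ n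
  have h1 := (hasSum_lambert (Q := Q) ha hb).add
    ((Equiv.prodComm ℕ ℕ).hasSum_iff.2 (hasSum_lambert (Q := Q) hb ha))
  refine h1.unique ?_
  have key : ∀ (c : A⟦X⟧) (i : ℕ), HasSum (fun j : ℕ => c ^ (2 * i) * (Q ^ j *
      (Q ^ ((2 * i + j) * j) * (-1) ^ j * 2))) (2 * ((c ^ 2) ^ i * partialTheta (Q ^ 2) i)) := by
    intro c i
    rw [← mul_assoc]
    refine ((vanishing_partialTheta hQ2 i).summable.hasSum.mul_left (2 * (c ^ 2) ^ i)).congr_fun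
      fun j => ?_
    -- On the diagonal of difference 2i the exponent of Q is j(j+1) + 2ij, twice the partial theta
    -- exponent; hence the base Q^2.
    have e : j + (2 * i + j) * j = 2 * ((j + 1).choose 2 + j * i) := by
      have h2 : (j + 1).choose 2 * 2 = (j + 1) * j := by
        rw [Nat.choose_two_right, Nat.add_sub_cancel]
        exact Nat.div_mul_cancel (by rw [mul_comm]; exact (Nat.even_mul_succ_self j).two_dvd)
      nlinarith
    have e2 : Q ^ j * Q ^ ((2 * i + j) * j) = (Q ^ 2) ^ ((j + 1).choose 2 + j * i) := by
      rw [← pow_add, e, pow_mul]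
    rw [pow_mul]
    linear_combination (2 * (c ^ 2) ^ i * (-1) ^ j) * e2
  rw [mul_add]
  refine hasSum_of_diagonals (Vanishing.hasSum_prod (g := fun m => ∑' j : ℕ, (b ^ m * (Q ^ j *
      (Q ^ ((m + j) * j) * (-1) ^ j * (1 + (-1) ^ m))))) ?_ (fun m => ?_) ?_)
    (Vanishing.hasSum_prod (g := fun m => ∑' j : ℕ, (a ^ (m + 1) * (Q ^ j *
      (Q ^ ((m + 1 + j) * j) * (-1) ^ j * (1 + (-1) ^ (m + 1)))))) ?_ (fun m => ?_) ?_)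
  · refine ((hvb.prod hvQ).mul_right fun p => Q ^ ((p.1 + p.2) * p.2) * (-1) ^ p.2 *
      (1 + (-1) ^ p.1)).mono fun p => dvd_of_eq ?_
    simp only [Function.comp_apply, Equiv.prodComm_apply, Prod.swap_prod_mk]
    rw [mul_comm p.2 (p.1 + p.2)]
    -- This power is made opaque so that unfolding Q = ab expands only the factors that must be
    -- redistributed.
    generalize Q ^ ((p.1 + p.2) * p.2) = W
    simp only [hQdef, mul_pow, pow_add]
    ring
  · refine ((Vanishing.mul_left (hvQ.mul_right _) _).summable.hasSum).congr_fun fun j => ?_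
    simp only [Function.comp_apply, Equiv.prodComm_apply, Prod.swap_prod_mk]
    rw [mul_comm j (m + j)]
    generalize Q ^ ((m + j) * j) = W
    simp only [hQdef, mul_pow, pow_add]
    ring
  · rw [← add_zero (2 * _)]
    refine HasSum.even_add_odd ?_ ?_
    · refine ((vanishing_pow_mul hb2 (partialTheta (Q ^ 2))).summable.hasSum.mul_left 2).congr_fun
        fun i => ?_
      rw [← (key b i).tsum_eq]
      simp [one_add_one_eq_two]
    · refine hasSum_zero.congr_fun fun i => ?_
      simp [pow_succ]
  · refine ((hva.prod hvQ).mul_right fun p => a * (Q ^ ((p.1 + 1 + p.2) * p.2) * (-1) ^ p.2 *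
      (1 + (-1) ^ (p.1 + 1)))).mono fun p => dvd_of_eq ?_
    simp only [Function.comp_apply, Equiv.prodComm_apply, Prod.swap_prod_mk]
    rw [mul_comm p.2 (p.1 + 1 + p.2)]
    generalize Q ^ ((p.1 + 1 + p.2) * p.2) = W
    simp only [hQdef, mul_pow, pow_add, pow_one]
    ring
  · refine ((Vanishing.mul_left (hvQ.mul_right _) _).summable.hasSum).congr_fun fun j => ?_
    simp only [Function.comp_apply, Equiv.prodComm_apply, Prod.swap_prod_mk]
    rw [mul_comm j (m + 1 + j)]
    generalize Q ^ ((m + 1 + j) * j) = W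
    simp only [hQdef, mul_pow, pow_add, pow_one]
    ring
  · rw [← zero_add (2 * _)]
    refine HasSum.even_add_odd ?_ ?_
    · refine hasSum_zero.congr_fun fun i => ?_
      simp [pow_succ]
    · refine (((vanishing_pow_mul ha2 (partialTheta (Q ^ 2))).comp_injective
        (add_left_injective 1)).summable.hasSum.mul_left 2).congr_fun fun i => ?_
      rw [← (key a (i + 1)).tsum_eq, show 2 * i + 1 + 1 = 2 * (i + 1) by ring]
      simp [one_add_one_eq_two]

/-- The two partial theta expansions are matched, the reciprocal product being taken at a^2, b^2 and
R = (ab)^2. -/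
theorem lambert_eq {a b : A⟦X⟧} (ha : (X : A⟦X⟧) ∣ a) (hb : (X : A⟦X⟧) ∣ b) :
    ((∑' k : ℕ, b ^ k * Ring.inverse (1 + a * (a * b) ^ k)) +
        (∑' k : ℕ, a ^ k * Ring.inverse (1 + b * (a * b) ^ k))) *
      (qPochInf (a ^ 2) ((a * b) ^ 2) * qPochInf (b ^ 2) ((a * b) ^ 2)) =
      2 * qPochInf ((a * b) ^ 2) ((a * b) ^ 2) ^ 2 := by
  have ha2 : (X : A⟦X⟧) ∣ a ^ 2 := ha.trans (dvd_pow_self _ two_ne_zero)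
  have hb2 : (X : A⟦X⟧) ∣ b ^ 2 := hb.trans (dvd_pow_self _ two_ne_zero)
  have h := inverse_mul_eq_partialTheta (R := (a * b) ^ 2) hb2 ha2 (by ring)
  have hR : (X : A⟦X⟧) ∣ (a * b) ^ 2 := (ha.mul_right b).trans (dvd_pow_self _ two_ne_zero)
  rw [lambert_eq_partialTheta ha hb]
  set S := (∑' m : ℕ, (b ^ 2) ^ m * partialTheta ((a * b) ^ 2) m) +
        ∑' m : ℕ, (a ^ 2) ^ (m + 1) * partialTheta ((a * b) ^ 2) (m + 1)
  have e1 := Ring.mul_inverse_cancel _ (isUnit_qPochInf hR hR)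
  have e2 := Ring.mul_inverse_cancel _ (isUnit_qPochInf ha2 hR)
  have e3 := Ring.mul_inverse_cancel _ (isUnit_qPochInf hb2 hR)
  set P := qPochInf ((a * b) ^ 2) ((a * b) ^ 2)
  set PA := qPochInf (a ^ 2) ((a * b) ^ 2)
  set PB := qPochInf (b ^ 2) ((a * b) ^ 2)
  have h' : S = P ^ 2 * (Ring.inverse PB * Ring.inverse PA) := by
    rw [h, ← mul_assoc, ← mul_pow, e1, one_pow, one_mul]
  rw [h']
  calc _ = 2 * P ^ 2 * ((PA * Ring.inverse PA) * (PB * Ring.inverse PB)) := by ring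
    _ = _ := by rw [e2, e3]; ring

end QSeries

/-! ## Generating functions over finite sets and multisets -/

section Finsets

/-- The sum of the elements of a finite set of positive integers, each shifted down by one, minus
the least possible value of that sum. -/
def excess (s : Finset ℕ) : ℕ := ∑ i ∈ s, (i + 1) - (s.card + 1).choose 2

/-- The finite set obtained by adding one to all elements. -/
def shiftUp (s : Finset ℕ) : Finset ℕ := s.map ⟨Nat.succ, Nat.succ_injective⟩

theorem shiftUp_injective : Function.Injective shiftUp := Finset.map_injective _

theorem zero_notMem_shiftUp (s : Finset ℕ) : 0 ∉ shiftUp s := by simp [shiftUp]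

theorem insert_shiftUp_injective : Function.Injective fun s => insert 0 (shiftUp s) := by
  intro s t h
  refine shiftUp_injective ?_
  rw [← Finset.erase_insert (zero_notMem_shiftUp s), ← Finset.erase_insert (zero_notMem_shiftUp t)]
  exact congrArg (fun u => u.erase 0) h

theorem mem_range_shiftUp {s : Finset ℕ} (h : 0 ∉ s) : s ∈ Set.range shiftUp := by
  refine ⟨s.image Nat.pred, ?_⟩
  ext i
  simp only [shiftUp, Finset.mem_map, Finset.mem_image, Function.Embedding.coeFn_mk]
  constructor
  · rintro ⟨_, ⟨j, hj, rfl⟩, rfl⟩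
    have : j ≠ 0 := fun h0 => h (h0 ▸ hj)
    rwa [Nat.succ_pred_eq_of_pos (Nat.pos_of_ne_zero this)]
  · intro hi
    have : i ≠ 0 := fun h0 => h (h0 ▸ hi)
    exact ⟨i.pred, ⟨i, hi, rfl⟩, Nat.succ_pred_eq_of_pos (Nat.pos_of_ne_zero this)⟩

theorem isCompl_range_shiftUp :
    IsCompl (Set.range shiftUp) (Set.range fun s => insert 0 (shiftUp s)) := by
  rw [isCompl_iff, Set.disjoint_iff, codisjoint_iff_le_sup]
  constructor
  · rintro _ ⟨⟨s, rfl⟩, ⟨t, ht⟩⟩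
    exact zero_notMem_shiftUp s (ht ▸ Finset.mem_insert_self 0 _)
  · intro s _
    by_cases h : 0 ∈ s
    · obtain ⟨t, ht⟩ := mem_range_shiftUp (Finset.notMem_erase 0 s)
      exact Or.inr ⟨t, by simp only [ht, Finset.insert_erase h]⟩
    · exact Or.inl (mem_range_shiftUp h)

theorem card_shiftUp (s : Finset ℕ) : (shiftUp s).card = s.card := Finset.card_map _

theorem sum_shiftUp (s : Finset ℕ) :
    ∑ i ∈ shiftUp s, (i + 1) = ∑ i ∈ s, (i + 1) + s.card := by
  simp [shiftUp, Finset.sum_add_distrib]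

/-- Ensures that the natural subtraction in `excess` never truncates. -/
theorem choose_le_sum (s : Finset ℕ) : (s.card + 1).choose 2 ≤ ∑ i ∈ s, (i + 1) := by
  have h := card_mul_le_sum (s.map ⟨Nat.succPNat, Nat.succPNat_injective⟩)
  simp only [Finset.card_map, Finset.sum_map, Function.Embedding.coeFn_mk,
    Nat.succPNat_coe, Nat.succ_eq_add_one] at h
  rw [Nat.choose_two_right, Nat.add_sub_cancel, mul_comm]
  omega

theorem excess_shiftUp (s : Finset ℕ) : excess (shiftUp s) = s.card + excess s := by
  have := choose_le_sum s
  rw [excess, excess, card_shiftUp, sum_shiftUp]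
  omega

theorem excess_insert_shiftUp (s : Finset ℕ) : excess (insert 0 (shiftUp s)) = excess s := by
  rw [excess, excess, Finset.card_insert_of_notMem (zero_notMem_shiftUp s), card_shiftUp,
    Finset.sum_insert (zero_notMem_shiftUp s), sum_shiftUp,
    Nat.choose_succ_succ' (s.card + 1) 1, Nat.choose_one_right, one_add_one_eq_two]
  omega

theorem hasSum_of_isCompl_range {M ι κ τ : Type*} [AddCommMonoid M] [TopologicalSpace M]
    [ContinuousAdd M] {f : τ → M} {e : ι → τ} {e' : κ → τ} {s t : M} (he : Function.Injective e)
    (he' : Function.Injective e') (h : IsCompl (Set.range e) (Set.range e'))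
    (hs : HasSum (fun i => f (e i)) s) (ht : HasSum (fun k => f (e' k)) t) : HasSum f (s + t) :=
  HasSum.add_isCompl h (he.hasSum_range_iff.2 hs) (he'.hasSum_range_iff.2 ht)

end Finsets

section QSeries

variable {A : Type*} [CommRing A]

/-- No uniformity in i is needed: f leaves finitely many i for each d, and each of these contributes
finitely many exceptions. -/
theorem Vanishing.dependent {ι κ : Type*} {f : ι → A⟦X⟧} {g : ι → κ → A⟦X⟧} (hf : Vanishing f)
    (hg : ∀ i, Vanishing (g i)) : Vanishing (fun p : ι × κ => f p.1 * g p.1 p.2) := fun d => by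
  refine ((hf d).biUnion fun i _ => (hg i d).image fun k => (i, k)).subset fun p hp => ?_
  exact Set.mem_biUnion (x := p.1) (fun h => hp (h.mul_right _))
    ⟨p.2, fun h => hp (h.mul_left _), rfl⟩

/-- The summand `Q ^ excess s` for the sets with `n` elements. -/
def finsetTerm (Q : A⟦X⟧) (n : ℕ) (s : Finset ℕ) : A⟦X⟧ := if s.card = n then Q ^ excess s else 0

theorem vanishing_finsetTerm {Q : A⟦X⟧} (hQ : (X : A⟦X⟧) ∣ Q) (n : ℕ) :
    Vanishing (finsetTerm Q n) := fun d => by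
  refine (Finset.range (d + (n + 1).choose 2)).powerset.finite_toSet.subset fun s hs => ?_
  have hs' : ¬ (X : A⟦X⟧) ^ d ∣ finsetTerm Q n s := hs
  rw [finsetTerm] at hs'
  split_ifs at hs' with h
  · have h1 : excess s < d := by
      by_contra hd
      exact hs' ((pow_dvd_pow _ (not_lt.1 hd)).trans (pow_dvd_pow_of_dvd hQ _))
    rw [Finset.coe_powerset]
    intro i hi
    have h2 : i + 1 ≤ ∑ i ∈ s, (i + 1) :=
      Finset.single_le_sum (f := fun i => i + 1) (fun _ _ => Nat.zero_le _) hi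
    rw [excess, h] at h1
    rw [Finset.coe_range, Set.mem_Iio]
    omega
  · exact absurd (dvd_zero _) hs'

/-- The product of `w i` over the elements of a multiset. -/
def multisetTerm (w : ℕ → A⟦X⟧) (μ : Multiset ℕ) : A⟦X⟧ := (μ.map w).prod

@[simp] theorem multisetTerm_zero (w : ℕ → A⟦X⟧) : multisetTerm w 0 = 1 := by simp [multisetTerm]

@[simp] theorem multisetTerm_cons (w : ℕ → A⟦X⟧) (i : ℕ) (μ : Multiset ℕ) :
    multisetTerm w (i ::ₘ μ) = w i * multisetTerm w μ := by simp [multisetTerm]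

/-- Both the elements and the multiplicities are less than d, so every such multiset lies below d
copies of {0, …, d-1}. -/
theorem finite_multiset_sum_lt (d : ℕ) :
    {μ : Multiset ℕ | (μ.map fun i => i + 1).sum < d}.Finite := by
  refine (Set.finite_Iic (d • Multiset.range d)).subset fun μ hμ => ?_
  have hμ' : (μ.map fun i => i + 1).sum < d := hμ
  rw [Set.mem_Iic, Multiset.le_iff_count]
  intro i
  by_cases hi : i ∈ μ
  · have h1 : i + 1 ≤ (μ.map fun i => i + 1).sum :=
      Multiset.single_le_sum (fun _ _ => Nat.zero_le _) _ (Multiset.mem_map_of_mem _ hi)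
    have h2 : μ.card ≤ (μ.map fun i => i + 1).sum := by
      rw [Multiset.sum_map_add]
      simp
    have h3 := Multiset.count_le_card i μ
    have h4 : 1 ≤ (Multiset.range d).count i :=
      Multiset.one_le_count_iff_mem.2 (Multiset.mem_range.2 (by omega))
    rw [Multiset.count_nsmul]
    nlinarith
  · rw [Multiset.count_eq_zero_of_notMem hi]
    exact Nat.zero_le _

theorem X_pow_dvd_multisetTerm {w : ℕ → A⟦X⟧} (hw : ∀ i, (X : A⟦X⟧) ^ (i + 1) ∣ w i)
    (μ : Multiset ℕ) : (X : A⟦X⟧) ^ (μ.map fun i => i + 1).sum ∣ multisetTerm w μ := by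
  induction μ using Multiset.induction_on with
  | empty => simp
  | cons i μ ih =>
    rw [Multiset.map_cons, Multiset.sum_cons, pow_add, multisetTerm_cons]
    exact mul_dvd_mul (hw i) ih

theorem vanishing_multisetTerm {w : ℕ → A⟦X⟧} (hw : ∀ i, (X : A⟦X⟧) ^ (i + 1) ∣ w i) :
    Vanishing (multisetTerm w) := fun d => by
  refine (finite_multiset_sum_lt d).subset fun μ hμ => ?_
  by_contra h
  exact hμ ((pow_dvd_pow _ (not_lt.1 h)).trans (X_pow_dvd_multisetTerm hw μ))

theorem map_succ_injective : Function.Injective (Multiset.map Nat.succ) :=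
  Multiset.map_injective Nat.succ_injective

theorem isCompl_range_map_succ :
    IsCompl (Set.range (Multiset.map Nat.succ)) (Set.range fun μ : Multiset ℕ => 0 ::ₘ μ) := by
  rw [isCompl_iff, Set.disjoint_iff, codisjoint_iff_le_sup]
  constructor
  · rintro _ ⟨⟨s, rfl⟩, ⟨t, ht⟩⟩
    have : 0 ∈ s.map Nat.succ := ht ▸ Multiset.mem_cons_self 0 t
    simp at this
  · intro s _
    by_cases h : 0 ∈ s
    · obtain ⟨t, ht⟩ := Multiset.exists_cons_of_mem h
      exact Or.inr ⟨t, ht.symm⟩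
    · refine Or.inl ⟨s.map Nat.pred, ?_⟩
      rw [Multiset.map_map]
      conv_rhs => rw [← Multiset.map_id s]
      refine Multiset.map_congr rfl fun i hi => ?_
      have : i ≠ 0 := fun h0 => h (h0 ▸ hi)
      exact Nat.succ_pred_eq_of_pos (Nat.pos_of_ne_zero this)

variable [TopologicalSpace A] [DiscreteTopology A]

theorem X_pow_dvd_of_hasSum {ι : Type*} {f : ι → A⟦X⟧} {s : A⟦X⟧} {N : ℕ}
    (hf : ∀ i, (X : A⟦X⟧) ^ N ∣ f i) (hs : HasSum f s) : (X : A⟦X⟧) ^ N ∣ s := by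
  rw [X_pow_dvd_iff]
  intro d hd
  have h := PowerSeries.WithPiTopology.hasSum_iff_hasSum_coeff A |>.1 hs d
  simp only [fun i => X_pow_dvd_iff.1 (hf i) d hd] at h
  exact h.unique hasSum_zero

/-- Split the sets with n+1 elements by whether they contain 0. Shifting up adds n+1 to the excess;
inserting 0 into a shifted n-element set preserves it. So the sums satisfy S_{n+1} = Q^{n+1} S_{n+1}
+ S_n. -/
theorem hasSum_finsetTerm {Q : A⟦X⟧} (hQ : (X : A⟦X⟧) ∣ Q) (n : ℕ) :
    HasSum (finsetTerm Q n) (Ring.inverse (qPoch Q Q n)) := by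
  induction n with
  | zero =>
    rw [qPoch_zero, Ring.inverse_one]
    have h := hasSum_single (f := finsetTerm Q 0) ∅ fun s hs => by
      rw [finsetTerm, if_neg (by simpa using hs)]
    simpa [finsetTerm, excess] using h
  | succ n ih =>
    have hs := (vanishing_finsetTerm hQ (n + 1)).summable.hasSum
    have h1 : HasSum (fun s => finsetTerm Q (n + 1) (shiftUp s))
        (Q ^ (n + 1) * ∑' s, finsetTerm Q (n + 1) s) := by
      refine (hs.mul_left (Q ^ (n + 1))).congr_fun fun s => ?_
      simp only [finsetTerm, card_shiftUp, excess_shiftUp, pow_add]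
      split_ifs with h
      · rw [h, pow_add]
      · rw [mul_zero]
    have h2 : HasSum (fun s => finsetTerm Q (n + 1) (insert 0 (shiftUp s)))
        (Ring.inverse (qPoch Q Q n)) := by
      refine ih.congr_fun fun s => ?_
      simp only [finsetTerm, excess_insert_shiftUp,
        Finset.card_insert_of_notMem (zero_notMem_shiftUp s), card_shiftUp, add_left_inj]
    have h3 := hasSum_of_isCompl_range shiftUp_injective insert_shiftUp_injective
      isCompl_range_shiftUp h1 h2
    have h4 := hs.unique h3
    have h5 : Ring.inverse (qPoch Q Q (n + 1)) = ∑' s, finsetTerm Q (n + 1) s := by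
      have hu : IsUnit (1 - Q ^ (n + 1)) := isUnit_one_sub_of_dvd (dvd_pow hQ n.succ_ne_zero)
      refine hu.mul_left_cancel ?_
      rw [one_sub_mul_inverse_qPoch_succ hQ]
      linear_combination -h4
    rwa [h5]

/-- Let Z_N be the sum using only the weights from index N on. Splitting by whether the smallest
index occurs gives Z_{N+1} = (1 - w_N) Z_N, and Z_N tends to 1, the contribution of the empty
multiset. -/
theorem hasSum_multisetTerm {w : ℕ → A⟦X⟧} (hw : ∀ i, (X : A⟦X⟧) ^ (i + 1) ∣ w i) :
    HasSum (multisetTerm w) (Ring.inverse (∏' i, (1 - w i))) := by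
  set Z : ℕ → A⟦X⟧ := fun N => ∑' μ, multisetTerm (fun i => w (i + N)) μ with hZ
  have hwN : ∀ N i, (X : A⟦X⟧) ^ (i + 1) ∣ w (i + N) := fun N i =>
    (pow_dvd_pow _ (by omega)).trans (hw (i + N))
  have hsum : ∀ N, HasSum (multisetTerm fun i => w (i + N)) (Z N) := fun N =>
    (vanishing_multisetTerm (hwN N)).summable.hasSum
  have hrec : ∀ N, Z (N + 1) = (1 - w N) * Z N := fun N => by
    have h1 : HasSum (fun μ : Multiset ℕ => multisetTerm (fun i => w (i + N)) (μ.map Nat.succ)) (Z (N + 1)) := by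
      refine (hsum (N + 1)).congr_fun fun μ => ?_
      simp only [multisetTerm, Multiset.map_map]
      congr 1
      refine Multiset.map_congr rfl fun i _ => ?_
      exact congrArg w (by rw [Nat.succ_eq_add_one]; omega)
    have h2 : HasSum (fun μ : Multiset ℕ => multisetTerm (fun i => w (i + N)) (0 ::ₘ μ)) (w N * Z N) := by
      refine ((hsum N).mul_left (w N)).congr_fun fun μ => ?_
      simp
    have h3 := hasSum_of_isCompl_range map_succ_injective
      (fun s t h => (Multiset.cons_inj_right 0).1 h) isCompl_range_map_succ h1 h2
    have h4 := (hsum N).unique h3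
    linear_combination -h4
  have hiter : ∀ N, (∏ i ∈ Finset.range N, (1 - w i)) * Z 0 = Z N := fun N => by
    induction N with
    | zero => simp
    | succ N ih =>
      rw [Finset.prod_range_succ, hrec, ← ih]
      ring
  have hlim : Tendsto Z atTop (𝓝 1) := by
    have h0 : Tendsto (fun N => Z N - 1) atTop (𝓝 0) := by
      refine tendsto_zero_of_dvd fun N => ?_
      have h1 := (hsum N).sub (hasSum_ite_eq (0 : Multiset ℕ) (1 : A⟦X⟧))
      refine X_pow_dvd_of_hasSum (fun μ => ?_) h1
      induction μ using Multiset.induction_on with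
      | empty => simp
      | cons i μ _ =>
        rw [if_neg (Multiset.cons_ne_zero), sub_zero, multisetTerm_cons]
        exact ((pow_dvd_pow _ (by omega)).trans (hw (i + N))).mul_right _
    simpa using h0.add_const 1
  have hm : Multipliable fun i => 1 - w i :=
    multipliable_one_sub fun i => (pow_dvd_pow _ i.le_succ).trans (hw i)
  have h1 := hm.hasProd.tendsto_prod_nat.mul_const (Z 0)
  have h2 := tendsto_nhds_unique (h1.congr hiter) hlim
  have h3 : Z 0 = Ring.inverse (∏' i, (1 - w i)) := by
    rw [← one_mul (Ring.inverse _), Ring.eq_mul_inverse_iff_mul_eq _ _ _ (isUnit_tprod_one_sub hw),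
      mul_comm]
    exact h2
  rw [← h3]
  exact hsum 0

end QSeries

/-! ## Monomials in `q` and `z` -/

theorem qz_mul (k k' : ℕ) (m m' : ℤ) : qz k m * qz k' m' = qz (k + k') (m + m') := by
  rw [qz, qz, qz, PowerSeries.monomial_mul_monomial, ← LaurentPolynomial.T_add]

theorem qz_zero : qz 0 0 = 1 := by
  rw [qz, LaurentPolynomial.T_zero, PowerSeries.monomial_zero_eq_C_apply, map_one]

theorem qz_pow (k : ℕ) (m : ℤ) (n : ℕ) : qz k m ^ n = qz (n * k) (n * m) := by
  induction n with
  | zero => simp [qz_zero]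
  | succ n ih =>
    rw [pow_succ, ih, qz_mul]
    congr 1
    · ring
    · push_cast; ring

theorem X_pow_dvd_qz {d k : ℕ} (h : d ≤ k) (m : ℤ) : (X : QZ) ^ d ∣ qz k m := by
  rw [X_pow_dvd_iff]
  intro i hi
  rw [qz, coeff_monomial, if_neg (by omega)]

theorem X_dvd_qz {k : ℕ} (h : 0 < k) (m : ℤ) : (X : QZ) ∣ qz k m := by
  have := X_pow_dvd_qz (d := 1) h m
  rwa [pow_one] at this

theorem qz_mul_qz_eq : qz 3 (-1) * qz 1 1 = qz 4 0 := by rw [qz_mul]; rfl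

/-- The product side of the character formula. -/
def charProduct : QZ :=
  qPochInf (qz 4 0) (qz 4 0) * Ring.inverse (qPochInf (qz 3 (-1)) (qz 4 0) * qPochInf (qz 1 1) (qz 4 0))

/-! ## Distinct integer bipartitions -/

/-- The factors 1/(Q)_n and 1/(Q)_s of the double series are replaced by sums over sets. In the
resulting sum over (n, s) and pairs of sets, each pair of sets meets exactly one (n, s), namely its
cardinalities. -/
theorem hasSum_finset_pair {A : Type*} [CommRing A] [TopologicalSpace A] [DiscreteTopology A]
    {Q a b : A⟦X⟧} (hQ : (X : A⟦X⟧) ∣ Q) (ha : (X : A⟦X⟧) ∣ a) (hb : (X : A⟦X⟧) ∣ b) :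
    HasSum (fun σ : Finset ℕ × Finset ℕ => (a ^ σ.1.card * b ^ σ.2.card) *
        (Q ^ (σ.1.card * σ.2.card) * (Q ^ excess σ.1 * Q ^ excess σ.2)))
      (qPochInf (a * b) Q * Ring.inverse (qPochInf a Q * qPochInf b Q)) := by
  have hab := (Vanishing.of_nat fun n => pow_dvd_pow_of_dvd ha n).prod
      (Vanishing.of_nat fun n => pow_dvd_pow_of_dvd hb n)
  have hf : ∀ p : ℕ × ℕ, Vanishing (fun σ : Finset ℕ × Finset ℕ =>
      Q ^ (p.1 * p.2) * (finsetTerm Q p.1 σ.1 * finsetTerm Q p.2 σ.2)) := fun p => by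
    have h := ((vanishing_finsetTerm hQ p.1).prod (vanishing_finsetTerm hQ p.2)).mul_left
      fun _ => Q ^ (p.1 * p.2)
    exact h
  have hv := hab.dependent hf
  have h1 := hv.hasSum_prod (fun p => ?_) (hasSum_double hQ ha hb)
  · rw [← (Equiv.prodComm _ _).hasSum_iff] at h1
    refine h1.prod_fiberwise fun σ => ?_
    simp only [Function.comp_apply, Equiv.prodComm_apply, Prod.swap_prod_mk]
    have h2 := hasSum_single (f := fun p : ℕ × ℕ => (a ^ p.1 * b ^ p.2) * (Q ^ (p.1 * p.2) *
        (finsetTerm Q p.1 σ.1 * finsetTerm Q p.2 σ.2))) (σ.1.card, σ.2.card) fun p hp => by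
      simp only [finsetTerm]
      by_cases h : σ.1.card = p.1
      · rw [if_neg (fun h' : σ.2.card = p.2 => hp (by rw [h, h']))]
        simp
      · rw [if_neg h]
        simp
    simp only [finsetTerm, if_true] at h2
    exact h2
  · have h2 := (vanishing_finsetTerm hQ p.1).hasSum_mul (vanishing_finsetTerm hQ p.2)
      (hasSum_finsetTerm hQ p.1) (hasSum_finsetTerm hQ p.2)
    have h3 := (h2.mul_left (Q ^ (p.1 * p.2))).mul_left (a ^ p.1 * b ^ p.2)
    exact h3

theorem two_mul_choose_succ (n : ℕ) : 2 * (((n + 1).choose 2 : ℕ) : ℤ) = (n + 1) * n := by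
  have h : (n + 1).choose 2 * 2 = (n + 1) * n := by
    rw [Nat.choose_two_right, Nat.add_sub_cancel]
    exact Nat.div_mul_cancel (by rw [mul_comm]; exact (Nat.even_mul_succ_self n).two_dvd)
  rw [mul_comm]
  exact_mod_cast h

/-- With n and s parts, 2W = 3n + s + 4ns + 4(excess of π₁) + 4(excess of π₂), which is the exponent
of q^{1/2} in a^n b^s Q^{ns} times the two excess powers. -/
theorem hasSum_bipartitions :
    HasSum (fun π : BPDI => qz (twiceW π).toNat (birank π)) charProduct := by
  have h := hasSum_finset_pair (X_dvd_qz (k := 4) (by norm_num) 0) (X_dvd_qz (k := 3) (by norm_num) (-1))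
    (X_dvd_qz (k := 1) (by norm_num) 1)
  rw [qz_mul_qz_eq, ← ((Equiv.finsetCongr Equiv.pnatEquivNat).prodCongr
    (Equiv.finsetCongr Equiv.pnatEquivNat)).hasSum_iff] at h
  refine h.congr_fun fun π => ?_
  have hs : ∀ s : Finset ℕ+,
      (excess (Equiv.finsetCongr Equiv.pnatEquivNat s) : ℤ) * 2 =
        2 * (∑ i ∈ s, (i : ℕ) : ℕ) - (s.card + 1) * s.card := fun s => by
    have h1 := choose_le_sum (Equiv.finsetCongr Equiv.pnatEquivNat s)
    have h3 : ∑ i ∈ Equiv.finsetCongr Equiv.pnatEquivNat s, (i + 1) = ∑ i ∈ s, (i : ℕ) := by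
      simp [Equiv.finsetCongr]
    have h4 : (Equiv.finsetCongr Equiv.pnatEquivNat s).card = s.card := by simp [Equiv.finsetCongr]
    have h2 := two_mul_choose_succ s.card
    rw [excess, Nat.cast_sub h1, h3, h4]
    linarith
  have hc : ∀ s : Finset ℕ+, (Equiv.finsetCongr Equiv.pnatEquivNat s).card = s.card := fun s => by
    simp [Equiv.finsetCongr]
  simp only [Function.comp_apply, Equiv.prodCongr_apply, Prod.map_fst, Prod.map_snd, hc, qz_pow,
    qz_mul]
  have h1 := hs π.1
  have h2 := hs π.2
  have h3 := twiceW_nonneg π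
  congr 1
  · zify
    rw [Int.toNat_of_nonneg h3, twiceW, size]
    push_cast at h1 h2 ⊢
    linear_combination -2 * h1 - 2 * h2
  · rw [birank]
    ring

/-! ## The crank generating function -/

section QSeries

variable {A : Type*} [CommRing A]

/-- The weight of a part `i + 2` of a partition with `ω` ones: parts greater than `ω` are
marked by `b`. -/
def partWeight (Q b : A⟦X⟧) (ω i : ℕ) : A⟦X⟧ := Q ^ (i + 2) * if ω < i + 2 then b else 1

/-- The summand that marks the sum and the maximum of the parts `i + 2`. -/
def maxTerm (Q b : A⟦X⟧) (μ : Multiset ℕ) : A⟦X⟧ :=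
  b ^ (μ.map fun i => i + 2).sup * Q ^ (μ.map fun i => i + 2).sum

/-- The summand of the crank generating function that belongs to the partition with `ω` ones, whose
other parts are the numbers `i + 2` for `i` in `μ`. -/
def crankTerm (Q a b : A⟦X⟧) (ω : ℕ) (μ : Multiset ℕ) : A⟦X⟧ :=
  a ^ ω * if ω = 0 then maxTerm Q b μ else multisetTerm (partWeight Q b ω) μ

theorem X_pow_dvd_partWeight {Q : A⟦X⟧} (hQ : (X : A⟦X⟧) ∣ Q) (b : A⟦X⟧) (ω i : ℕ) :
    (X : A⟦X⟧) ^ (i + 1) ∣ partWeight Q b ω i :=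
  ((pow_dvd_pow _ (by omega)).trans (pow_dvd_pow_of_dvd hQ (i + 2))).mul_right _

theorem sup_map_add_two {μ : Multiset ℕ} (h : μ ≠ 0) :
    (μ.map fun i => i + 2).sup = μ.sup + 2 := by
  refine le_antisymm (Multiset.sup_le.2 fun k hk => ?_) ?_
  · obtain ⟨i, hi, rfl⟩ := Multiset.mem_map.1 hk
    exact Nat.add_le_add_right (Multiset.le_sup hi) 2
  · obtain ⟨i, hi⟩ := Multiset.exists_mem_of_ne_zero h
    have h1 : i + 2 ≤ (μ.map fun i => i + 2).sup := Multiset.le_sup (Multiset.mem_map_of_mem _ hi)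
    have h2 : μ.sup ≤ (μ.map fun i => i + 2).sup - 2 := Multiset.sup_le.2 fun k hk => by
      have : k + 2 ≤ (μ.map fun i => i + 2).sup := Multiset.le_sup (Multiset.mem_map_of_mem _ hk)
      omega
    omega

theorem vanishing_maxTerm {Q : A⟦X⟧} (hQ : (X : A⟦X⟧) ∣ Q) (b : A⟦X⟧) :
    Vanishing (maxTerm Q b) := fun d => by
  refine (finite_multiset_sum_lt d).subset fun μ hμ => ?_
  by_contra h
  have h1 : (μ.map fun i => i + 1).sum ≤ (μ.map fun i => i + 2).sum :=
    Multiset.sum_map_le_sum_map _ _ fun i _ => by omega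
  have h2 : ¬ (μ.map fun i => i + 1).sum < d := h
  exact hμ (((pow_dvd_pow _ (by omega)).trans (pow_dvd_pow_of_dvd hQ _)).mul_left _)

theorem multisetTerm_ite_le (Q : A⟦X⟧) (j : ℕ) (μ : Multiset ℕ) :
    multisetTerm (fun i => if i ≤ j then Q ^ (i + 2) else 0) μ =
      if μ.sup ≤ j then Q ^ (μ.map fun i => i + 2).sum else 0 := by
  induction μ using Multiset.induction_on with
  | empty => simp
  | cons i μ ih =>
    rw [multisetTerm_cons, ih, Multiset.sup_cons, Multiset.map_cons, Multiset.sum_cons]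
    by_cases h1 : i ≤ j <;> by_cases h2 : μ.sup ≤ j <;> simp [h1, h2, pow_add]

variable [TopologicalSpace A] [DiscreteTopology A]

/-- Here ω = j + 1. The parts 2, …, j+1 are unmarked and, together with the missing factor for the
part 1, form (Q)_{j+1}; the parts from j+2 on carry b. -/
theorem tprod_one_sub_partWeight {Q : A⟦X⟧} (hQ : (X : A⟦X⟧) ∣ Q) (b : A⟦X⟧) (j : ℕ) :
    (1 - Q) * ∏' i, (1 - partWeight Q b (j + 1) i) =
      qPoch Q Q (j + 1) * qPochInf (b * Q * Q ^ (j + 1)) Q := by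
  have hv : ∀ i, (X : A⟦X⟧) ^ i ∣ partWeight Q b (j + 1) (i + j) := fun i =>
    (pow_dvd_pow X (by omega : i ≤ i + j + 1)).trans (X_pow_dvd_partWeight hQ b (j + 1) (i + j))
  have hm := multipliable_one_sub hv
  rw [← Multipliable.prod_mul_tprod_nat_mul' (f := fun i => 1 - partWeight Q b (j + 1) i) hm,
    ← mul_assoc, qPoch_succ']
  congr 1
  · congr 1
    refine Finset.prod_congr rfl fun i hi => ?_
    have := Finset.mem_range.1 hi
    rw [partWeight, if_neg (by omega)]
    ring
  · rw [qPochInf]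
    congr 1
    funext i
    rw [partWeight, if_pos (by omega)]
    ring

theorem hasSum_partWeight {Q b : A⟦X⟧} (hQ : (X : A⟦X⟧) ∣ Q) (hb : (X : A⟦X⟧) ∣ b) (j : ℕ) :
    HasSum (multisetTerm (partWeight Q b (j + 1)))
      ((1 - Q) * Ring.inverse (qPochInf (b * Q) Q) *
        (qPoch (b * Q) Q (j + 1) * Ring.inverse (qPoch Q Q (j + 1)))) := by
  have h := hasSum_multisetTerm (X_pow_dvd_partWeight hQ b (j + 1))
  have hu := isUnit_tprod_one_sub (X_pow_dvd_partWeight hQ b (j + 1))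
  have e := tprod_one_sub_partWeight hQ b j
  have h1 := isUnit_qPoch Q hQ (j + 1)
  have h2 : IsUnit (qPochInf (b * Q * Q ^ (j + 1)) Q) := isUnit_qPochInf ((hb.mul_right _).mul_right _) hQ
  have e3 := Ring.mul_inverse_cancel _ hu
  have e4 := Ring.inverse_mul_cancel _ (h1.mul h2)
  have key : Ring.inverse (∏' i, (1 - partWeight Q b (j + 1) i)) =
      (1 - Q) * Ring.inverse (qPoch Q Q (j + 1) * qPochInf (b * Q * Q ^ (j + 1)) Q) := by
    rw [← e] at e4 ⊢
    linear_combination (-(Ring.inverse (∏' i, (1 - partWeight Q b (j + 1) i)))) * e4 +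
      (1 - Q) * Ring.inverse ((1 - Q) * ∏' i, (1 - partWeight Q b (j + 1) i)) * e3
  rw [key, Ring.inverse_mul (Or.inl h1), inverse_qPochInf_mul_pow hQ (hb.mul_right Q)] at h
  convert h using 1
  ring

theorem hasSum_bounded {Q : A⟦X⟧} (hQ : (X : A⟦X⟧) ∣ Q) (j : ℕ) :
    HasSum (multisetTerm fun i => if i ≤ j then Q ^ (i + 2) else 0)
      ((1 - Q) * Ring.inverse (qPoch Q Q (j + 2))) := by
  have hw : ∀ i, (X : A⟦X⟧) ^ (i + 1) ∣ if i ≤ j then Q ^ (i + 2) else 0 := fun i => by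
    split_ifs
    · exact (pow_dvd_pow _ (by omega)).trans (pow_dvd_pow_of_dvd hQ (i + 2))
    · exact dvd_zero _
  have h := hasSum_multisetTerm hw
  have e : qPoch Q Q (j + 2) = (1 - Q) * ∏' i, (1 - if i ≤ j then Q ^ (i + 2) else 0) := by
    rw [tprod_eq_prod (s := Finset.range (j + 1)) fun i hi => by
      rw [Finset.mem_range] at hi
      rw [if_neg (by omega), sub_zero], qPoch_succ']
    congr 1
    refine Finset.prod_congr rfl fun i hi => ?_
    have := Finset.mem_range.1 hi
    rw [if_pos (by omega)]
    ring
  have hu : IsUnit (1 - Q) := isUnit_one_sub_of_dvd hQ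
  rw [e, Ring.inverse_mul (Or.inl hu), mul_comm (Ring.inverse _), ← mul_assoc,
    Ring.mul_inverse_cancel _ hu, one_mul]
  exact h

/-- The summand of `maxTerm` restricted to the multisets with maximum `j`. -/
def maxTermAt (Q b : A⟦X⟧) (j : ℕ) (μ : Multiset ℕ) : A⟦X⟧ :=
  if μ ≠ 0 ∧ μ.sup = j then maxTerm Q b μ else 0

/-- Removing one copy of the maximum leaves an arbitrary multiset bounded by j; the removed part j+2
contributes (bQ)^{j+2}. -/
theorem hasSum_maxTermAt {Q : A⟦X⟧} (hQ : (X : A⟦X⟧) ∣ Q) (b : A⟦X⟧) (j : ℕ) :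
    HasSum (maxTermAt Q b j)
      ((1 - Q) * ((b * Q) ^ (j + 2) * Ring.inverse (qPoch Q Q (j + 2)))) := by
  have hinj : Function.Injective fun μ : Multiset ℕ => j ::ₘ μ :=
    fun s t h => (Multiset.cons_inj_right j).1 h
  refine (hinj.hasSum_iff fun μ hμ => ?_).1 ?_
  · rw [maxTermAt, if_neg]
    rintro ⟨h0, hj⟩
    have hmem : ∀ ν : Multiset ℕ, ν ≠ 0 → ν.sup ∈ ν := fun ν => by
      induction ν using Multiset.induction_on with
      | empty => exact fun h => absurd rfl h
      | cons i ν ih =>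
        intro _
        rw [Multiset.sup_cons, Multiset.mem_cons]
        by_cases hν : ν = 0
        · simp [hν]
        · rcases le_total i ν.sup with h | h
          · right
            rw [sup_eq_right.2 h]
            exact ih hν
          · left
            exact sup_eq_left.2 h
    obtain ⟨ν, hν⟩ := Multiset.exists_cons_of_mem (hmem μ h0)
    exact hμ ⟨ν, by rw [← hj]; exact hν.symm⟩
  · have h := (hasSum_bounded hQ j).mul_left ((b * Q) ^ (j + 2))
    rw [mul_left_comm]
    refine h.congr_fun fun μ => ?_
    rw [Function.comp_apply, maxTermAt, maxTerm, multisetTerm_ite_le,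
      sup_map_add_two (Multiset.cons_ne_zero), Multiset.sup_cons, Multiset.map_cons,
      Multiset.sum_cons]
    by_cases hj : μ.sup ≤ j
    · rw [if_pos ⟨Multiset.cons_ne_zero, sup_eq_left.2 hj⟩, if_pos hj, sup_eq_left.2 hj]
      ring
    · rw [if_neg fun h => hj (sup_eq_left.1 h.2), if_neg hj, mul_zero]

theorem vanishing_maxTermAt {Q : A⟦X⟧} (hQ : (X : A⟦X⟧) ∣ Q) (b : A⟦X⟧) :
    Vanishing (fun p : ℕ × Multiset ℕ => maxTermAt Q b p.1 p.2) := fun d => by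
  refine ((vanishing_maxTerm hQ b d).image fun μ => (μ.sup, μ)).subset fun p hp => ?_
  have hp' : ¬ (X : A⟦X⟧) ^ d ∣ maxTermAt Q b p.1 p.2 := hp
  rw [maxTermAt] at hp'
  split_ifs at hp' with h
  · exact ⟨p.2, hp', Prod.ext h.2 rfl⟩
  · exact absurd (dvd_zero _) hp'

/-- The sums for fixed maximum form Euler's series for 1/(bQ)_∞ without its first two terms. Those
terms, and the 1 for the empty multiset, produce the correction Q - bQ. -/
theorem hasSum_maxTerm {Q b : A⟦X⟧} (hQ : (X : A⟦X⟧) ∣ Q) (hb : (X : A⟦X⟧) ∣ b) :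
    HasSum (maxTerm Q b) ((1 - Q) * Ring.inverse (qPochInf (b * Q) Q) + (Q - b * Q)) := by
  have h1 := hasSum_inverse_qPochInf hQ (hb.mul_right Q)
  rw [← hasSum_nat_add_iff' 2] at h1
  have h2 := (vanishing_maxTermAt hQ b).hasSum_prod (fun j => hasSum_maxTermAt hQ b j)
    (h1.mul_left (1 - Q))
  rw [← (Equiv.prodComm _ _).hasSum_iff] at h2
  have h3 : HasSum (fun μ : Multiset ℕ => if μ = 0 then 0 else maxTerm Q b μ) _ :=
    h2.prod_fiberwise fun μ => by
      have h := hasSum_single (f := fun j => maxTermAt Q b j μ) μ.sup fun j hj => by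
        rw [maxTermAt, if_neg fun h => hj h.2.symm]
      simp only [maxTermAt] at h ⊢
      by_cases h0 : μ = 0
      · simp [h0]
      · simpa [h0] using h
  have h4 := h3.add (hasSum_ite_eq (0 : Multiset ℕ) (1 : A⟦X⟧))
  have hu : IsUnit (1 - Q) := isUnit_one_sub_of_dvd hQ
  have e := Ring.mul_inverse_cancel _ hu
  convert h4 using 1
  · funext μ
    by_cases h0 : μ = 0
    · simp [h0, maxTerm]
    · simp [h0]
  · simp only [Finset.sum_range_succ, Finset.sum_range_zero, qPoch_zero, qPoch_succ, pow_zero,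
      pow_one, Ring.inverse_one, one_mul, mul_one, zero_add]
    linear_combination (b * Q) * e

theorem vanishing_crankTerm {Q a : A⟦X⟧} (b : A⟦X⟧) (hQ : (X : A⟦X⟧) ∣ Q) (ha : (X : A⟦X⟧) ∣ a) :
    Vanishing (fun p : ℕ × Multiset ℕ => crankTerm Q a b p.1 p.2) := by
  have hva : Vanishing (fun n : ℕ => a ^ n) := Vanishing.of_nat fun n => pow_dvd_pow_of_dvd ha n
  have hg : ∀ ω : ℕ, Vanishing (fun μ : Multiset ℕ =>
      if ω = 0 then maxTerm Q b μ else multisetTerm (partWeight Q b ω) μ) := fun ω => by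
    by_cases h : ω = 0
    · simp only [h, if_true]
      exact vanishing_maxTerm hQ b
    · simp only [h, if_false]
      exact vanishing_multisetTerm (X_pow_dvd_partWeight hQ b ω)
  have h := hva.dependent hg
  exact h

/-- After the correction at ω = 0 is set aside, every ω contributes a^ω (bQ)_ω/(Q)_ω up to a common
factor, so the q-binomial theorem applies; ab = Q turns (abQ)_∞ into (Q^2)_∞. -/
theorem hasSum_crankTerm {Q a b : A⟦X⟧} (hQ : (X : A⟦X⟧) ∣ Q) (ha : (X : A⟦X⟧) ∣ a)
    (hb : (X : A⟦X⟧) ∣ b) (hab : a * b = Q) :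
    HasSum (fun p : ℕ × Multiset ℕ => crankTerm Q a b p.1 p.2)
      (qPochInf Q Q * Ring.inverse (qPochInf a Q * qPochInf (b * Q) Q) + (Q - b * Q)) := by
  have hbQ : (X : A⟦X⟧) ∣ b * Q := hb.mul_right Q
  have h1 := ((hasSum_qBinomial (b * Q) hQ ha).mul_left
    ((1 - Q) * Ring.inverse (qPochInf (b * Q) Q))).add (hasSum_ite_eq 0 (Q - b * Q))
  have e : (1 - Q) * Ring.inverse (qPochInf (b * Q) Q) *
      (qPochInf (b * Q * a) Q * Ring.inverse (qPochInf a Q)) =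
      qPochInf Q Q * Ring.inverse (qPochInf a Q * qPochInf (b * Q) Q) := by
    rw [Ring.inverse_mul (Or.inl (isUnit_qPochInf ha hQ)), qPochInf_eq_one_sub_mul Q hQ,
      show b * Q * a = Q * Q by rw [← hab]; ring]
    ring
  rw [e] at h1
  refine (vanishing_crankTerm b hQ ha).hasSum_prod (fun ω => ?_) h1
  rcases ω with - | j
  · simpa [crankTerm] using hasSum_maxTerm hQ hb
  · have h := (hasSum_partWeight hQ hb j).mul_left (a ^ (j + 1))
    simp only [crankTerm, Nat.add_eq_zero_iff, one_ne_zero, and_false, if_false, add_zero]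
    rw [mul_left_comm]
    exact h

end QSeries

/-! ## Partitions by crank -/

/-- The partition with `ω` ones whose other parts are the numbers `i + 2` for `i` in `μ`. -/
def toPartition (p : ℕ × Multiset ℕ) : Σ n : ℕ, n.Partition :=
  ⟨p.1 + (p.2.map fun i => i + 2).sum,
    { parts := Multiset.replicate p.1 1 + p.2.map fun i => i + 2
      parts_pos := by
        intro i hi
        rcases Multiset.mem_add.1 hi with h | h
        · rw [Multiset.eq_of_mem_replicate h]
          exact one_pos
        · obtain ⟨j, _, rfl⟩ := Multiset.mem_map.1 h
          omega
      parts_sum := by simp }⟩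

theorem count_one_map_add_two (μ : Multiset ℕ) : (μ.map fun i => i + 2).count 1 = 0 :=
  Multiset.count_eq_zero_of_notMem fun h => by
    obtain ⟨j, _, hj⟩ := Multiset.mem_map.1 h
    omega

theorem toPartition_injective : Function.Injective toPartition := by
  intro p q h
  have h1 : (toPartition p).2.parts = (toPartition q).2.parts := by rw [h]
  simp only [toPartition] at h1
  have h2 := congrArg (Multiset.count 1) h1
  simp only [Multiset.count_add, count_one_map_add_two, Multiset.count_replicate_self,
    add_zero] at h2
  rw [h2, add_right_inj] at h1
  exact Prod.ext h2 (Multiset.map_injective (add_left_injective 2) h1)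

theorem sigma_partition_ext {x y : Σ n : ℕ, n.Partition} (h : x.2.parts = y.2.parts) : x = y := by
  obtain ⟨n, p⟩ := x
  obtain ⟨m, q⟩ := y
  have hn : n = m := by rw [← p.parts_sum, ← q.parts_sum]; exact congrArg _ h
  subst hn
  exact congrArg _ (Nat.Partition.ext h)

theorem toPartition_surjective : Function.Surjective toPartition := by
  intro x
  refine ⟨(x.2.parts.count 1, (x.2.parts.filter fun i => i ≠ 1).map fun i => i - 2),
    sigma_partition_ext ?_⟩
  simp only [toPartition, Multiset.map_map]
  rw [Multiset.map_congr (g := id) rfl fun i hi => ?_, Multiset.map_id]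
  · rw [← Multiset.filter_eq']
    exact Multiset.filter_add_not _ _
  · obtain ⟨h1, h2⟩ := Multiset.mem_filter.1 hi
    have := x.2.parts_pos h1
    simp only [Function.comp_apply, id_eq]
    omega

theorem maxTerm_qz (μ : Multiset ℕ) : maxTerm (qz 4 0) (qz 1 1) μ =
    qz ((μ.map fun i => i + 2).sup + 4 * (μ.map fun i => i + 2).sum)
      ((μ.map fun i => i + 2).sup : ℕ) := by
  rw [maxTerm, qz_pow, qz_pow, qz_mul]
  congr 1 <;> ring

theorem multisetTerm_partWeight_qz (ω : ℕ) (μ : Multiset ℕ) :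
    multisetTerm (partWeight (qz 4 0) (qz 1 1) ω) μ =
      qz (((μ.map fun i => i + 2).filter fun i => ω < i).card + 4 * (μ.map fun i => i + 2).sum)
        (((μ.map fun i => i + 2).filter fun i => ω < i).card : ℤ) := by
  induction μ using Multiset.induction_on with
  | empty => simp [qz_zero]
  | cons i μ ih =>
    rw [multisetTerm_cons, ih, partWeight, Multiset.map_cons, Multiset.sum_cons]
    by_cases h : ω < i + 2
    · rw [if_pos h, Multiset.filter_cons_of_pos _ h, Multiset.card_cons, qz_pow, qz_mul, qz_mul]
      congr 1
      · ring
      · push_cast; ring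
    · rw [if_neg h, Multiset.filter_cons_of_neg _ h, qz_pow, mul_one, qz_mul]
      congr 1 <;> ring

/-- The monomial attached to a partition. -/
def partitionTerm (x : Σ n : ℕ, n.Partition) : QZ := qz (4 * (x.1 : ℤ) + crank x.2).toNat (crank x.2)

theorem partitionTerm_toPartition (p : ℕ × Multiset ℕ) :
    partitionTerm (toPartition p) = crankTerm (qz 4 0) (qz 3 (-1)) (qz 1 1) p.1 p.2 := by
  obtain ⟨ω, μ⟩ := p
  have hcount : (toPartition (ω, μ)).2.parts.count 1 = ω := by
    simp only [toPartition, Multiset.count_add, count_one_map_add_two,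
      Multiset.count_replicate_self, add_zero]
  rw [crankTerm, partitionTerm, crank, hcount]
  by_cases h : ω = 0
  · subst h
    rw [if_pos rfl, if_pos rfl, pow_zero, one_mul, maxTerm_qz]
    simp only [toPartition, Multiset.replicate_zero, zero_add]
    congr 1
    omega
  · rw [if_neg h, if_neg h, multisetTerm_partWeight_qz, qz_pow, qz_mul]
    have hf : (toPartition (ω, μ)).2.parts.filter (fun i => ω < i) =
        (μ.map fun i => i + 2).filter fun i => ω < i := by
      simp only [toPartition, Multiset.filter_add]
      rw [Multiset.filter_eq_nil.2 fun i hi => by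
        rw [Multiset.eq_of_mem_replicate hi]; omega, zero_add]
    rw [hf]
    simp only [toPartition]
    congr 1
    · omega
    · ring

theorem hasSum_partitionTerm : HasSum partitionTerm
    (qPochInf (qz 4 0) (qz 4 0) * Ring.inverse (qPochInf (qz 3 (-1)) (qz 4 0) *
      qPochInf (qz 1 1 * qz 4 0) (qz 4 0)) + (qz 4 0 - qz 1 1 * qz 4 0)) := by
  rw [← (Equiv.ofBijective toPartition ⟨toPartition_injective, toPartition_surjective⟩).hasSum_iff]
  have h := hasSum_crankTerm (Q := qz 4 0) (a := qz 3 (-1)) (b := qz 1 1) (X_dvd_qz (by norm_num) _)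
    (X_dvd_qz (by norm_num) _) (X_dvd_qz (by norm_num) _) qz_mul_qz_eq
  exact h.congr_fun partitionTerm_toPartition

theorem hasSum_crank_card : HasSum (fun t : ℕ × ℤ =>
      (Fintype.card {p : t.1.Partition // crank p = t.2} : ℤ) • qz (4 * (t.1 : ℤ) + t.2).toNat t.2)
    (qPochInf (qz 4 0) (qz 4 0) * Ring.inverse (qPochInf (qz 3 (-1)) (qz 4 0) *
      qPochInf (qz 1 1 * qz 4 0) (qz 4 0)) + (qz 4 0 - qz 1 1 * qz 4 0)) := by
  have hleft : ∀ (n : ℕ) (m : ℤ) (x : {p : n.Partition // crank p = m}),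
      (⟨(n, crank x.1), ⟨x.1, rfl⟩⟩ : Σ t : ℕ × ℤ, {p : t.1.Partition // crank p = t.2}) =
        ⟨(n, m), x⟩ := by
    rintro n m ⟨p, rfl⟩
    rfl
  let e : (Σ t : ℕ × ℤ, {p : t.1.Partition // crank p = t.2}) ≃ Σ n : ℕ, n.Partition :=
    { toFun := fun x => ⟨x.1.1, x.2.1⟩
      invFun := fun x => ⟨(x.1, crank x.2), ⟨x.2, rfl⟩⟩
      left_inv := fun x => hleft x.1.1 x.1.2 x.2
      right_inv := fun _ => rfl }
  refine (e.hasSum_iff.2 hasSum_partitionTerm).sigma fun t => ?_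
  have h := hasSum_fintype (fun p : {p : t.1.Partition // crank p = t.2} =>
    (partitionTerm ∘ e) ⟨t, p⟩)
  convert h using 1
  rw [Finset.sum_congr rfl fun p _ => show (partitionTerm ∘ e) ⟨t, p⟩ =
    qz (4 * (t.1 : ℤ) + t.2).toNat t.2 by
      simp only [Function.comp_apply, e, Equiv.coe_fn_mk, partitionTerm, p.2],
    Finset.sum_const, Finset.card_univ, natCast_zsmul]

theorem crank_one (p : (1 : ℕ).Partition) : crank p = -1 := by
  have hp : p.parts = {1} := by rw [Subsingleton.elim p (Nat.Partition.indiscrete 1)]; rfl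
  rw [crank, hp]
  simp

/-- The only partition of 1 has crank -1, so the convention at n = 1 differs from the true count by
+1 at m = 1 and -1 at m = 0. -/
theorem crankCount_eq (m : ℤ) (n : ℕ) :
    crankCount m n = (Fintype.card {p : n.Partition // crank p = m} : ℤ) +
      ((if (n, m) = (1, 1) then 1 else 0) - if (n, m) = (1, 0) then 1 else 0) := by
  rw [crankCount]
  by_cases hn : n = 1
  · subst hn
    have hc : (Fintype.card {p : (1 : ℕ).Partition // crank p = m} : ℤ) = if m = -1 then 1 else 0 := by
      simp only [crank_one]
      split_ifs with h
      · simp [h, Fintype.card_subtype]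
      · simp [Ne.symm h]
    rw [hc]
    simp only [if_true, Prod.mk.injEq, true_and]
    split_ifs <;> omega
  · simp [hn]

theorem hasSum_crankCount : HasSum (fun t : ℕ × ℤ =>
      crankCount t.2 t.1 • qz (4 * (t.1 : ℤ) + t.2).toNat t.2)
    (qPochInf (qz 4 0) (qz 4 0) * Ring.inverse (qPochInf (qz 3 (-1)) (qz 4 0) *
      qPochInf (qz 1 1 * qz 4 0) (qz 4 0))) := by
  have h1 := hasSum_ite_eq ((1, 1) : ℕ × ℤ) (qz 5 1)
  have h2 := hasSum_ite_eq ((1, 0) : ℕ × ℤ) (qz 4 0)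
  have h := hasSum_crank_card.add (h1.sub h2)
  -- The change of convention at n = 1 cancels the correction Q - bQ exactly.
  rw [qz_mul, show 1 + 4 = 5 from rfl, show (1 : ℤ) + 0 = 1 from rfl, add_assoc,
    show qz 4 0 - qz 5 1 + (qz 5 1 - qz 4 0) = 0 by ring, add_zero] at h
  rw [qz_mul]
  refine h.congr_fun fun t => ?_
  rw [crankCount_eq, add_smul, sub_smul]
  congr 2
  · split_ifs with ht
    · rw [Prod.mk.eta] at ht
      rw [ht, one_smul]
      rfl
    · exact zero_smul _ _
  · split_ifs with ht
    · rw [Prod.mk.eta] at ht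
      rw [ht, one_smul]
      rfl
    · exact zero_smul _ _

/-- A nonzero count forces m ≥ -n, so 4n + m < d bounds both n and |m|. -/
theorem vanishing_crankCount : Vanishing (fun t : ℕ × ℤ =>
    crankCount t.2 t.1 • qz (4 * (t.1 : ℤ) + t.2).toNat t.2) := fun d => by
  refine ((Set.finite_Iio d).prod (Set.finite_Icc (-(d : ℤ)) d)).subset fun t ht => ?_
  have ht' : ¬ (X : QZ) ^ d ∣ crankCount t.2 t.1 • qz (4 * (t.1 : ℤ) + t.2).toNat t.2 := ht
  have hc : crankCount t.2 t.1 ≠ 0 := fun h => ht' (by rw [h, zero_smul]; exact dvd_zero _)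
  have h1 : (4 * (t.1 : ℤ) + t.2).toNat < d := by
    by_contra hd
    rw [zsmul_eq_mul] at ht'
    exact ht' ((X_pow_dvd_qz (not_lt.1 hd) t.2).mul_left _)
  have h2 : -(t.1 : ℤ) ≤ t.2 := by
    rw [crankCount] at hc
    split_ifs at hc with h h' h'
    · omega
    · omega
    · exact absurd rfl hc
    · have h4 : Fintype.card {p : t.1.Partition // crank p = t.2} ≠ 0 := by exact_mod_cast hc
      obtain ⟨p, hp⟩ := Fintype.card_pos_iff.1 (Nat.pos_of_ne_zero h4)
      have := neg_le_crank p
      omega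
  rw [Set.mem_prod, Set.mem_Iio, Set.mem_Icc]
  omega

theorem charProduct_eq_crank : charProduct =
    qPochInf (qz 4 0) (qz 4 0) * Ring.inverse (qPochInf (qz 3 (-1)) (qz 4 0) *
      qPochInf (qz 1 1 * qz 4 0) (qz 4 0)) * Ring.inverse (1 - qz 1 1) := by
  rw [charProduct, qPochInf_eq_one_sub_mul (qz 1 1) (X_dvd_qz (by norm_num) _),
    mul_left_comm, Ring.inverse_mul (Or.inl (isUnit_one_sub_qz one_pos 1))]
  ring

theorem hasSum_charProduct_crank : HasSum (fun t : ℕ × ℤ × ℕ =>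
      crankCount (t.2.1 - (t.2.2 : ℤ)) t.1 • qz (4 * (t.1 : ℤ) + t.2.1).toNat t.2.1) charProduct := by
  have hb : (X : QZ) ∣ -qz 1 1 := (X_dvd_qz (by norm_num) _).neg_right
  have h1 := hasSum_inverse_one_add hb
  simp only [neg_neg, ← sub_eq_add_neg] at h1
  have hv : Vanishing (fun n : ℕ => qz 1 1 ^ n) :=
    Vanishing.of_nat fun n => pow_dvd_pow_of_dvd (X_dvd_qz (by norm_num) _) n
  have h2 := vanishing_crankCount.hasSum_mul hv hasSum_crankCount h1
  rw [← charProduct_eq_crank] at h2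
  let e : ℕ × ℤ × ℕ ≃ (ℕ × ℤ) × ℕ :=
    { toFun := fun t => ((t.1, t.2.1 - t.2.2), t.2.2)
      invFun := fun t => (t.1.1, t.1.2 + t.2, t.2)
      left_inv := fun t => by simp
      right_inv := fun t => by simp }
  rw [← e.hasSum_iff] at h2
  refine h2.congr_fun fun t => ?_
  simp only [Function.comp_apply, e, Equiv.coe_fn_mk]
  by_cases hc : crankCount (t.2.1 - (t.2.2 : ℤ)) t.1 = 0
  · rw [hc, zero_smul, zero_smul, zero_mul]
  · have h3 := exponent_nonneg (m := t.2.1 - (t.2.2 : ℤ)) (l := 0) le_rfl (by rwa [sub_zero])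
    rw [smul_mul_assoc, qz_pow, qz_mul]
    congr 2
    · omega
    · ring

/-! ## The product and the Lambert series expressions -/

/-- The factors are 1 + x/(1-x), so their product converges; multiplied termwise by the factors 1 -
x it becomes the constant product 1. -/
theorem hasProd_inverse_one_sub {A : Type*} [CommRing A] [TopologicalSpace A] [DiscreteTopology A]
    {x : ℕ → A⟦X⟧} (hx : ∀ n, (X : A⟦X⟧) ^ (n + 1) ∣ x n) :
    HasProd (fun n => Ring.inverse (1 - x n)) (Ring.inverse (∏' n, (1 - x n))) := by
  have hx' : ∀ n, (X : A⟦X⟧) ^ n ∣ x n := fun n => (pow_dvd_pow _ n.le_succ).trans (hx n)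
  have hu : ∀ n, IsUnit (1 - x n) := fun n =>
    isUnit_one_sub_of_dvd ((dvd_pow_self _ n.succ_ne_zero).trans (hx n))
  have h1 : Multipliable fun n => 1 + x n * Ring.inverse (1 - x n) :=
    multipliable_one_add fun n => (hx' n).mul_right _
  have h2 : (fun n => 1 + x n * Ring.inverse (1 - x n)) = fun n => Ring.inverse (1 - x n) := by
    funext n
    linear_combination -Ring.mul_inverse_cancel _ (hu n)
  rw [h2] at h1
  have h3 := h1.hasProd.mul (multipliable_one_sub hx').hasProd
  simp only [fun n => Ring.inverse_mul_cancel _ (hu n)] at h3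
  have h4 := h3.unique hasProd_one
  have h5 : (∏' n, Ring.inverse (1 - x n)) = Ring.inverse (∏' n, (1 - x n)) := by
    rw [← one_mul (Ring.inverse (∏' n, (1 - x n))),
      Ring.eq_mul_inverse_iff_mul_eq _ _ _ (isUnit_tprod_one_sub hx)]
    exact h4
  rw [← h5]
  exact h1.hasProd

theorem hasProd_inverse_qPochInf {A : Type*} [CommRing A] [TopologicalSpace A] [DiscreteTopology A]
    {x Q : A⟦X⟧} (hx : (X : A⟦X⟧) ∣ x) (hQ : (X : A⟦X⟧) ∣ Q) :
    HasProd (fun n : ℕ => Ring.inverse (1 - x * Q ^ n)) (Ring.inverse (qPochInf x Q)) :=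
  hasProd_inverse_one_sub fun n => by
    rw [pow_succ']
    exact mul_dvd_mul hx (pow_dvd_pow_of_dvd hQ n)

theorem qz_mul_pow_four (k n : ℕ) (m : ℤ) : qz k m * qz 4 0 ^ n = qz (4 * n + k) m := by
  rw [qz_pow, qz_mul]
  congr 1 <;> ring

theorem hasProd_charProduct : HasProd (fun n : ℕ =>
      (1 - qz (4 * (n + 1)) 0) *
        Ring.inverse ((1 - qz (4 * n + 1) 1) * (1 - qz (4 * n + 3) (-1)))) charProduct := by
  have hQ : (X : QZ) ∣ qz 4 0 := X_dvd_qz (by norm_num) _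
  have ha : (X : QZ) ∣ qz 3 (-1) := X_dvd_qz (by norm_num) _
  have hb : (X : QZ) ∣ qz 1 1 := X_dvd_qz (by norm_num) _
  have h := (hasProd_qPochInf (qz 4 0) hQ).mul
    ((hasProd_inverse_qPochInf ha hQ).mul (hasProd_inverse_qPochInf hb hQ))
  simp only [qz_mul_pow_four] at h
  rw [charProduct, mul_comm (qPochInf (qz 3 (-1)) _), Ring.inverse_mul (Or.inl (isUnit_qPochInf hb hQ))]
  refine h.congr_fun fun n => ?_
  rw [Ring.inverse_mul (Or.inl (isUnit_one_sub_qz (by omega) 1)), mul_add, mul_one]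

theorem hasProd_one_add_qz {k : ℕ} (m : ℤ) :
    HasProd (fun l : ℕ => 1 + qz (4 * l + k) m) (qPochInf (-qz k m) (qz 4 0)) := by
  refine (hasProd_qPochInf (-qz k m) (X_dvd_qz (k := 4) (by norm_num) 0)).congr_fun fun n => ?_
  rw [neg_mul, sub_neg_eq_add, qz_mul_pow_four]

theorem hasProd_denominator :
    HasProd (fun i : ℕ => (1 - qz (8 * (i + 1)) 0) * (1 + qz (4 * (i + 1)) 0))
      (qPochInf (qz 4 0 ^ 2) (qz 4 0 ^ 2) * qPochInf (-qz 4 0) (qz 4 0)) := by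
  have hQ : (X : QZ) ∣ qz 4 0 := X_dvd_qz (by norm_num) _
  refine ((hasProd_qPochInf (qz 4 0 ^ 2) (hQ.trans (dvd_pow_self _ two_ne_zero))).mul
    (hasProd_one_add_qz (k := 4) 0)).congr_fun fun n => ?_
  rw [← pow_mul, ← pow_add, qz_pow, mul_zero]
  congr 3
  ring

theorem isUnit_two : IsUnit (2 : QZ) := by
  have h : (2 : QZ) = algebraMap ℚ QZ 2 := (map_ofNat _ 2).symm
  rw [h]
  exact (IsUnit.mk0 (2 : ℚ) two_ne_zero).map _

theorem lambert_left (k : ℕ) : qz k (k : ℤ) * Ring.inverse (1 + qz (4 * k + 3) (-1)) =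
    qz 1 1 ^ k * Ring.inverse (1 + qz 3 (-1) * (qz 3 (-1) * qz 1 1) ^ k) := by
  rw [qz_mul_qz_eq, qz_mul_pow_four, qz_pow, mul_one, mul_one]

theorem lambert_right (k : ℕ) : qz (3 * k) (-(k : ℤ)) * Ring.inverse (1 + qz (4 * k + 1) 1) =
    qz 3 (-1) ^ k * Ring.inverse (1 + qz 1 1 * (qz 3 (-1) * qz 1 1) ^ k) := by
  rw [qz_mul_qz_eq, qz_mul_pow_four, qz_pow, mul_comm 3 k, mul_neg_one]

/-- After (x^2;Q^2)_∞ is split as (x)_∞(-x)_∞ for x = a, b, Q, the Lambert identity becomes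
polynomial in six products. Clearing the unit denominators leaves a multiple of it. -/
theorem charProduct_eq_lambert : charProduct =
      ((∏' l : ℕ, (1 + qz (4 * l + 1) 1)) * (∏' l : ℕ, (1 + qz (4 * l + 3) (-1)))) *
        Ring.inverse (2 * ∏' i : ℕ, ((1 - qz (8 * (i + 1)) 0) * (1 + qz (4 * (i + 1)) 0))) *
        ((∑' k : ℕ, (qz k (k : ℤ) * Ring.inverse (1 + qz (4 * k + 3) (-1)))) +
          (∑' k : ℕ, (qz (3 * k) (-(k : ℤ)) * Ring.inverse (1 + qz (4 * k + 1) 1)))) := by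
  have hQ : (X : QZ) ∣ qz 4 0 := X_dvd_qz (by norm_num) _
  have ha : (X : QZ) ∣ qz 3 (-1) := X_dvd_qz (by norm_num) _
  have hb : (X : QZ) ∣ qz 1 1 := X_dvd_qz (by norm_num) _
  simp only [lambert_left, lambert_right]
  rw [(hasProd_one_add_qz 1).tprod_eq, (hasProd_one_add_qz (-1)).tprod_eq,
    hasProd_denominator.tprod_eq]
  have h := lambert_eq ha hb
  generalize (∑' k : ℕ, qz 1 1 ^ k * Ring.inverse (1 + qz 3 (-1) * (qz 3 (-1) * qz 1 1) ^ k)) +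
    (∑' k : ℕ, qz 3 (-1) ^ k * Ring.inverse (1 + qz 1 1 * (qz 3 (-1) * qz 1 1) ^ k)) = S at h ⊢
  rw [qz_mul_qz_eq, ← qPochInf_mul_neg _ hQ, ← qPochInf_mul_neg _ hQ, ← qPochInf_mul_neg _ hQ] at h
  rw [charProduct, ← qPochInf_mul_neg _ hQ]
  have ua := isUnit_qPochInf ha hQ
  have ub := isUnit_qPochInf hb hQ
  have uQ := isUnit_qPochInf hQ hQ
  have uQ' := isUnit_qPochInf hQ.neg_right hQ
  generalize qPochInf (qz 4 0) (qz 4 0) = PQ at *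
  generalize qPochInf (-qz 4 0) (qz 4 0) = PQ' at *
  generalize qPochInf (qz 3 (-1)) (qz 4 0) = Pa at *
  generalize qPochInf (-qz 3 (-1)) (qz 4 0) = Pa' at *
  generalize qPochInf (qz 1 1) (qz 4 0) = Pb at *
  generalize qPochInf (-qz 1 1) (qz 4 0) = Pb' at *
  rw [mul_right_comm, Ring.eq_mul_inverse_iff_mul_eq _ _ _
    (isUnit_two.mul ((uQ.mul uQ').mul uQ')), mul_right_comm]
  symm
  rw [Ring.eq_mul_inverse_iff_mul_eq _ _ _ (ua.mul ub)]
  linear_combination h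

/-! ## The polynomial model and a basis of the Fock space -/

/-- The action of the mode `χ_{j + 1/2}` on polynomials: a multiple of a partial derivative for
`0 ≤ j`, multiplication by a variable for `j < 0`. -/
def polyMode (j : ℤ) : Module.End ℂ (MvPolynomial ℕ ℂ) :=
  if 0 ≤ j then (-1 : ℂ) ^ j • (MvPolynomial.pderiv j.toNat).toLinearMap
  else LinearMap.mulLeft ℂ (MvPolynomial.X (-j - 1).toNat)

theorem polyMode_of_nonneg {j : ℤ} (h : 0 ≤ j) (p : MvPolynomial ℕ ℂ) :
    polyMode j p = (-1 : ℂ) ^ j • MvPolynomial.pderiv j.toNat p := by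
  rw [polyMode, if_pos h]
  rfl

theorem polyMode_of_neg {j : ℤ} (h : j < 0) (p : MvPolynomial ℕ ℂ) :
    polyMode j p = MvPolynomial.X (-j - 1).toNat * p := by
  rw [polyMode, if_neg (not_le.2 h)]
  rfl

theorem pderiv_comm (i j : ℕ) (p : MvPolynomial ℕ ℂ) :
    MvPolynomial.pderiv i (MvPolynomial.pderiv j p) =
      MvPolynomial.pderiv j (MvPolynomial.pderiv i p) := by
  have h : ⁅(MvPolynomial.pderiv i : Derivation ℂ (MvPolynomial ℕ ℂ) (MvPolynomial ℕ ℂ)),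
      (MvPolynomial.pderiv j : Derivation ℂ (MvPolynomial ℕ ℂ) (MvPolynomial ℕ ℂ))⁆ = 0 := by
    refine MvPolynomial.derivation_ext fun k => ?_
    rw [Derivation.commutator_apply, MvPolynomial.pderiv_X, MvPolynomial.pderiv_X]
    by_cases h1 : k = i <;> by_cases h2 : k = j <;> simp [Pi.single_apply, h1, h2, eq_comm] <;> split_ifs <;> simp
  have h2 := congrArg (fun D => D p) h
  simp only [Derivation.commutator_apply, Derivation.coe_zero, Pi.zero_apply] at h2
  exact sub_eq_zero.1 h2

theorem neg_one_zpow_neg_sub_one (k : ℤ) : (-1 : ℂ) ^ (-k - 1) = -(-1 : ℂ) ^ k := by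
  rw [zpow_sub₀ (by norm_num), zpow_neg, zpow_one]
  rcases Int.even_or_odd k with h | h
  · rw [h.neg_one_zpow]; norm_num
  · rw [h.neg_one_zpow]; norm_num

theorem bracket_antisymm (j k : ℤ) : bracket k j = -bracket j k := by
  rw [bracket, bracket]
  by_cases h : j + k = -1
  · rw [if_pos h, if_pos (by omega), show k = -j - 1 by omega, neg_one_zpow_neg_sub_one]
  · rw [if_neg h, if_neg (by omega), neg_zero]

theorem polyMode_comm_of_nonneg {j : ℤ} (h : 0 ≤ j) (k : ℤ) (p : MvPolynomial ℕ ℂ) :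
    polyMode j (polyMode k p) = polyMode k (polyMode j p) + bracket j k • p := by
  rcases le_or_gt 0 k with h' | h'
  · rw [bracket, if_neg (by omega), zero_smul, add_zero]
    simp only [polyMode_of_nonneg h, polyMode_of_nonneg h', Derivation.map_smul]
    rw [pderiv_comm, smul_comm]
  · simp only [polyMode_of_nonneg h, polyMode_of_neg h', MvPolynomial.pderiv_mul]
    rw [smul_add, mul_smul_comm, add_comm]
    congr 1
    rw [bracket]
    by_cases hjk : j + k = -1
    · rw [if_pos hjk, show (-k - 1).toNat = j.toNat by omega, MvPolynomial.pderiv_X_self, one_mul]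
    · rw [if_neg hjk, MvPolynomial.pderiv_X_of_ne (by omega), zero_mul, smul_zero, zero_smul]

theorem polyMode_comm (j k : ℤ) (p : MvPolynomial ℕ ℂ) :
    polyMode j (polyMode k p) = polyMode k (polyMode j p) + bracket j k • p := by
  rcases le_or_gt 0 j with h | h
  · exact polyMode_comm_of_nonneg h k p
  · rcases le_or_gt 0 k with h' | h'
    · rw [polyMode_comm_of_nonneg h' j p, bracket_antisymm k j, add_assoc, ← add_smul,
        add_neg_cancel, zero_smul, add_zero]
    · rw [bracket, if_neg (by omega), zero_smul, add_zero]
      simp only [polyMode_of_neg h, polyMode_of_neg h']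
      rw [mul_left_comm]

/-- The representation of the mode algebra on polynomials. -/
def polyAction : ModeAlgebra →ₐ[ℂ] Module.End ℂ (MvPolynomial ℕ ℂ) :=
  RingQuot.liftAlgHom ℂ ⟨FreeAlgebra.lift ℂ polyMode, by
    rintro _ _ ⟨j, k⟩
    refine LinearMap.ext fun p => ?_
    simp only [map_mul, map_add, FreeAlgebra.lift_ι_apply, AlgHom.commutes, Module.End.mul_apply,
      LinearMap.add_apply, Module.algebraMap_end_apply]
    exact polyMode_comm j k p⟩

theorem polyAction_mode (j : ℤ) : polyAction (mode j) = polyMode j := by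
  rw [polyAction, mode, toModeAlgebra]
  exact (RingQuot.liftAlgHom_mkAlgHom_apply ℂ _ _ _).trans (FreeAlgebra.lift_ι_apply _ _)

theorem polyAction_vacuumIdeal {x : ModeAlgebra} (hx : x ∈ vacuumIdeal) : polyAction x 1 = 0 := by
  induction hx using Submodule.span_induction with
  | mem x h =>
    obtain ⟨j, hj, rfl⟩ := h
    rw [polyAction_mode, polyMode_of_nonneg hj, MvPolynomial.pderiv_one, smul_zero]
  | zero => rw [map_zero]; rfl
  | add x y _ _ hx hy => rw [map_add, LinearMap.add_apply, hx, hy, add_zero]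
  | smul a x _ hx => rw [smul_eq_mul, map_mul, Module.End.mul_apply, hx, map_zero]

/-- The comparison map from the Fock space to polynomials. -/
def toPoly : Fock →+ MvPolynomial ℕ ℂ :=
  QuotientAddGroup.lift vacuumIdeal.toAddSubgroup
    { toFun := fun x => polyAction x 1
      map_zero' := by rw [map_zero]; rfl
      map_add' := fun x y => by rw [map_add]; rfl } fun _ hx => polyAction_vacuumIdeal hx

theorem toPoly_smul (x : ModeAlgebra) (v : Fock) : toPoly (x • v) = polyAction x (toPoly v) := by
  obtain ⟨y, rfl⟩ := Submodule.mkQ_surjective vacuumIdeal v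
  change polyAction (x * y) 1 = polyAction x (polyAction y 1)
  rw [map_mul, Module.End.mul_apply]

theorem toPoly_chi (j : ℤ) (v : Fock) : toPoly (chi j v) = polyMode j (toPoly v) := by
  rw [chi_apply, toPoly_smul, polyAction_mode]

/-- The comparison map as a linear map. -/
def toPolyLinear : Fock →ₗ[ℂ] MvPolynomial ℕ ℂ :=
  { toPoly with
    map_smul' := fun c v => by
      have h := toPoly_smul (algebraMap ℂ ModeAlgebra c) v
      rw [algebraMap_smul, AlgHom.commutes, Module.algebraMap_end_apply] at h
      exact h }

theorem toPoly_vac : toPoly vac = 1 := by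
  change polyAction 1 1 = 1
  rw [map_one polyAction]
  rfl

/-- The creation operator `χ_{-(i + 1/2)}`. -/
def creation (i : ℕ) : Module.End ℂ Fock := chi (-i - 1)

theorem creation_comm (i j : ℕ) (v : Fock) :
    creation i (creation j v) = creation j (creation i v) := by
  rw [creation, creation, chi_comm, bracket, if_neg (by omega), zero_smul, add_zero]

instance leftCommutative_creation : LeftCommutative fun (i : ℕ) (v : Fock) => creation i v :=
  ⟨creation_comm⟩

/-- The vector obtained from the vacuum by applying creation operators. -/
def fockVec (μ : Multiset ℕ) : Fock := μ.foldr (fun i v => creation i v) vac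

@[simp] theorem fockVec_zero : fockVec 0 = vac := Multiset.foldr_zero _ _

@[simp] theorem fockVec_cons (i : ℕ) (μ : Multiset ℕ) :
    fockVec (i ::ₘ μ) = creation i (fockVec μ) := Multiset.foldr_cons _ _ _ _

theorem toPoly_fockVec (μ : Multiset ℕ) :
    toPoly (fockVec μ) = MvPolynomial.monomial (Multiset.toFinsupp μ) 1 := by
  induction μ using Multiset.induction_on with
  | empty => rw [fockVec_zero, toPoly_vac, map_zero]; rfl
  | cons i μ ih =>
    rw [fockVec_cons, creation, toPoly_chi, polyMode_of_neg (by omega), ih,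
      show (-(-(i : ℤ) - 1) - 1).toNat = i by omega, MvPolynomial.X, MvPolynomial.monomial_mul,
      one_mul, ← Multiset.singleton_add, map_add, Multiset.toFinsupp_singleton]

/-- The polynomial representation sends these vectors to distinct monomials. -/
theorem linearIndependent_fockVec : LinearIndependent ℂ fockVec := by
  refine LinearIndependent.of_comp toPolyLinear ?_
  have h := (MvPolynomial.basisMonomials ℕ ℂ).linearIndependent.comp _
    (Multiset.toFinsupp (α := ℕ)).injective
  have e : toPolyLinear ∘ fockVec = MvPolynomial.basisMonomials ℕ ℂ ∘ Multiset.toFinsupp := by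
    funext μ
    rw [Function.comp_apply, Function.comp_apply, MvPolynomial.coe_basisMonomials]
    exact toPoly_fockVec μ
  rw [e]
  exact h

theorem chi_fockVec_mem (j : ℤ) (μ : Multiset ℕ) :
    chi j (fockVec μ) ∈ Submodule.span ℂ (Set.range fockVec) := by
  have hcr : ∀ (i : ℕ) (v : Fock), v ∈ Submodule.span ℂ (Set.range fockVec) →
      creation i v ∈ Submodule.span ℂ (Set.range fockVec) := fun i v hv => by
    induction hv using Submodule.span_induction with
    | mem x h =>
      obtain ⟨ν, rfl⟩ := h
      exact Submodule.subset_span ⟨i ::ₘ ν, fockVec_cons i ν⟩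
    | zero => rw [map_zero]; exact zero_mem _
    | add x y _ _ hx hy => rw [map_add]; exact add_mem hx hy
    | smul a x _ hx => rw [map_smul]; exact Submodule.smul_mem _ _ hx
  rcases le_or_gt 0 j with h | h
  · induction μ using Multiset.induction_on with
    | empty => rw [fockVec_zero, chi_vac j h]; exact zero_mem _
    | cons i μ ih =>
      rw [fockVec_cons, creation, chi_comm]
      exact add_mem (hcr i _ ih) (Submodule.smul_mem _ _ (Submodule.subset_span ⟨μ, rfl⟩))
  · have := hcr (-j - 1).toNat _ (Submodule.subset_span ⟨μ, rfl⟩)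
    rwa [creation, show -(((-j - 1).toNat : ℕ) : ℤ) - 1 = j by omega] at this

/-- The span contains the vacuum and is stable under all modes: an annihilation mode is commuted to
the right until it kills the vacuum. -/
theorem span_fockVec : Submodule.span ℂ (Set.range fockVec) = ⊤ := by
  rw [eq_top_iff]
  rintro v -
  obtain ⟨x, hx⟩ := Submodule.mkQ_surjective vacuumIdeal v
  obtain ⟨w, hw⟩ : ∃ w, toModeAlgebra w = x := RingQuot.mkAlgHom_surjective ℂ ModeRel x
  have key : ∀ u ∈ Submodule.span ℂ (Set.range fockVec),
      toModeAlgebra w • u ∈ Submodule.span ℂ (Set.range fockVec) := by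
    clear hw
    induction w using FreeAlgebra.induction with
    | grade0 r =>
      intro u hu
      rw [AlgHom.commutes, algebraMap_smul]
      exact Submodule.smul_mem _ _ hu
    | grade1 k =>
      intro u hu
      change chi k u ∈ _
      induction hu using Submodule.span_induction with
      | mem x h =>
        obtain ⟨ν, rfl⟩ := h
        exact chi_fockVec_mem k ν
      | zero => rw [map_zero]; exact zero_mem _
      | add x y _ _ hx hy => rw [map_add]; exact add_mem hx hy
      | smul a x _ hx => rw [map_smul]; exact Submodule.smul_mem _ _ hx
    | mul a b ha hb =>
      intro u hu
      rw [map_mul, mul_smul]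
      exact ha _ (hb u hu)
    | add a b ha hb =>
      intro u hu
      rw [map_add, add_smul]
      exact add_mem (ha u hu) (hb u hu)
  have h := key vac (Submodule.subset_span ⟨0, fockVec_zero⟩)
  rwa [smul_vac, hw, hx] at h

/-- The basis of the Fock space given by products of creation operators applied to the vacuum. -/
def fockBasis : Module.Basis (Multiset ℕ) ℂ Fock :=
  Module.Basis.mk linearIndependent_fockVec span_fockVec.ge

@[simp] theorem fockBasis_apply (μ : Multiset ℕ) : fockBasis μ = fockVec μ := by
  rw [fockBasis, Module.Basis.mk_apply]

theorem end_ext {C D : Module.End ℂ Fock} (h : ∀ μ, C (fockVec μ) = D (fockVec μ)) : C = D :=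
  fockBasis.ext fun μ => by rw [fockBasis_apply, h]

/-- An operator that commutes with all modes is determined by its value on the vacuum. -/
theorem eq_smul_of_commute {C : Module.End ℂ Fock} {c : ℂ}
    (hC : ∀ k v, C (chi k v) = chi k (C v)) (h0 : C vac = c • vac) (v : Fock) : C v = c • v := by
  have h : C = c • (1 : Module.End ℂ Fock) := end_ext fun μ => by
    rw [LinearMap.smul_apply, Module.End.one_apply]
    induction μ using Multiset.induction_on with
    | empty => simpa using h0
    | cons i μ ih => rw [fockVec_cons, creation, hC, ih, map_smul]
  rw [h]
  rfl

/-! ## Commutation relations -/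

theorem normalOrdered_chi (j l k : ℤ) (v : Fock) :
    normalOrdered j l (chi k v) =
      chi k (normalOrdered j l v) + (bracket l k • chi j v + bracket j k • chi l v) := by
  rw [normalOrdered]
  split_ifs
  · simp only [Module.End.mul_apply]
    rw [chi_comm l k, map_add, map_smul, chi_comm j k]
    abel
  · simp only [Module.End.mul_apply]
    rw [chi_comm j k, map_add, map_smul, chi_comm l k]
    abel

theorem map_locSum {ι : Type} (T : Module.End ℂ Fock) (f : ι → Module.End ℂ Fock)
    (hf : ∀ v, {i | f i v ≠ 0}.Finite) (v : Fock) : T (locSum f hf v) = ∑ᶠ i, T (f i v) :=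
  T.toAddMonoidHom.map_finsum (hf v)

theorem heis_apply (n : ℤ) (v : Fock) :
    heis n v = (1 / 2 : ℂ) • ∑ᶠ j : ℤ, normalOrdered j (2 * n - 1 - j) v := rfl

theorem map_heis (T : Module.End ℂ Fock) (n : ℤ) (v : Fock) :
    T (heis n v) = (1 / 2 : ℂ) • ∑ᶠ j : ℤ, T (normalOrdered j (2 * n - 1 - j) v) := by
  rw [heis, LinearMap.smul_apply, map_smul, map_locSum]

/-- Each of the two contractions with χ_k is nonzero for a single summand. The two contributions are
equal, which absorbs the factor 1/2. -/
theorem heis_chi (n k : ℤ) (v : Fock) :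
    heis n (chi k v) = chi k (heis n v) + (-1 : ℂ) ^ (k + 1) • chi (k + 2 * n) v := by
  rw [heis_apply, map_heis]
  simp only [normalOrdered_chi]
  have hs1 : ∀ j : ℤ, j ≠ k + 2 * n → bracket (2 * n - 1 - j) k • chi j v = 0 := fun j hj => by
    rw [bracket, if_neg (by omega), zero_smul]
  have hs2 : ∀ j : ℤ, j ≠ -1 - k → bracket j k • chi (2 * n - 1 - j) v = 0 := fun j hj => by
    rw [bracket, if_neg (by omega), zero_smul]
  have hf1 : (Function.support fun j : ℤ => bracket (2 * n - 1 - j) k • chi j v).Finite :=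
    (Set.finite_singleton (k + 2 * n)).subset fun j hj => by
      by_contra h
      exact hj (hs1 j h)
  have hf2 : (Function.support fun j : ℤ => bracket j k • chi (2 * n - 1 - j) v).Finite :=
    (Set.finite_singleton (-1 - k)).subset fun j hj => by
      by_contra h
      exact hj (hs2 j h)
  have hf0 : (Function.support fun j : ℤ => chi k (normalOrdered j (2 * n - 1 - j) v)).Finite :=
    (normalOrdered_locFinite n v).subset fun j hj h => hj (by simp only [h, map_zero])
  have hf12 : (Function.support fun j : ℤ => bracket (2 * n - 1 - j) k • chi j v +
      bracket j k • chi (2 * n - 1 - j) v).Finite :=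
    (hf1.union hf2).subset (Function.support_add _ _)
  rw [finsum_add_distrib hf0 hf12, finsum_add_distrib hf1 hf2, finsum_eq_single _ _ hs1,
    finsum_eq_single _ _ hs2, show 2 * n - 1 - (-1 - k) = k + 2 * n by ring]
  have e1 : bracket (2 * n - 1 - (k + 2 * n)) k = (-1 : ℂ) ^ (k + 1) := by
    rw [bracket, if_pos (by ring), show 2 * n - 1 - (k + 2 * n) = -k - 1 by ring,
      neg_one_zpow_neg_sub_one, zpow_add_one₀ (by norm_num)]
    ring
  have e2 : bracket (-1 - k) k = (-1 : ℂ) ^ (k + 1) := by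
    rw [bracket, if_pos (by ring), show -1 - k = -k - 1 by ring,
      neg_one_zpow_neg_sub_one, zpow_add_one₀ (by norm_num)]
    ring
  rw [e1, e2, smul_add, smul_add, ← smul_add (1 / 2 : ℂ), ← two_smul ℂ, smul_smul,
    show (1 / 2 : ℂ) * 2 = 1 by norm_num, one_smul]

theorem normalOrdered_vac {j l : ℤ} (h : 0 ≤ j ∨ 0 ≤ l) : normalOrdered j l vac = 0 := by
  rw [normalOrdered]
  split_ifs with hj
  · rw [Module.End.mul_apply, chi_vac l (by omega), map_zero]
  · rw [Module.End.mul_apply, chi_vac j (by omega), map_zero]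

theorem heis_vac {n : ℤ} (hn : 0 ≤ n) : heis n vac = 0 := by
  rw [heis_apply]
  simp only [fun j : ℤ => normalOrdered_vac (j := j) (l := 2 * n - 1 - j) (by omega), finsum_zero,
    smul_zero]

/-- The commutator of two Heisenberg modes commutes with all modes. -/
theorem heis_commutator_chi (m n k : ℤ) (v : Fock) :
    (heis m * heis n - heis n * heis m) (chi k v) =
      chi k ((heis m * heis n - heis n * heis m) v) := by
  simp only [LinearMap.sub_apply, Module.End.mul_apply, heis_chi, map_add, map_sub, map_smul]
  rw [show k + 2 * n + 2 * m = k + 2 * m + 2 * n by ring]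
  have e : ∀ a : ℤ, (-1 : ℂ) ^ (k + 2 * a + 1) = (-1 : ℂ) ^ (k + 1) := fun a => by
    rw [show k + 2 * a + 1 = (k + 1) + 2 * a by ring, zpow_add₀ (by norm_num), zpow_mul]
    norm_num
  rw [e, e]
  module

/-- The commutator commutes with all modes and kills the vacuum. -/
theorem heis_comm_of_nonneg {m n : ℤ} (hm : 0 ≤ m) (hn : 0 ≤ n) (v : Fock) :
    heis m (heis n v) = heis n (heis m v) := by
  have h := eq_smul_of_commute (c := 0) (heis_commutator_chi m n) (by
    rw [LinearMap.sub_apply, Module.End.mul_apply, Module.End.mul_apply, heis_vac hm, heis_vac hn,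
      map_zero, map_zero, sub_zero, zero_smul]) v
  rw [zero_smul, LinearMap.sub_apply, Module.End.mul_apply, Module.End.mul_apply] at h
  exact sub_eq_zero.1 h

/-- Only the 2n summands with both modes creating survive in h_{-n}|0⟩. As m ≥ n, h_m turns either
mode into an annihilator, leaving one contraction per summand: -1 if m = n, otherwise 0. With the
factor 1/2 the total is -n. -/
theorem heis_heis_neg_vac {m n : ℤ} (hn : 0 < n) (hmn : n ≤ m) :
    heis m (heis (-n) vac) = (if m = n then -(n : ℂ) else 0) • vac := by
  have key : ∀ j : ℤ, heis m (normalOrdered j (2 * -n - 1 - j) vac) =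
      if j ∈ Finset.Ico (-(2 * n)) 0 then (if m = n then (-1 : ℂ) else 0) • vac else 0 := fun j => by
    by_cases hj : j ∈ Finset.Ico (-(2 * n)) 0
    · rw [if_pos hj]
      rw [Finset.mem_Ico] at hj
      rw [normalOrdered, if_pos hj.2, Module.End.mul_apply, heis_chi, heis_chi,
        heis_vac (by omega), map_zero, zero_add, chi_vac _ (by omega), smul_zero, map_zero, zero_add,
        chi_comm, chi_vac _ (by omega), map_zero, zero_add, smul_smul, bracket]
      by_cases h : m = n
      · rw [if_pos h, if_pos (by omega), ← zpow_add₀ (by norm_num)]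
        congr 1
        exact Odd.neg_one_zpow ⟨j + m, by ring⟩
      · rw [if_neg h, if_neg (by omega), mul_zero]
    · rw [if_neg hj, normalOrdered_vac, map_zero]
      rw [Finset.mem_Ico] at hj
      omega
  rw [map_heis]
  simp only [key]
  rw [finsum_eq_sum_of_support_subset (s := Finset.Ico (-(2 * n)) 0) _ fun j hj => by
    by_contra h
    exact hj (if_neg h)]
  rw [Finset.sum_congr rfl fun j hj => if_pos hj, Finset.sum_const, Int.card_Ico,
    ← Nat.cast_smul_eq_nsmul ℂ, smul_smul, smul_smul]
  congr 1
  split_ifs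
  · have : (((0 - -(2 * n)).toNat : ℕ) : ℂ) = 2 * (n : ℂ) := by
      have h : (((0 - -(2 * n)).toNat : ℕ) : ℤ) = 2 * n := by omega
      exact_mod_cast congrArg (Int.cast : ℤ → ℂ) h
    rw [this]
    ring
  · ring

theorem heis_heis_neg {m n : ℤ} (hn : 0 < n) (hmn : n ≤ m) (v : Fock) :
    heis m (heis (-n) v) = heis (-n) (heis m v) + (if m = n then -(n : ℂ) else 0) • v := by
  have h := eq_smul_of_commute (c := if m = n then -(n : ℂ) else 0)
    (heis_commutator_chi m (-n)) (by
    rw [LinearMap.sub_apply, Module.End.mul_apply, Module.End.mul_apply,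
      heis_vac (n := m) (by omega), map_zero, sub_zero, heis_heis_neg_vac hn hmn]) v
  rw [← h, LinearMap.sub_apply, Module.End.mul_apply, Module.End.mul_apply]
  abel

/-- The operator `2 L_0`. -/
def energy : Module.End ℂ Fock := (2 : ℂ) • virL0

theorem energy_apply (v : Fock) : energy v =
    ∑ᶠ i : ℕ, (((-1 : ℂ) ^ i * ((i : ℂ) + 1 / 2)) • normalOrdered (-i - 1) i) v := by
  rw [energy, virL0, smul_smul, show (2 : ℂ) * (1 / 2) = 1 by norm_num, one_smul]
  rfl

theorem map_energy (T : Module.End ℂ Fock) (v : Fock) : T (energy v) =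
    ∑ᶠ i : ℕ, T ((((-1 : ℂ) ^ i * ((i : ℂ) + 1 / 2)) • normalOrdered (-i - 1) i) v) := by
  rw [energy, virL0, smul_smul, show (2 : ℂ) * (1 / 2) = 1 by norm_num, one_smul, map_locSum]

theorem energy_vac : energy vac = 0 := by
  rw [energy_apply]
  simp only [LinearMap.smul_apply, fun i : ℕ => normalOrdered_vac (j := -i - 1) (l := i) (by omega),
    smul_zero, finsum_zero]

/-- Only the summand containing χ_k or its conjugate contributes; the alternating signs in L_0
cancel those of the bracket, leaving the weight -(k + 1/2). -/
theorem energy_chi (k : ℤ) (v : Fock) :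
    energy (chi k v) = chi k (energy v) - ((k : ℂ) + 1 / 2) • chi k v := by
  rw [energy_apply, map_energy]
  set i₀ : ℕ := if 0 ≤ k then k.toNat else (-k - 1).toNat with hi₀
  set g : ℕ → Fock := fun i => ((-1 : ℂ) ^ i * ((i : ℂ) + 1 / 2)) •
    (bracket i k • chi (-i - 1) v + bracket (-i - 1) k • chi i v) with hg
  have hs : ∀ i, i ≠ i₀ → g i = 0 := fun i hi => by
    simp only [hg]
    rw [bracket, bracket, if_neg, if_neg, zero_smul, zero_smul, add_zero, smul_zero]
    all_goals
      rw [hi₀] at hi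
      split_ifs at hi <;> omega
  have hfg : (Function.support g).Finite := (Set.finite_singleton i₀).subset fun j hj => by
    by_contra h
    exact hj (hs j h)
  have hf0 : (Function.support fun i : ℕ =>
      chi k ((((-1 : ℂ) ^ i * ((i : ℂ) + 1 / 2)) • normalOrdered (-i - 1) i) v)).Finite :=
    (degree_locFinite v).subset fun j hj h => hj (by simp only [h, map_zero])
  have e : ∀ i : ℕ, (((-1 : ℂ) ^ i * ((i : ℂ) + 1 / 2)) • normalOrdered (-i - 1) i) (chi k v) =
      chi k ((((-1 : ℂ) ^ i * ((i : ℂ) + 1 / 2)) • normalOrdered (-i - 1) i) v) + g i := fun i => by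
    rw [LinearMap.smul_apply, LinearMap.smul_apply, map_smul, normalOrdered_chi, smul_add]
  have hg0 : g i₀ = -(((k : ℂ) + 1 / 2) • chi k v) := by
    have hsq : ∀ n : ℕ, (-1 : ℂ) ^ n * (-1) ^ n = 1 := fun n => by
      rw [← mul_pow]; norm_num
    simp only [hg]
    rcases le_or_gt 0 k with h | h
    · obtain ⟨n, rfl⟩ := Int.eq_ofNat_of_zero_le h
      have h0 : i₀ = n := by rw [hi₀, if_pos h]; simp
      rw [h0, bracket, if_neg (by omega), bracket, if_pos (by ring), neg_one_zpow_neg_sub_one,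
        zero_smul, zero_add, smul_smul, ← neg_smul, zpow_natCast]
      congr 1
      rw [Int.cast_natCast]
      linear_combination (-((n : ℂ) + 1 / 2)) * hsq n
    · obtain ⟨n, hn⟩ : ∃ n : ℕ, k = -n - 1 := ⟨(-k - 1).toNat, by omega⟩
      have h0 : i₀ = n := by rw [hi₀, if_neg (by omega)]; omega
      rw [h0, hn, bracket, if_pos (by ring), bracket, if_neg (by omega), zero_smul, add_zero,
        smul_smul, ← neg_smul, zpow_natCast]
      congr 1
      push_cast
      linear_combination ((n : ℂ) + 1 / 2) * hsq n
  simp only [e]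
  rw [finsum_add_distrib hf0 hfg, finsum_eq_single _ _ hs, hg0, sub_eq_add_neg]

theorem energy_normalOrdered (j l : ℤ) (v : Fock) :
    energy (normalOrdered j l v) =
      normalOrdered j l (energy v) - ((j : ℂ) + l + 1) • normalOrdered j l v := by
  rw [normalOrdered]
  split_ifs
  · simp only [Module.End.mul_apply]
    rw [energy_chi, energy_chi, map_sub, map_smul]
    module
  · simp only [Module.End.mul_apply]
    rw [energy_chi, energy_chi, map_sub, map_smul]
    module

theorem energy_heis (n : ℤ) (v : Fock) :
    energy (heis n v) = heis n (energy v) - (2 * (n : ℂ)) • heis n v := by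
  rw [map_heis]
  simp only [energy_normalOrdered]
  have hf0 : (Function.support fun j : ℤ => normalOrdered j (2 * n - 1 - j) (energy v)).Finite :=
    normalOrdered_locFinite n (energy v)
  have hf1 : (Function.support fun j : ℤ => normalOrdered j (2 * n - 1 - j) v).Finite :=
    normalOrdered_locFinite n v
  have e : ∀ j : ℤ, (j : ℂ) + ((2 * n - 1 - j : ℤ) : ℂ) + 1 = 2 * n := fun j => by
    push_cast
    ring
  simp only [e]
  have hf2 : (Function.support fun j : ℤ =>
      (2 * (n : ℂ)) • normalOrdered j (2 * n - 1 - j) v).Finite :=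
    hf1.subset (Function.support_const_smul_subset _ _)
  rw [finsum_sub_distrib hf0 hf2, ← smul_finsum' _ hf1, smul_sub, smul_comm (1 / 2 : ℂ)]
  rfl

/-! ## The grading of the Fock space by degree and charge -/

/-- The degree of a basis vector, which is four times its `L_0` eigenvalue. -/
def degree (μ : Multiset ℕ) : ℕ := (μ.map fun i => 2 * i + 1).sum

/-- The charge of a basis vector, which is its `h_0` eigenvalue. -/
def charge (μ : Multiset ℕ) : ℤ := (μ.map fun i => (-1 : ℤ) ^ i).sum

theorem energy_fockVec (μ : Multiset ℕ) :
    energy (fockVec μ) = ((degree μ : ℂ) / 2) • fockVec μ := by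
  induction μ using Multiset.induction_on with
  | empty => simp [energy_vac, degree]
  | cons i μ ih =>
    rw [fockVec_cons, creation, energy_chi, ih, map_smul, ← sub_smul, degree, degree,
      Multiset.map_cons, Multiset.sum_cons]
    congr 1
    push_cast
    ring

theorem heis_zero_fockVec (μ : Multiset ℕ) :
    heis 0 (fockVec μ) = (charge μ : ℂ) • fockVec μ := by
  induction μ using Multiset.induction_on with
  | empty => simp [heis_vac le_rfl, charge]
  | cons i μ ih =>
    rw [fockVec_cons, creation, heis_chi, ih, map_smul, mul_zero, add_zero, ← add_smul, charge,
      charge, Multiset.map_cons, Multiset.sum_cons, sub_add_cancel, zpow_neg, zpow_natCast,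
      ← inv_pow, inv_neg_one]
    congr 1
    push_cast
    ring

/-- The two mode indices in each summand of h_n add up to the odd number 2n - 1, so the modes have
opposite charges and every summand commutes with h_0. -/
theorem heis_zero_heis (n : ℤ) (v : Fock) : heis 0 (heis n v) = heis n (heis 0 v) := by
  rw [map_heis, heis_apply n]
  have e : ∀ j : ℤ, (-1 : ℂ) ^ (2 * n - 1 - j + 1) = -(-1 : ℂ) ^ (j + 1) := fun j => by
    rw [show 2 * n - 1 - j + 1 = 2 * n + (-(j + 1) + 1) by ring, zpow_add₀ (by norm_num), zpow_mul,
      zpow_add_one₀ (by norm_num), zpow_neg, ← inv_zpow, inv_neg_one]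
    norm_num
  congr 2
  funext j
  rw [normalOrdered]
  split_ifs
  · simp only [Module.End.mul_apply, heis_chi, mul_zero, add_zero, map_add, map_smul, e]
    module
  · simp only [Module.End.mul_apply, heis_chi, mul_zero, add_zero, map_add, map_smul, e]
    module

/-- The joint eigenspace of `2 L_0` and `h_0` on the Fock space for the eigenvalues `k / 2`
and `m`. -/
def FockGraded (k m : ℤ) : Submodule ℂ Fock where
  carrier := {v | energy v = ((k : ℂ) / 2) • v ∧ heis 0 v = (m : ℂ) • v}
  zero_mem' := by simp
  add_mem' := by
    rintro v w ⟨h1, h2⟩ ⟨h3, h4⟩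
    exact ⟨by rw [map_add, smul_add, h1, h3], by rw [map_add, smul_add, h2, h4]⟩
  smul_mem' := by
    rintro c v ⟨h1, h2⟩
    exact ⟨by rw [map_smul, h1, smul_comm], by rw [map_smul, h2, smul_comm]⟩

theorem fockVec_mem_fockGraded (μ : Multiset ℕ) : fockVec μ ∈ FockGraded (degree μ) (charge μ) :=
  ⟨by rw [energy_fockVec, Int.cast_natCast], heis_zero_fockVec μ⟩

theorem heis_mem_fockGraded {k m : ℤ} (n : ℤ) {v : Fock} (hv : v ∈ FockGraded k m) :
    heis n v ∈ FockGraded (k - 4 * n) m := by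
  refine ⟨?_, ?_⟩
  · rw [energy_heis, hv.1, map_smul, ← sub_smul]
    congr 1
    push_cast
    ring
  · rw [heis_zero_heis, hv.2, map_smul]

theorem repr_diagonal {T : Module.End ℂ Fock} {c : Multiset ℕ → ℂ}
    (hT : ∀ μ, T (fockVec μ) = c μ • fockVec μ) (v : Fock) (μ : Multiset ℕ) :
    fockBasis.repr (T v) μ = c μ * fockBasis.repr v μ := by
  have h : (Finsupp.lapply μ : _ →ₗ[ℂ] ℂ) ∘ₗ fockBasis.repr.toLinearMap ∘ₗ T =
      c μ • ((Finsupp.lapply μ : _ →ₗ[ℂ] ℂ) ∘ₗ fockBasis.repr.toLinearMap) := by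
    refine fockBasis.ext fun ν => ?_
    rw [fockBasis_apply]
    simp only [LinearMap.comp_apply, LinearMap.smul_apply, LinearEquiv.coe_coe, hT, map_smul]
    rw [← fockBasis_apply, Module.Basis.repr_self, Finsupp.lapply_apply, smul_eq_mul, smul_eq_mul]
    by_cases hν : ν = μ
    · rw [hν]
    · rw [Finsupp.single_eq_of_ne (Ne.symm hν), mul_zero, mul_zero]
  exact congrArg (fun L => L v) h

/-- Both operators are diagonal in the Fock basis, so an eigenvector is supported on the basis
vectors with its eigenvalues. -/
theorem mem_fockGraded_iff {k m : ℤ} {v : Fock} : v ∈ FockGraded k m ↔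
    ∀ μ, fockBasis.repr v μ ≠ 0 → (degree μ : ℤ) = k ∧ charge μ = m := by
  constructor
  · rintro ⟨h1, h2⟩ μ hμ
    have e1 := congrArg (fun w => fockBasis.repr w μ) h1
    have e2 := congrArg (fun w => fockBasis.repr w μ) h2
    simp only [map_smul, Finsupp.smul_apply, smul_eq_mul] at e1 e2
    rw [repr_diagonal energy_fockVec] at e1
    rw [repr_diagonal heis_zero_fockVec] at e2
    have e3 := mul_right_cancel₀ hμ e1
    have e4 := mul_right_cancel₀ hμ e2
    refine ⟨?_, by exact_mod_cast e4⟩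
    have e5 : (degree μ : ℂ) = k := by linear_combination 2 * e3
    exact_mod_cast e5
  · intro h
    refine ⟨fockBasis.repr.injective (Finsupp.ext fun μ => ?_),
      fockBasis.repr.injective (Finsupp.ext fun μ => ?_)⟩
    · rw [repr_diagonal energy_fockVec, map_smul, Finsupp.smul_apply, smul_eq_mul]
      by_cases h0 : fockBasis.repr v μ = 0
      · rw [h0, mul_zero, mul_zero]
      · rw [← (h μ h0).1, Int.cast_natCast]
    · rw [repr_diagonal heis_zero_fockVec, map_smul, Finsupp.smul_apply, smul_eq_mul]
      by_cases h0 : fockBasis.repr v μ = 0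
      · rw [h0, mul_zero, mul_zero]
      · rw [← (h μ h0).2]

theorem eq_zero_of_mem_fockGraded_neg {k m : ℤ} (hk : k < 0) {v : Fock} (hv : v ∈ FockGraded k m) :
    v = 0 := by
  refine fockBasis.repr.injective (Finsupp.ext fun μ => ?_)
  rw [map_zero, Finsupp.zero_apply]
  by_contra h
  have := (mem_fockGraded_iff.1 hv μ h).1
  omega

theorem sum_succ_le_degree (μ : Multiset ℕ) : (μ.map fun i => i + 1).sum ≤ degree μ :=
  Multiset.sum_map_le_sum_map _ _ fun i _ => by omega

theorem finite_degree_eq (k : ℤ) : {μ : Multiset ℕ | (degree μ : ℤ) = k}.Finite := by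
  refine (finite_multiset_sum_lt (k.toNat + 1)).subset fun μ hμ => ?_
  have h1 : (degree μ : ℤ) = k := hμ
  have h2 := sum_succ_le_degree μ
  rw [Set.mem_ofPred_eq]
  omega

/-- The indices of the basis vectors of given degree and charge. -/
def weightSet (k m : ℤ) : Set (Multiset ℕ) := {μ | (degree μ : ℤ) = k ∧ charge μ = m}

theorem finite_weightSet (k m : ℤ) : (weightSet k m).Finite :=
  (finite_degree_eq k).subset fun _ h => h.1

theorem map_fockGraded (k m : ℤ) :
    (FockGraded k m).map fockBasis.repr.toLinearMap = Finsupp.supported ℂ ℂ (weightSet k m) := by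
  ext f
  rw [Submodule.mem_map, Finsupp.mem_supported]
  constructor
  · rintro ⟨v, hv, rfl⟩ μ hμ
    exact mem_fockGraded_iff.1 hv μ (Finsupp.mem_support_iff.1 hμ)
  · intro hf
    refine ⟨fockBasis.repr.symm f, mem_fockGraded_iff.2 fun μ hμ => ?_, ?_⟩
    · rw [LinearEquiv.apply_symm_apply] at hμ
      exact hf (Finsupp.mem_support_iff.2 hμ)
    · exact LinearEquiv.apply_symm_apply _ _

/-- The graded pieces have the evident bases. -/
def fockGradedEquiv (k m : ℤ) : FockGraded k m ≃ₗ[ℂ] (weightSet k m →₀ ℂ) :=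
  (fockBasis.repr.submoduleMap (FockGraded k m)).trans
    ((LinearEquiv.ofEq _ _ (map_fockGraded k m)).trans (Finsupp.supportedEquivFinsupp (weightSet k m)))

instance finiteDimensional_fockGraded (k m : ℤ) : FiniteDimensional ℂ (FockGraded k m) := by
  have := (finite_weightSet k m).to_subtype
  exact Module.Finite.equiv (fockGradedEquiv k m).symm

theorem finrank_fockGraded (k m : ℤ) :
    Module.finrank ℂ (FockGraded k m) = (weightSet k m).ncard := by
  have := (finite_weightSet k m).fintype
  rw [(fockGradedEquiv k m).finrank_eq, Module.finrank_finsupp_self, ← Nat.card_coe_set_eq,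
    Nat.card_eq_fintype_card]

theorem exists_weight_of_ne_bot {k m : ℤ} (h : FockGraded k m ≠ ⊥) : (weightSet k m).Nonempty := by
  obtain ⟨v, hv, h0⟩ := Submodule.exists_mem_ne_zero_of_ne_bot h
  have h1 : fockBasis.repr v ≠ 0 := fun h => h0 (fockBasis.repr.map_eq_zero_iff.1 h)
  obtain ⟨μ, hμ⟩ := Finsupp.ne_iff.1 h1
  exact ⟨μ, mem_fockGraded_iff.1 hv μ hμ⟩

theorem finite_charges (k : ℤ) : {m : ℤ | FockGraded k m ≠ ⊥}.Finite := by
  refine ((finite_degree_eq k).image charge).subset fun m hm => ?_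
  obtain ⟨μ, h1, h2⟩ := exists_weight_of_ne_bot hm
  exact ⟨μ, h1, h2⟩

/-- The projection onto a graded piece. -/
def gradedProj (k m : ℤ) : Module.End ℂ Fock :=
  fockBasis.constr ℂ fun μ => if (degree μ : ℤ) = k ∧ charge μ = m then fockVec μ else 0

theorem gradedProj_fockVec (k m : ℤ) (μ : Multiset ℕ) : gradedProj k m (fockVec μ) =
    if (degree μ : ℤ) = k ∧ charge μ = m then fockVec μ else 0 := by
  have h := fockBasis.constr_basis ℂ
    (fun μ => if (degree μ : ℤ) = k ∧ charge μ = m then fockVec μ else 0) μ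
  rwa [fockBasis_apply] at h

theorem repr_gradedProj (k m : ℤ) (v : Fock) (μ : Multiset ℕ) :
    fockBasis.repr (gradedProj k m v) μ =
      if (degree μ : ℤ) = k ∧ charge μ = m then fockBasis.repr v μ else 0 := by
  rw [repr_diagonal (T := gradedProj k m)
    (c := fun μ => if (degree μ : ℤ) = k ∧ charge μ = m then 1 else 0) fun ν => ?_]
  · rw [ite_mul, one_mul, zero_mul]
  · rw [gradedProj_fockVec, ite_smul, one_smul, zero_smul]

theorem gradedProj_mem (k m : ℤ) (v : Fock) : gradedProj k m v ∈ FockGraded k m := by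
  refine mem_fockGraded_iff.2 fun μ hμ => ?_
  rw [repr_gradedProj] at hμ
  by_contra h
  exact hμ (if_neg h)

theorem gradedProj_of_mem {k m : ℤ} (k' m' : ℤ) {v : Fock} (hv : v ∈ FockGraded k m) :
    gradedProj k' m' v = if k = k' ∧ m = m' then v else 0 := by
  refine fockBasis.repr.injective (Finsupp.ext fun μ => ?_)
  rw [repr_gradedProj]
  by_cases h0 : fockBasis.repr v μ = 0
  · split_ifs <;> simp [h0]
  · obtain ⟨rfl, rfl⟩ := mem_fockGraded_iff.1 hv μ h0
    split_ifs <;> simp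

/-- Homogeneity of h_n; it makes every graded component of a highest weight vector again annihilated
by the positive modes. -/
theorem heis_gradedProj (n k m : ℤ) (v : Fock) :
    heis n (gradedProj k m v) = gradedProj (k - 4 * n) m (heis n v) := by
  have h : heis n * gradedProj k m = gradedProj (k - 4 * n) m * heis n := end_ext fun μ => by
    rw [Module.End.mul_apply, Module.End.mul_apply, gradedProj_fockVec,
      gradedProj_of_mem _ _ (heis_mem_fockGraded n (fockVec_mem_fockGraded μ))]
    simp only [sub_left_inj]
    split_ifs
    · rfl
    · rw [map_zero]
  exact congrArg (fun T => T v) h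

theorem mem_iSup_of_gradedProj_mem {W : ℕ × ℤ → Submodule ℂ Fock} {v : Fock}
    (h : ∀ p : ℕ × ℤ, gradedProj p.1 p.2 v ∈ W p) : v ∈ ⨆ p, W p := by
  classical
  set s := (fockBasis.repr v).support.image fun μ => (degree μ, charge μ) with hs
  have hsum : v = ∑ p ∈ s, gradedProj p.1 p.2 v := by
    refine fockBasis.repr.injective (Finsupp.ext fun μ => ?_)
    rw [map_sum, Finsupp.finsetSum_apply]
    simp only [repr_gradedProj]
    by_cases h0 : fockBasis.repr v μ = 0
    · simp [h0]
    · have hmem : (degree μ, charge μ) ∈ s :=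
        Finset.mem_image.2 ⟨μ, Finsupp.mem_support_iff.2 h0, rfl⟩
      rw [Finset.sum_eq_single_of_mem _ hmem, if_pos ⟨rfl, rfl⟩]
      rintro ⟨k, m⟩ _ hp
      refine if_neg fun h => hp ?_
      rw [Prod.mk.injEq]
      exact ⟨by exact_mod_cast h.1.symm, h.2.symm⟩
  rw [hsum]
  exact sum_mem fun p _ => Submodule.mem_iSup_of_mem p (h p)

theorem iSupIndep_fockGraded : iSupIndep fun p : ℕ × ℤ => FockGraded p.1 p.2 := by
  intro p
  rw [Submodule.disjoint_def]
  intro v hv hv'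
  have h : (⨆ j, ⨆ (_ : j ≠ p), FockGraded j.1 j.2) ≤ LinearMap.ker (gradedProj p.1 p.2) := by
    refine iSup₂_le fun j hj w hw => ?_
    rw [LinearMap.mem_ker, gradedProj_of_mem _ _ hw, if_neg fun h => hj ?_]
    exact Prod.ext (by exact_mod_cast h.1) h.2
  have h1 := LinearMap.mem_ker.1 (h hv')
  rwa [gradedProj_of_mem _ _ hv, if_pos ⟨rfl, rfl⟩] at h1

/-! ## Highest weight vectors -/

/-- The vectors of given degree and charge annihilated by `h_n` for all `n > N`. -/
def truncHighest (N : ℕ) (k m : ℤ) : Submodule ℂ Fock where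
  carrier := {v | v ∈ FockGraded k m ∧ ∀ n : ℤ, (N : ℤ) < n → heis n v = 0}
  zero_mem' := ⟨zero_mem _, fun _ _ => map_zero _⟩
  add_mem' := by
    rintro v w ⟨h1, h2⟩ ⟨h3, h4⟩
    exact ⟨add_mem h1 h3, fun n hn => by rw [map_add, h2 n hn, h4 n hn, add_zero]⟩
  smul_mem' := by
    rintro c v ⟨h1, h2⟩
    exact ⟨Submodule.smul_mem _ c h1, fun n hn => by rw [map_smul, h2 n hn, smul_zero]⟩

theorem mem_truncHighest {N : ℕ} {k m : ℤ} {v : Fock} : v ∈ truncHighest N k m ↔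
    v ∈ FockGraded k m ∧ ∀ n : ℤ, (N : ℤ) < n → heis n v = 0 := Iff.rfl

theorem truncHighest_le (N : ℕ) (k m : ℤ) : truncHighest N k m ≤ FockGraded k m := fun _ h => h.1

instance finiteDimensional_truncHighest (N : ℕ) (k m : ℤ) :
    FiniteDimensional ℂ (truncHighest N k m) :=
  Submodule.finiteDimensional_of_le (truncHighest_le N k m)

theorem truncHighest_eq_fockGraded {N : ℕ} {k : ℤ} (h : k < 4 * ((N : ℤ) + 1)) (m : ℤ) :
    truncHighest N k m = FockGraded k m :=
  le_antisymm (truncHighest_le N k m) fun _ hv =>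
    ⟨hv, fun n hn => eq_zero_of_mem_fockGraded_neg (by omega) (heis_mem_fockGraded n hv)⟩

theorem heis_mem_truncHighest {N : ℕ} {k m : ℤ} {n : ℤ} (hn : 0 ≤ n) {v : Fock}
    (hv : v ∈ truncHighest N k m) : heis n v ∈ truncHighest N (k - 4 * n) m :=
  ⟨heis_mem_fockGraded n hv.1, fun l hl => by
    rw [heis_comm_of_nonneg (by omega) hn, hv.2 l hl, map_zero]⟩

/-- For l > N ≥ n the modes h_l and h_{-n} commute, so h_{-n} preserves the truncation condition. -/
theorem heis_neg_mem_truncHighest {N : ℕ} {k m : ℤ} {n : ℤ} (hn : 0 < n) (hN : n ≤ N) {v : Fock}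
    (hv : v ∈ truncHighest N (k - 4 * n) m) : heis (-n) v ∈ truncHighest N k m := by
  refine ⟨?_, fun l hl => ?_⟩
  · have h := heis_mem_fockGraded (-n) hv.1
    rwa [show k - 4 * n - 4 * -n = k by ring] at h
  · rw [heis_heis_neg hn (by omega), if_neg (by omega), hv.2 l hl, map_zero, zero_smul, zero_add]

theorem heis_pow_heis_neg {n : ℤ} (hn : 0 < n) (r : ℕ) (v : Fock) :
    (heis n ^ (r + 1)) (heis (-n) v) =
      heis (-n) ((heis n ^ (r + 1)) v) + (((r : ℂ) + 1) * -(n : ℂ)) • (heis n ^ r) v := by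
  induction r with
  | zero =>
    rw [zero_add, pow_one, pow_zero, Module.End.one_apply, heis_heis_neg hn le_rfl, if_pos rfl]
    simp
  | succ r ih =>
    rw [pow_succ', Module.End.mul_apply, ih, map_add, map_smul, heis_heis_neg hn le_rfl, if_pos rfl,
      ← Module.End.mul_apply (heis n) (heis n ^ (r + 1)), ← Module.End.mul_apply (heis n) (heis n ^ r),
      ← pow_succ', ← pow_succ']
    push_cast
    module

/-- If h_n^{r+1} v = 0 and c = -(r+1)n, the commutation formula shows that h_n^r kills h_n h_{-n} v
- cv. By induction this vector is h_n u, so v = h_n(c^{-1}(h_{-n} v - u)). -/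
theorem exists_heis_eq {N : ℕ} {k m : ℤ} {n : ℤ} (hn : 0 < n) (hN : n ≤ N) (r : ℕ) :
    ∀ v ∈ truncHighest N (k - 4 * n) m, (heis n ^ r) v = 0 →
      ∃ u ∈ truncHighest N k m, heis n u = v := by
  induction r with
  | zero =>
    intro v _ h
    rw [pow_zero, Module.End.one_apply] at h
    exact ⟨0, zero_mem _, by rw [map_zero, h]⟩
  | succ r ih =>
    intro v hv h
    have hc : ((r : ℂ) + 1) * -(n : ℂ) ≠ 0 := by
      refine mul_ne_zero (by exact_mod_cast r.succ_ne_zero) (neg_ne_zero.2 ?_)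
      exact_mod_cast hn.ne'
    set c : ℂ := ((r : ℂ) + 1) * -(n : ℂ) with hc_def
    have hx := heis_neg_mem_truncHighest hn hN hv
    obtain ⟨u, hu, hu'⟩ := ih (heis n (heis (-n) v) - c • v)
      (sub_mem (heis_mem_truncHighest hn.le hx) (Submodule.smul_mem _ _ hv)) (by
        rw [map_sub, map_smul, ← Module.End.mul_apply (heis n ^ r), ← pow_succ,
          heis_pow_heis_neg hn, h, map_zero, zero_add, sub_self])
    refine ⟨c⁻¹ • (heis (-n) v - u), Submodule.smul_mem _ _ (sub_mem hx hu), ?_⟩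
    rw [map_smul, map_sub, hu', sub_sub_cancel, smul_smul, inv_mul_cancel₀ hc, one_smul]

theorem heis_pow_mem_fockGraded {k m : ℤ} (n : ℤ) {v : Fock} (hv : v ∈ FockGraded k m) (r : ℕ) :
    (heis n ^ r) v ∈ FockGraded (k - 4 * n * r) m := by
  induction r with
  | zero => simpa using hv
  | succ r ih =>
    have h := heis_mem_fockGraded n ih
    rw [pow_succ', Module.End.mul_apply]
    rwa [show k - 4 * n * r - 4 * n = k - 4 * n * ((r + 1 : ℕ) : ℤ) by push_cast; ring] at h

theorem heis_surjective {N : ℕ} {k m : ℤ} {n : ℤ} (hn : 0 < n) (hN : n ≤ N) {v : Fock}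
    (hv : v ∈ truncHighest N (k - 4 * n) m) : ∃ u ∈ truncHighest N k m, heis n u = v := by
  -- Each application of h_n lowers the degree by 4n, so this many applications reach negative
  -- degree.
  refine exists_heis_eq hn hN (k.toNat + 1) v hv ?_
  refine eq_zero_of_mem_fockGraded_neg ?_ (heis_pow_mem_fockGraded n hv.1 _)
  push_cast
  nlinarith [Int.self_le_toNat k, Int.natCast_nonneg k.toNat]

/-- Rank-nullity for h_{N+1} on the vectors killed by all h_n with n > N+1: it is onto, and its
kernel imposes exactly the one missing condition. -/
theorem finrank_truncHighest_succ (N : ℕ) (k m : ℤ) :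
    Module.finrank ℂ (truncHighest (N + 1) (k - 4 * ((N : ℤ) + 1)) m) +
      Module.finrank ℂ (truncHighest N k m) = Module.finrank ℂ (truncHighest (N + 1) k m) := by
  have hn : (0 : ℤ) < (N : ℤ) + 1 := by omega
  have hN : (N : ℤ) + 1 ≤ ((N + 1 : ℕ) : ℤ) := by push_cast; rfl
  let D : truncHighest (N + 1) k m →ₗ[ℂ] truncHighest (N + 1) (k - 4 * ((N : ℤ) + 1)) m :=
    (heis ((N : ℤ) + 1)).restrict fun v hv => heis_mem_truncHighest hn.le hv
  have hsurj : LinearMap.range D = ⊤ := by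
    rw [LinearMap.range_eq_top]
    rintro ⟨v, hv⟩
    obtain ⟨u, hu, hu'⟩ := heis_surjective hn hN hv
    exact ⟨⟨u, hu⟩, Subtype.ext hu'⟩
  have hle : truncHighest N k m ≤ truncHighest (N + 1) k m := fun v hv =>
    ⟨hv.1, fun n h => hv.2 n (by push_cast at h; omega)⟩
  have hker : LinearMap.ker D = (truncHighest N k m).comap (truncHighest (N + 1) k m).subtype := by
    ext ⟨v, hv⟩
    rw [LinearMap.mem_ker, Submodule.mem_comap, Submodule.subtype_apply, mem_truncHighest]
    have h0 : D ⟨v, hv⟩ = 0 ↔ heis ((N : ℤ) + 1) v = 0 := Subtype.ext_iff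
    rw [h0]
    constructor
    · intro h
      refine ⟨hv.1, fun n hn => ?_⟩
      rcases eq_or_lt_of_le (show (N : ℤ) + 1 ≤ n by omega) with e | e
      · rw [← e, h]
      · exact hv.2 n (by push_cast; exact e)
    · exact fun h => h.2 _ (by omega)
  have h := D.finrank_range_add_finrank_ker
  rw [hsurj, finrank_top, hker, (Submodule.comapSubtypeEquivOfLe hle).finrank_eq] at h
  exact h

/-! ## Characters -/

theorem finrank_smul_eq_zero {W : Submodule ℂ Fock} (h : W = ⊥) (f : ℚ[T;T⁻¹]) :
    (Module.finrank ℂ W : ℚ) • f = 0 := by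
  rw [h, finrank_bot, Nat.cast_zero, zero_smul]

theorem finite_support_finrank {W : ℤ → Submodule ℂ Fock} {k : ℤ} (hW : ∀ m, W m ≤ FockGraded k m) :
    (Function.support fun m : ℤ =>
      (Module.finrank ℂ (W m) : ℚ) • (LaurentPolynomial.T m : ℚ[T;T⁻¹])).Finite := by
  refine (finite_charges k).subset fun m hm h => hm ?_
  exact finrank_smul_eq_zero (eq_bot_iff.2 ((hW m).trans h.le)) _

/-- The character of the space of vectors annihilated by `h_n` for all `n > N`. -/
def truncChar (N : ℕ) : QZ :=
  PowerSeries.mk fun k : ℕ =>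
    ∑ᶠ m : ℤ, (Module.finrank ℂ (truncHighest N k m) : ℚ) • LaurentPolynomial.T m

/-- The character of the Fock space. -/
def fockChar : QZ :=
  PowerSeries.mk fun k : ℕ =>
    ∑ᶠ m : ℤ, (Module.finrank ℂ (FockGraded k m) : ℚ) • LaurentPolynomial.T m

theorem qz_eq_X_pow (k : ℕ) : qz k 0 = (X : QZ) ^ k := by
  rw [qz, LaurentPolynomial.T_zero, X_pow_eq]

theorem truncChar_eq (N : ℕ) : truncChar N = (1 - qz (4 * (N + 1)) 0) * truncChar (N + 1) := by
  ext1 k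
  rw [sub_mul, one_mul, map_sub, qz_eq_X_pow, coeff_X_pow_mul', truncChar, truncChar, coeff_mk,
    coeff_mk, coeff_mk]
  have h1 := finite_support_finrank (truncHighest_le N k)
  have h2 := finite_support_finrank (truncHighest_le (N + 1) (k - 4 * ((N : ℤ) + 1)))
  have e : (∑ᶠ m : ℤ, (Module.finrank ℂ (truncHighest (N + 1) k m) : ℚ) •
        (LaurentPolynomial.T m : ℚ[T;T⁻¹])) =
      (∑ᶠ m : ℤ, (Module.finrank ℂ (truncHighest (N + 1) (k - 4 * ((N : ℤ) + 1)) m) : ℚ) •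
        (LaurentPolynomial.T m : ℚ[T;T⁻¹])) +
      ∑ᶠ m : ℤ, (Module.finrank ℂ (truncHighest N k m) : ℚ) •
        (LaurentPolynomial.T m : ℚ[T;T⁻¹]) := by
    rw [← finsum_add_distrib h2 h1]
    congr 1
    funext m
    rw [← add_smul, ← finrank_truncHighest_succ N k m]
    push_cast
    rfl
  rw [e]
  split_ifs with h
  · rw [show ((k - 4 * (N + 1) : ℕ) : ℤ) = (k : ℤ) - 4 * ((N : ℤ) + 1) by push_cast [h]; ring,
      add_sub_cancel_left]
  · have h0 : ∀ m, truncHighest (N + 1) ((k : ℤ) - 4 * ((N : ℤ) + 1)) m = ⊥ := fun m =>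
      eq_bot_iff.2 fun v hv => eq_zero_of_mem_fockGraded_neg (by omega) hv.1
    simp only [fun m => finrank_smul_eq_zero (h0 m), finsum_zero, zero_add, sub_zero]

theorem truncChar_zero_eq (N : ℕ) :
    truncChar 0 = qPoch (qz 4 0) (qz 4 0) N * truncChar N := by
  induction N with
  | zero => simp
  | succ N ih =>
    rw [ih, qPoch_succ, truncChar_eq N, qz_pow, qz_mul, mul_assoc]
    congr 4
    ring

/-- In degree k the truncation is the whole piece once N ≥ k, since h_n with n > N then lands in
negative degree. -/
theorem tendsto_truncChar : Tendsto truncChar atTop (𝓝 fockChar) := by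
  rw [PowerSeries.WithPiTopology.tendsto_iff_coeff_tendsto]
  intro k
  refine tendsto_const_nhds.congr' ?_
  filter_upwards [eventually_ge_atTop k] with N hN
  rw [fockChar, truncChar, coeff_mk, coeff_mk]
  congr 1
  funext m
  rw [truncHighest_eq_fockGraded (by omega)]

theorem truncChar_zero_eq_fockChar :
    truncChar 0 = qPochInf (qz 4 0) (qz 4 0) * fockChar := by
  have h := (tendsto_qPoch (qz 4 0) (X_dvd_qz (k := 4) (by norm_num) 0)).mul tendsto_truncChar
  refine tendsto_nhds_unique (tendsto_const_nhds.congr fun N => ?_) h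
  exact truncChar_zero_eq N

theorem hasSum_fockChar : HasSum (fun μ : Multiset ℕ => qz (degree μ) (charge μ)) fockChar := by
  classical
  rw [PowerSeries.WithPiTopology.hasSum_iff_hasSum_coeff]
  intro k
  rw [fockChar, coeff_mk]
  set S : Finset (Multiset ℕ) := (finite_degree_eq k).toFinset with hS
  have hmem : ∀ μ, μ ∈ S ↔ degree μ = k := fun μ => by simp [hS]
  have h1 : HasSum (fun μ => coeff k (qz (degree μ) (charge μ)))
      (∑ μ ∈ S, coeff k (qz (degree μ) (charge μ))) :=
    hasSum_sum_of_ne_finset_zero fun μ hμ => by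
      rw [qz, coeff_monomial, if_neg fun h => hμ ((hmem μ).2 h.symm)]
  suffices h : (∑ᶠ m : ℤ, (Module.finrank ℂ (FockGraded k m) : ℚ) •
      (LaurentPolynomial.T m : ℚ[T;T⁻¹])) = ∑ μ ∈ S, coeff k (qz (degree μ) (charge μ)) by
    rw [h]
    exact h1
  rw [← Finset.sum_fiberwise_of_maps_to (t := S.image charge) (g := charge)
    fun μ hμ => Finset.mem_image_of_mem _ hμ]
  rw [finsum_eq_sum_of_support_subset (s := S.image charge)]
  · refine Finset.sum_congr rfl fun m _ => ?_
    rw [Finset.sum_congr rfl fun μ hμ => show coeff k (qz (degree μ) (charge μ)) =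
      LaurentPolynomial.T m by
        rw [Finset.mem_filter, hmem] at hμ
        rw [qz, coeff_monomial, if_pos hμ.1.symm, hμ.2], Finset.sum_const, finrank_fockGraded,
      Nat.cast_smul_eq_nsmul]
    congr 1
    rw [← Set.ncard_coe_finset]
    congr 1
    ext μ
    simp [weightSet, hmem]
  · intro m hm
    have h2 : FockGraded k m ≠ ⊥ := fun h => hm (finrank_smul_eq_zero h _)
    obtain ⟨μ, h3, h4⟩ := exists_weight_of_ne_bot h2
    exact Finset.mem_coe.2 (Finset.mem_image.2 ⟨μ, (hmem μ).2 (by exact_mod_cast h3), h4⟩)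

theorem multisetTerm_qz (μ : Multiset ℕ) :
    multisetTerm (fun i => qz (2 * i + 1) ((-1) ^ i)) μ = qz (degree μ) (charge μ) := by
  induction μ using Multiset.induction_on with
  | empty => simp [degree, charge, qz_zero]
  | cons i μ ih =>
    rw [multisetTerm_cons, ih, qz_mul, degree, degree, charge, charge, Multiset.map_cons,
      Multiset.map_cons, Multiset.sum_cons, Multiset.sum_cons]

/-- The multiset series is the reciprocal of ∏(1 - w_i). Even i have charge +1 and give (b)_∞; odd i
have charge -1 and give (a)_∞. -/
theorem fockChar_eq : fockChar =
    Ring.inverse (qPochInf (qz 3 (-1)) (qz 4 0) * qPochInf (qz 1 1) (qz 4 0)) := by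
  have hQ : (X : QZ) ∣ qz 4 0 := X_dvd_qz (by norm_num) _
  have h := hasSum_multisetTerm (w := fun i => qz (2 * i + 1) ((-1) ^ i)) fun i =>
    X_pow_dvd_qz (by omega) _
  have h1 : HasProd (fun i : ℕ => 1 - qz (2 * i + 1) ((-1) ^ i))
      (qPochInf (qz 1 1) (qz 4 0) * qPochInf (qz 3 (-1)) (qz 4 0)) := by
    refine HasProd.even_mul_odd ?_ ?_
    · refine (hasProd_qPochInf (qz 1 1) hQ).congr_fun fun n => ?_
      rw [qz_mul_pow_four, Even.neg_one_pow (even_two_mul n)]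
      congr 2
      ring
    · refine (hasProd_qPochInf (qz 3 (-1)) hQ).congr_fun fun n => ?_
      rw [qz_mul_pow_four, Odd.neg_one_pow (odd_two_mul_add_one n)]
      congr 2
      ring
  rw [h1.tprod_eq, mul_comm] at h
  exact hasSum_fockChar.unique (h.congr_fun fun μ => (multisetTerm_qz μ).symm)

/-! ### The span of the highest weight vectors as the truncation N = 0 -/

theorem heis_eq_zero_of_mem_Fhwv {v : Fock} (hv : v ∈ Fhwv) {n : ℤ} (hn : 0 < n) : heis n v = 0 := by
  induction hv using Submodule.span_induction with
  | mem x h => exact h.2.1 n hn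
  | zero => exact map_zero _
  | add x y _ _ hx hy => rw [map_add, hx, hy, add_zero]
  | smul a x _ hx => rw [map_smul, hx, smul_zero]

/-- Annihilation by the positive modes is a linear condition and so passes to the span. Conversely,
a nonzero vector of fixed charge killed by them is itself a highest weight vector. -/
theorem FhwvGraded_eq (k : ℕ) (m : ℤ) : FhwvGraded k m = truncHighest 0 k m := by
  ext v
  constructor
  · rintro ⟨h1, h2, h3⟩
    refine ⟨⟨?_, h3⟩, fun n hn => heis_eq_zero_of_mem_Fhwv h1 (by exact_mod_cast hn)⟩
    rw [Int.cast_natCast]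
    exact h2
  · rintro ⟨⟨h1, h2⟩, h3⟩
    refine ⟨?_, ?_, h2⟩
    · by_cases h0 : v = 0
      · rw [h0]
        exact zero_mem _
      · exact Submodule.subset_span ⟨h0, fun n hn => h3 n (by exact_mod_cast hn), m, h2⟩
    · rw [Int.cast_natCast] at h1
      exact h1

theorem charFhwv_eq_charProduct : charFhwv = charProduct := by
  have h : charFhwv = truncChar 0 := by
    rw [charFhwv, truncChar]
    congr 1
    funext k
    congr 1
    funext m
    rw [FhwvGraded_eq]
  rw [h, truncChar_zero_eq_fockChar, fockChar_eq, charProduct]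

theorem FhwvGraded_le (k : ℕ) (m : ℤ) : FhwvGraded k m ≤ FockGraded k m := by
  rw [FhwvGraded_eq]
  exact truncHighest_le 0 k m

/-- A highest weight vector need not be homogeneous for L_0, but its graded components are still
killed by the positive modes. -/
theorem iSup_FhwvGraded : (⨆ p : ℕ × ℤ, FhwvGraded p.1 p.2) = Fhwv := by
  refine le_antisymm (iSup_le fun p v hv => hv.1) (Submodule.span_le.2 fun v hv => ?_)
  refine mem_iSup_of_gradedProj_mem fun p => ?_
  rw [FhwvGraded_eq]
  refine ⟨gradedProj_mem _ _ v, fun n hn => ?_⟩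
  rw [heis_gradedProj, hv.2.1 n (by exact_mod_cast hn), map_zero]

end CKP

end

/-! ### The main theorem -/

theorem mainTheorem2 :
    -- the character is well defined: the joint eigenspaces of `2 L_0` and `h_0` on `F^hwv_χ`
    -- are finite-dimensional, finitely many in each degree, and decompose `F^hwv_χ`
    ((∀ (k : ℕ) (m : ℤ), FiniteDimensional ℂ (FhwvGraded k m)) ∧
      (∀ k : ℕ, {m : ℤ | FhwvGraded k m ≠ ⊥}.Finite) ∧
      iSupIndep (fun p : ℕ × ℤ => FhwvGraded p.1 p.2) ∧
      (⨆ p : ℕ × ℤ, FhwvGraded p.1 p.2) = Fhwv) ∧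
    -- (1) the sum over `n ≥ 0`, `m ∈ ℤ`, `l ≥ 0` of `N'(m - l, n) z^m q^(2n + m/2)`
    HasSum (fun t : ℕ × ℤ × ℕ =>
      crankCount (t.2.1 - (t.2.2 : ℤ)) t.1 • qz (4 * (t.1 : ℤ) + t.2.1).toNat t.2.1) charFhwv ∧
    -- (2) the sum over distinct integer bipartitions of `q^W z^birank`
    HasSum (fun π : BPDI => qz (twiceW π).toNat (birank π)) charFhwv ∧
    -- (3) the product over `n + 1 = 1, 2, …`
    HasProd (fun n : ℕ =>
      (1 - qz (4 * (n + 1)) 0) *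
        Ring.inverse ((1 - qz (4 * n + 1) 1) * (1 - qz (4 * n + 3) (-1)))) charFhwv ∧
    -- (4) the sum-times-product expression: all products and sums in it converge, and it equals
    -- the character
    Multipliable (fun l : ℕ => 1 + qz (4 * l + 1) 1) ∧
    Multipliable (fun l : ℕ => 1 + qz (4 * l + 3) (-1)) ∧
    Multipliable (fun i : ℕ => (1 - qz (8 * (i + 1)) 0) * (1 + qz (4 * (i + 1)) 0)) ∧
    IsUnit (2 * ∏' i : ℕ, ((1 - qz (8 * (i + 1)) 0) * (1 + qz (4 * (i + 1)) 0))) ∧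
    Summable (fun k : ℕ => qz k (k : ℤ) * Ring.inverse (1 + qz (4 * k + 3) (-1))) ∧
    Summable (fun k : ℕ => qz (3 * k) (-(k : ℤ)) * Ring.inverse (1 + qz (4 * k + 1) 1)) ∧
    charFhwv =
      ((∏' l : ℕ, (1 + qz (4 * l + 1) 1)) * (∏' l : ℕ, (1 + qz (4 * l + 3) (-1)))) *
        Ring.inverse (2 * ∏' i : ℕ, ((1 - qz (8 * (i + 1)) 0) * (1 + qz (4 * (i + 1)) 0))) *
        ((∑' k : ℕ, (qz k (k : ℤ) * Ring.inverse (1 + qz (4 * k + 3) (-1)))) +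
          (∑' k : ℕ, (qz (3 * k) (-(k : ℤ)) * Ring.inverse (1 + qz (4 * k + 1) 1)))) := by
  rw [charFhwv_eq_charProduct]
  refine ⟨⟨fun k m => Submodule.finiteDimensional_of_le (FhwvGraded_le k m), fun k => ?_,
    iSupIndep_fockGraded.mono fun p => FhwvGraded_le p.1 p.2, iSup_FhwvGraded⟩,
    hasSum_charProduct_crank, hasSum_bipartitions, hasProd_charProduct,
    (hasProd_one_add_qz 1).multipliable, (hasProd_one_add_qz (-1)).multipliable,
    hasProd_denominator.multipliable, ?_, ?_, ?_, charProduct_eq_lambert⟩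
  · refine (finite_charges k).subset fun m hm h => hm ?_
    exact eq_bot_iff.2 ((FhwvGraded_le k m).trans h.le)
  · have hQ : PowerSeries.X ∣ qz 4 0 := X_dvd_qz (by norm_num) _
    have hQ2 : PowerSeries.X ∣ qz 4 0 ^ 2 := hQ.trans (dvd_pow_self _ two_ne_zero)
    rw [hasProd_denominator.tprod_eq]
    exact isUnit_two.mul ((isUnit_qPochInf hQ2 hQ2).mul (isUnit_qPochInf hQ.neg_right hQ))
  · simp only [lambert_left]
    exact (vanishing_lambert (X_dvd_qz (by norm_num) _) _).summable
  · simp only [lambert_right]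
    exact (vanishing_lambert (X_dvd_qz (by norm_num) _) _).summable
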